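/- **Theorem (parallel mark extractability of the watermarkable UPF from two-key equivocal PRFs).** *Algorithms and adversaries.* $\lambda$ is the security parameter; a function is negligible if it decays faster than every inverse polynomial in $\lambda$. PPT/QPT mean (uniform) probabilistic/quantum polynomial time. Adversaries are non-uniform QPT: families of polynomial-size quantum circuits with quantum advice on polynomially many qubits. Oracle queries are classical. *Two-key equivocal PRF.* A TEPRF with input length $\ell=\ell(\lambda)$ is a pair $(\mathsf{KG},\mathsf{Eval})$, where the PPT algorithm $\mathsf{KG}(1^\lambda,s^*)$, $s^*\in\{0,1\}^\ell$, outputs keys $(\mathsf{key}_0,\mathsf{key}_1)$, and the deterministic polynomial-time algorithm $\mathsf{Eval}(\mathsf{key},s)$ outputs a bit, such that $\mathsf{Eval}(\mathsf{key}_0,s)=\mathsf{Eval}(\mathsf{key}_1,s)$ for all $(\mathsf{key}_0,\mathsf{key}_1)$ in the support of $\mathsf{KG}(1^\lambda,s^*)$ and all $s\ne s^*$. It has *different values on target* if always $\mathsf{Eval}(\mathsf{key}_0,s^*)\neq\mathsf{Eval}(\mathsf{key}_1,s^*)$. It is *differing-point hiding* if for every stateful adversary $\mathcal A$ that outputs $(s^*_0,s^*_1,b)$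 and then receives $\mathsf{key}_b$, where $(\mathsf{key}_0,\mathsf{key}_1)\leftarrow\mathsf{KG}(1^\lambda,s^*_{\beta})$, the probabilities that $\mathcal A$ finally outputs $1$ for $\beta=0$ and for $\beta=1$ differ by a negligible amount. *Construction.* Let $w=w(\lambda)$ be the mark length. - $\mathsf{KG}(1^\lambda)$ samples $s^*_1,\dots,s^*_w\leftarrow\{0,1\}^\ell$ and equivocating bits $c\leftarrow\{0,1\}^w$, runs $(\mathsf{key}_{j,0},\mathsf{key}_{j,1})\leftarrow\mathsf{TEPRF.KG}(1^\lambda,s^*_j)$ for $j\in[w]$, and outputs $\mathsf{msk}=(c,\{\mathsf{key}_{j,b}\}_{j,b})$ and $\mathsf{xk}=(c,\{s^*_j\}_j,\{\mathsf{key}_{j,b}\}_{j,b})$. - $\mathsf{Mark}(\mathsf{msk},x)=\{\mathsf{key}_{j,x[j]\oplus c[j]}\}_{j\in[w]}$ for $x\in\{0,1\}^w$. - $\mathsf{Eval}$ on input $s=s_1\|\cdots\|s_w\in\{0,1\}^{w\ell}$ outputs $t_1\|\cdots\|t_w$ with $t_j=\mathsf{TEPRF.Eval}(\mathsf{key}'_j,s_j)$,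 where $\mathsf{key}'_j=\mathsf{key}_{j,0}$ for a master secret key and $\{\mathsf{key}'_j\}_j$ is the marked key otherwise. *Experiments.* For $n=n(\lambda)$ instances $(\mathsf{msk}_i,\mathsf{xk}_i)\leftarrow\mathsf{KG}(1^\lambda)$, the adversary $\mathcal A$ has access to the oracles $\mathsf{Eval}(\mathsf{msk}_i,\cdot)$, $i\in[n]$, until it receives the challenge. It chooses marks $x_1,\dots,x_n\in\{0,1\}^w$, receives $\mathsf{Mark}(\mathsf{msk}_i,x_i)$ for all $i$, and later declares itself ready. At this moment it is described by a unitary circuit $U_{\mathcal A}$ and a quantum state $\rho_{\mathcal A}$. In the *prediction experiment* it then receives uniformly random $s_1,\dots,s_n\in\{0,1\}^{w\ell}$ (and loses the oracles), applies $U_{\mathcal A}$ to them and $\rho_{\mathcal A}$, measures, and wins if the outcome $(t'_1,\dots,t'_n)$ satisfies $t'_i=\mathsf{Eval}(\mathsf{msk}_i,s_i)$ for all $i$; let $\mathrm{Adv}^{\mathrm{pre}}_{\mathcal A,n}(\lambda)$ be the winning probability. In the *extraction experiment* one instead runs $\mathsf{Ext}(\{\mathsf{xk}_i\}_i,(U_{\mathcal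 A},\rho_{\mathcal A}))\to\{x'_i\}_i$ at this moment, and $\mathrm{Adv}^{\mathrm{ext}}_{\mathcal A,\mathsf{Ext},n}(\lambda)$ is the probability that $x'_i=x_i$ for all $i$. *Claim.* Let $\ell$ and $w$ be polynomially bounded with $\ell=\omega(\log\lambda)$ and $w=\omega(\log\lambda)$, and let the TEPRF have different values on target and be differing-point hiding. Then the construction is parallel mark extractable: there is a QPT algorithm $\mathsf{Ext}$ such that for every polynomially bounded $n$ and every adversary $\mathcal A$ there is a negligible $\varepsilon$ with $$\mathrm{Adv}^{\mathrm{ext}}_{\mathcal A,\mathsf{Ext},n}(\lambda)\;\ge\;\mathrm{Adv}^{\mathrm{pre}}_{\mathcal A,n}(\lambda)-\varepsilon(\lambda)\qquad\text{for all }\lambda .$$ -/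

import Mathlib

noncomputable section

namespace WMark

/-! ### Asymptotics and finite probability -/

/-- `f` is bounded by a polynomial. -/
def PolyBounded (f : ℕ → ℕ) : Prop := ∃ p : Polynomial ℕ, ∀ κ, f κ ≤ p.eval κ

/-- `ε` is negligible: it decays faster than every inverse polynomial. -/
def Negligible (ε : ℕ → ℝ) : Prop :=
  Asymptotics.SuperpolynomialDecay Filter.atTop (fun κ : ℕ => (κ : ℝ)) ε

/-- `f = ω(log κ)`. -/
def SuperLog (f : ℕ → ℕ) : Prop :=
  (fun κ : ℕ => Real.log (κ : ℝ)) =o[Filter.atTop] (fun κ : ℕ => (f κ : ℝ))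

/-- Expectation of a real random variable under a discrete distribution. -/
def expect {α : Type} (p : PMF α) (f : α → ℝ) : ℝ := ∑' a, (p a).toReal * f a

/-- Independent samples, the `i`-th one from `p i`. -/
def indep {α : Type} : (n : ℕ) → (Fin n → PMF α) → PMF (Fin n → α)
  | 0, _ => PMF.pure Fin.elim0
  | n + 1, p => (p 0).bind fun a =>
      (indep n fun i => p i.succ).bind fun f => PMF.pure (Fin.cons a f)

/-- The first `m` bits of a string, padded with zeros where the string is too short. -/
def readBits (m : ℕ) (l : List Bool) : Fin m → Bool := fun k => l.getD k false

/-! ### Qubits and gates -/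

/-- A (not necessarily normalized) vector on qubits numbered by `ℕ`, given by its amplitudes.
The basis vector `B` is the one in which exactly the qubits in the finite set `B` are `1`. -/
abbrev Ket := Finset ℕ → ℂ

/-- All qubits are `0`. -/
def zeroKet : Ket := fun B => if B = ∅ then 1 else 0

/-- The squared norm. -/
def normSq (ψ : Ket) : ℝ := ∑' B, ‖ψ B‖ ^ 2

/-- `ψ` is a normalized state of the qubits `0, …, m - 1`, all other qubits being `0`. -/
def IsState (m : ℕ) (ψ : Ket) : Prop :=
  (∀ B, ψ B ≠ 0 → B ⊆ Finset.range m) ∧ ∑ B ∈ (Finset.range m).powerset, ‖ψ B‖ ^ 2 = 1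

/-- Gates of the universal set NOT, Hadamard, `T = diag(1, exp(iπ/4))`, CNOT, with their operands. -/
inductive Gate where
  | x (a : ℕ)
  | h (a : ℕ)
  | t (a : ℕ)
  | cnot (a b : ℕ)

def Gate.map (f : ℕ → ℕ) : Gate → Gate
  | x a => x (f a)
  | h a => h (f a)
  | t a => t (f a)
  | cnot a b => cnot (f a) (f b)

/-- The unitary of a gate whose operands are qubit numbers (`cnot a a` is the identity). -/
def Gate.apply : Gate → Ket → Ket
  | x a, ψ => fun B => ψ (symmDiff B {a})
  | h a, ψ => fun B =>
      (ψ (B.erase a) + (if a ∈ B then -1 else 1) * ψ (insert a B)) / (Real.sqrt 2 : ℂ)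
  | t a, ψ => fun B => (if a ∈ B then Complex.exp (Real.pi / 4 * Complex.I) else 1) * ψ B
  | cnot a b, ψ => fun B => ψ (if a ≠ b ∧ a ∈ B then symmDiff B {b} else B)

/-- A unitary circuit, the first gate of the list being applied first. -/
abbrev Circuit := List Gate

def Circuit.apply (C : Circuit) (ψ : Ket) : Ket := C.foldl (fun φ g => g.apply φ) ψ

/-! ### Encoding of data as bit strings -/

def encNat (a : ℕ) : List Bool := List.replicate a true ++ [false]

/-- Self-delimiting encoding of a list, for a self-delimiting encoding `f` of its items. -/
def encList {α : Type} (f : α → List Bool) (l : List α) : List Bool :=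
  (l.flatMap fun a => true :: f a) ++ [false]

def encStr (l : List Bool) : List Bool := encList (fun b => [b]) l

def encGate : Gate → List Bool
  | .x a => [false, false] ++ encNat a
  | .h a => [false, true] ++ encNat a
  | .t a => [true, false] ++ encNat a
  | .cnot a b => [true, true] ++ encNat a ++ encNat b

def encCircuit (C : Circuit) : List Bool := encList encGate C

/-! ### The machine model

A machine has classical registers, numbered by `ℕ`, each holding a stack of bits, and qubits,
numbered by `ℕ`. A program controls both. -/

structure State where
  reg : ℕ → List Bool
  ket : Ket

def State.set (σ : State) (r : ℕ) (l : List Bool) : State :=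
  ⟨Function.update σ.reg r l, σ.ket⟩

/-- Elementary instructions. A qubit is addressed by the length of a register: the operands of the
gate in `gate g`, and the first argument of `measure`, are registers.
`call i r r'` queries the `i`-th oracle on the content of register `r` and puts the answer
into register `r'`. -/
inductive Instr where
  | push (r : ℕ) (b : Bool)
  | pop (r : ℕ)
  | coin (r : ℕ)
  | gate (g : Gate)
  | measure (r r' : ℕ)
  | call (i r r' : ℕ)

/-- Classical oracles, numbered by `ℕ`. -/
abbrev Oracle := ℕ → List Bool → List Bool

def noOracle : Oracle := fun _ _ => []

/-- The possible successor states. The squared norm of the vector in a state is the probability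
of the branch that leads to it, so vectors are not renormalized. -/
def Instr.apply (O : Oracle) : Instr → State → List State
  | push r b, σ => [σ.set r (b :: σ.reg r)]
  | pop r, σ => [σ.set r (σ.reg r).tail]
  | coin r, σ => [false, true].map fun b =>
      ⟨Function.update σ.reg r (b :: σ.reg r), fun B => σ.ket B / (Real.sqrt 2 : ℂ)⟩
  | gate g, σ => [⟨σ.reg, (g.map fun r => (σ.reg r).length).apply σ.ket⟩]
  | measure r r', σ => [false, true].map fun b =>
      ⟨Function.update σ.reg r' (b :: σ.reg r'),
        fun B => if decide ((σ.reg r).length ∈ B) = b then σ.ket B else 0⟩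
  | call i r r', σ => [σ.set r' (O i (σ.reg r))]

/-- Programs. `ite r a b c` runs `a`, `b` or `c` according to whether the top of register `r` is
`1`, is `0`, or does not exist; `loop r a` repeats `a` as long as register `r` is not empty. -/
inductive Code where
  | skip
  | instr (i : Instr)
  | seq (a b : Code)
  | ite (r : ℕ) (a b c : Code)
  | loop (r : ℕ) (a : Code)

/-- One step of computation; a configuration consists of the programs still to be run and the
current state, and it has halted when no program is left. -/
def step (O : Oracle) : List Code × State → List (List Code × State)
  | ([], σ) => [([], σ)]
  | (Code.skip :: k, σ) => [(k, σ)]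
  | (Code.instr i :: k, σ) => (i.apply O σ).map fun σ' => (k, σ')
  | (Code.seq a b :: k, σ) => [(a :: b :: k, σ)]
  | (Code.ite r a b c :: k, σ) =>
      match σ.reg r with
      | [] => [(c :: k, σ)]
      | true :: _ => [(a :: k, σ)]
      | false :: _ => [(b :: k, σ)]
  | (Code.loop r a :: k, σ) =>
      match σ.reg r with
      | [] => [(k, σ)]
      | _ :: _ => [(a :: Code.loop r a :: k, σ)]

/-- All branches of the computation after `t` steps. -/
def configs (O : Oracle) (t : ℕ) (a : Code) (σ : State) : List (List Code × State) :=
  (fun L => L.flatMap (step O))^[t] [([a], σ)]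

/-- Every branch halts within `t` steps. -/
def HaltsIn (O : Oracle) (t : ℕ) (a : Code) (σ : State) : Prop :=
  ∀ γ ∈ configs O t a σ, γ.1 = []

/-- The states of all branches after `t` steps. -/
def exec (O : Oracle) (t : ℕ) (a : Code) (σ : State) : List State :=
  (configs O t a σ).map Prod.snd

open Classical in
/-- The probability of the branches in `L` that satisfy `E`. -/
def weight (L : List State) (E : State → Prop) : ℝ :=
  (L.map fun σ => if E σ then normSq σ.ket else 0).sum

/-- The state with input strings `a` and `b` in registers `0` and `1`. -/
def inputState (a b : List Bool) (ψ : Ket) : State :=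
  ⟨fun r => if r = 0 then a else if r = 1 then b else [], ψ⟩

/-- All instructions of the program satisfy `P`. -/
def Code.All (P : Instr → Prop) : Code → Prop
  | skip => True
  | instr i => P i
  | seq a b => a.All P ∧ b.All P
  | ite _ a b c => a.All P ∧ b.All P ∧ c.All P
  | loop _ a => a.All P

def Instr.IsDeterministic : Instr → Prop
  | push _ _ => True
  | pop _ => True
  | _ => False

def Instr.IsClassical : Instr → Prop
  | push _ _ => True
  | pop _ => True
  | coin _ => True
  | _ => False

def Code.LoopFree : Code → Prop
  | skip => True
  | instr _ => True
  | seq a b => a.LoopFree ∧ b.LoopFree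
  | ite _ a b c => a.LoopFree ∧ b.LoopFree ∧ c.LoopFree
  | loop _ _ => False

/-- The size of a program. A loop-free program halts within that many steps. -/
def Code.size : Code → ℕ
  | skip => 1
  | instr _ => 1
  | seq a b => a.size + b.size + 1
  | ite _ a b c => a.size + b.size + c.size + 1
  | loop _ a => a.size + 1

/-- A family of polynomial-size programs without loops: the non-uniform model of polynomial-time
computation, by circuits (here with classical control). -/
def PolySize (a : ℕ → Code) : Prop :=
  (∀ κ, (a κ).LoopFree) ∧ PolyBounded fun κ => (a κ).size

/-- The branches of a loop-free program when it has halted. -/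
def Code.run (O : Oracle) (a : Code) (σ : State) : List State := exec O a.size a σ

/-! ### Two-key equivocal PRFs -/

/-- A two-key equivocal PRF with input length `ℓ` and output length `1`: a probabilistic
polynomial-time key generation, a deterministic polynomial-time evaluation, and equality of the
two keys outside the differing point. -/
structure TEPRF (ℓ : ℕ → ℕ) where
  KG : (κ : ℕ) → (Fin (ℓ κ) → Bool) → PMF (List Bool × List Bool)
  Eval : List Bool → List Bool → Bool
  kg_ppt : ∃ (a : Code) (T : Polynomial ℕ), a.All Instr.IsClassical ∧
    ∀ (κ : ℕ) (s : Fin (ℓ κ) → Bool),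
      HaltsIn noOracle (T.eval (κ + ℓ κ)) a
        (inputState (List.replicate κ true) (List.ofFn s) zeroKet) ∧
      ∀ key : List Bool × List Bool, (KG κ s key).toReal =
        weight (exec noOracle (T.eval (κ + ℓ κ)) a
          (inputState (List.replicate κ true) (List.ofFn s) zeroKet))
          (fun σ => σ.reg 0 = key.1 ∧ σ.reg 1 = key.2)
  eval_poly : ∃ (a : Code) (T : Polynomial ℕ), a.All Instr.IsDeterministic ∧
    ∀ key s : List Bool,
      HaltsIn noOracle (T.eval (key.length + s.length)) a (inputState key s zeroKet) ∧
      ∀ σ ∈ exec noOracle (T.eval (key.length + s.length)) a (inputState key s zeroKet),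
        σ.reg 0 = [Eval key s]
  equality : ∀ (κ : ℕ) (s' : Fin (ℓ κ) → Bool), ∀ key ∈ (KG κ s').support,
    ∀ s : Fin (ℓ κ) → Bool, s ≠ s' → Eval key.1 (List.ofFn s) = Eval key.2 (List.ofFn s)

def TEPRF.DifferentValuesOnTarget {ℓ : ℕ → ℕ} (F : TEPRF ℓ) : Prop :=
  ∀ (κ : ℕ) (s' : Fin (ℓ κ) → Bool), ∀ key ∈ (F.KG κ s').support,
    F.Eval key.1 (List.ofFn s') ≠ F.Eval key.2 (List.ofFn s')

/-- A two-stage non-uniform quantum polynomial-time adversary with quantum advice. -/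
structure HidingAdversary where
  choose : ℕ → Code
  guess : ℕ → Code
  qubits : ℕ → ℕ
  advice : ℕ → Ket
  choose_poly : PolySize choose
  guess_poly : PolySize guess
  qubits_poly : PolyBounded qubits
  advice_state : ∀ κ, IsState (qubits κ) (advice κ)

/-- The probability that the adversary outputs `1` when the differing point is the first
(`coin = false`) or the second (`coin = true`) of the two points it chooses. It leaves the two
points in registers `0` and `1` and the bit `b` on top of register `2`; it then finds the `b`-th key
in register `0` and leaves its output on top of register `0`. -/
def TEPRF.hidingProb {ℓ : ℕ → ℕ} (F : TEPRF ℓ) (A : HidingAdversary) (coin : Bool) (κ : ℕ) : ℝ :=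
  (((A.choose κ).run noOracle ⟨fun _ => [], A.advice κ⟩).map fun σ =>
    expect (F.KG κ (readBits (ℓ κ) (σ.reg (if coin then 1 else 0)))) fun key =>
      weight ((A.guess κ).run noOracle
          (σ.set 0 (if (σ.reg 2).headD false then key.2 else key.1)))
        (fun σ' => (σ'.reg 0).headD false = true)).sum

def TEPRF.DifferingPointHiding {ℓ : ℕ → ℕ} (F : TEPRF ℓ) : Prop :=
  ∀ A : HidingAdversary, Negligible fun κ => |F.hidingProb A false κ - F.hidingProb A true κ|

/-! ### Watermarkable unpredictable functions -/

/-- A watermarkable unpredictable function with inputs, marks and outputs of `inLen`, `markLen` and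
`outLen` bits. `evalMsk` and `evalKey` are the two uses of the evaluation algorithm, with the master
secret key and with a marked key. Marked keys and extraction keys, which are inputs of other
algorithms, come with their encodings as strings. -/
structure WUPF where
  inLen : ℕ → ℕ
  markLen : ℕ → ℕ
  outLen : ℕ → ℕ
  Msk : ℕ → Type
  Xk : ℕ → Type
  Key : ℕ → Type
  encXk : {κ : ℕ} → Xk κ → List Bool
  encKey : {κ : ℕ} → Key κ → List Bool
  KG : (κ : ℕ) → PMF (Msk κ × Xk κ)
  mark : {κ : ℕ} → Msk κ → (Fin (markLen κ) → Bool) → Key κ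
  evalMsk : {κ : ℕ} → Msk κ → (Fin (inLen κ) → Bool) → (Fin (outLen κ) → Bool)
  evalKey : {κ : ℕ} → Key κ → (Fin (inLen κ) → Bool) → (Fin (outLen κ) → Bool)

/-- A non-uniform quantum polynomial-time adversary with quantum advice: its programs before and
after it has chosen the marks, and the unitary circuit that it applies to the challenge
and to the quantum state it then has. As the adversary is non-uniform, the security parameter and
the number of instances are hard-wired; classical information that the circuit needs has been
written into qubits before. -/
structure ParAdversary where
  preMark : ℕ → Code
  postMark : ℕ → Code
  predictor : ℕ → Circuit
  qubits : ℕ → ℕ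
  advice : ℕ → Ket
  preMark_poly : PolySize preMark
  postMark_poly : PolySize postMark
  predictor_poly : PolyBounded fun κ => (encCircuit (predictor κ)).length
  qubits_poly : PolyBounded qubits
  advice_state : ∀ κ, IsState (qubits κ) (advice κ)

/-- Writes (by XOR) the challenge `s 0 ‖ s 1 ‖ …` into the qubits `0, 1, 2, …`. -/
def loadInput {n m : ℕ} (s : Fin n → Fin m → Bool) (ψ : Ket) : Ket := fun B =>
  ψ (symmDiff B
    ((Finset.univ.filter fun q : Fin n × Fin m => s q.1 q.2 = true).image
      fun q => q.1.val * m + q.2.val))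

open Classical in
/-- The probability that measuring the qubits `0, 1, 2, …` yields `t 0 ‖ t 1 ‖ …`. -/
def outputProb {n v : ℕ} (ψ : Ket) (t : Fin n → Fin v → Bool) : ℝ :=
  ∑' B, if ∀ i j, decide (i.val * v + j.val ∈ B) = t i j then ‖ψ B‖ ^ 2 else 0

namespace WUPF

variable (W : WUPF)

/-- The evaluation oracles `evalMsk (msk i)` for `i < n`. -/
def oracle {κ n : ℕ} (k : Fin n → W.Msk κ × W.Xk κ) : Oracle := fun i q =>
  if hi : i < n then List.ofFn (W.evalMsk (k ⟨i, hi⟩).1 (readBits (W.inLen κ) q)) else []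

/-- The marks `x 0 ‖ x 1 ‖ …` in a string. -/
def readMarks (κ n : ℕ) (l : List Bool) : Fin n → Fin (W.markLen κ) → Bool :=
  fun i j => l.getD (i.val * W.markLen κ + j.val) false

/-- The experiment with `n` instances up to the moment right before the challenge is sent. The
adversary has access to the evaluation oracles throughout, leaves its marks in register `0`, and
then finds the marked keys there. Then `final` is the probability of winning, given
the keys of all instances, the marks and the quantum state of the adversary. -/
def experiment (n : ℕ) (A : ParAdversary) (κ : ℕ)
    (final : (Fin n → W.Msk κ × W.Xk κ) → (Fin n → Fin (W.markLen κ) → Bool) → Ket → ℝ) : ℝ :=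
  expect (indep n fun _ => W.KG κ) fun k =>
    (((A.preMark κ).run (W.oracle k) ⟨fun _ => [], A.advice κ⟩).map fun σ =>
      let x := W.readMarks κ n (σ.reg 0)
      let keys := encList W.encKey (List.ofFn fun i => W.mark (k i).1 (x i))
      (((A.postMark κ).run (W.oracle k) (σ.set 0 keys)).map fun σ' => final k x σ'.ket).sum).sum

/-- The parallel prediction experiment: the circuit of the adversary is applied to uniformly random
inputs and the state of the adversary, and it has to output the values at all inputs. -/
def predictionProb (n : ℕ) (A : ParAdversary) (κ : ℕ) : ℝ :=
  W.experiment n A κ fun k _ ψ =>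
    expect (PMF.uniformOfFintype (Fin n → Fin (W.inLen κ) → Bool)) fun s =>
      outputProb ((A.predictor κ).apply (loadInput s ψ)) fun i => W.evalMsk (k i).1 (s i)

/-- The input of an extractor: the extraction keys in register `0`, the description of the circuit
of the adversary in register `1`, and the state of the adversary in the qubits. -/
def extInput {κ n : ℕ} (xk : Fin n → W.Xk κ) (C : Circuit) (ψ : Ket) : State :=
  inputState (encList W.encXk (List.ofFn xk)) (encCircuit C) ψ

/-- The time that an extractor with time bound `T` has on this input. -/
def extTime (T : Polynomial ℕ) {κ n : ℕ} (xk : Fin n → W.Xk κ) (C : Circuit) : ℕ :=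
  T.eval ((encList W.encXk (List.ofFn xk)).length + (encCircuit C).length)

/-- The parallel extraction experiment for the extractor `E` with time bound `T`, which has to
leave the marks `x 0 ‖ x 1 ‖ …` in register `0`. -/
def extractionProb (E : Code) (T : Polynomial ℕ) (n : ℕ) (A : ParAdversary) (κ : ℕ) : ℝ :=
  W.experiment n A κ fun k x ψ =>
    let xk := fun i => (k i).2
    weight (exec noOracle (W.extTime T xk (A.predictor κ)) E (W.extInput xk (A.predictor κ) ψ))
      fun σ => σ.reg 0 = (List.ofFn fun i => List.ofFn (x i)).flatten

/-- There is a (uniform) quantum polynomial-time extractor that works for every polynomial number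
of instances and every adversary. -/
def ParallelMarkExtractable : Prop :=
  ∃ (E : Code) (T : Polynomial ℕ),
    (∀ (κ n : ℕ) (xk : Fin n → W.Xk κ) (C : Circuit) (ψ : Ket),
      HaltsIn noOracle (W.extTime T xk C) E (W.extInput xk C ψ)) ∧
    ∀ n : ℕ → ℕ, PolyBounded n → ∀ A : ParAdversary,
      ∃ ε : ℕ → ℝ, Negligible ε ∧
        ∀ κ, W.extractionProb E T (n κ) A κ ≥ W.predictionProb (n κ) A κ - ε κ

end WUPF

/-! ### The construction -/

/-- The `j`-th of the `w` blocks of a string of `w * l` bits. -/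
def block {w l : ℕ} (s : Fin (w * l) → Bool) (j : Fin w) : List Bool :=
  List.ofFn fun k : Fin l => s (finProdFinEquiv (j, k))

/-- The watermarkable unpredictable function with mark length `w` built from a two-key equivocal PRF:
`msk = (c, keys)`, `xk = (c, differing points, keys)`, where `c` are the equivocating bits and
`keys j b` is the `b`-th key of the `j`-th instance of the PRF. -/
def TEPRF.toWUPF {ℓ : ℕ → ℕ} (F : TEPRF ℓ) (w : ℕ → ℕ) : WUPF where
  inLen κ := w κ * ℓ κ
  markLen := w
  outLen := w
  Msk κ := (Fin (w κ) → Bool) × (Fin (w κ) → Bool → List Bool)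
  Xk κ := (Fin (w κ) → Bool) × (Fin (w κ) → Fin (ℓ κ) → Bool) × (Fin (w κ) → Bool → List Bool)
  Key κ := Fin (w κ) → List Bool
  encXk xk := encList id (List.ofFn fun j =>
    xk.1 j :: (encStr (List.ofFn (xk.2.1 j)) ++ encStr (xk.2.2 j false) ++ encStr (xk.2.2 j true)))
  encKey key := encList encStr (List.ofFn key)
  KG κ :=
    (PMF.uniformOfFintype (Fin (w κ) → Fin (ℓ κ) → Bool)).bind fun s =>
    (PMF.uniformOfFintype (Fin (w κ) → Bool)).bind fun c =>
    (indep (w κ) fun j => F.KG κ (s j)).bind fun k =>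
      let keys : Fin (w κ) → Bool → List Bool := fun j b => if b then (k j).2 else (k j).1
      PMF.pure ((c, keys), (c, s, keys))
  mark msk x := fun j => msk.2 j (xor (x j) (msk.1 j))
  evalMsk msk s := fun j => F.Eval (msk.2 j false) (block s j)
  evalKey key s := fun j => F.Eval (key j) (block s j)

end WMark

end

noncomputable section

namespace WMark

/-! ### Runs of programs -/

/-! The extractor challenges the adversary at the differing points instead of at random points. It
loads the points s* of all n·w instances of the PRF into the qubits, applies the circuit, measures,
and adds to each outcome the bit c ⊕ Eval(key₀, s*). Since the two keys disagree at s*, the marked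
key, which has index x ⊕ c, takes there the value Eval(key₀, s*) ⊕ x ⊕ c. So the marks come out
exactly if the adversary's answers are the values of the marked keys at all differing points. What
remains is to compare two challenges to the same adversary: uniform points checked against key₀
(`preSpec`), and differing points checked against the marked key (`extSpec`).

Both winning probabilities are averages of `game` over independent samples, one for each pair (i,
j): `TEPRF.Bounded.predictionProb_eq` and `TEPRF.Bounded.extractionProb_eq`. This form is available
because the oracles use key₀ only: up to the choice of marks nothing depends on c, hence b = x ⊕ c,
the index of the marked key, is uniform and can be drawn in advance (`TEPRF.Bounded.experiment_eq`).
`hybrid_le` then switches the pairs from one specification to the other one at a time.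

For a single pair (`sum_preSpec_le`), everything the adversary meets can be expressed by the one key
it is given: key₀ is the marked key with its value flipped at s* if b = 1 and the marked key itself
if b = 0, and at a challenge h ≠ s* the expected answer is that of the marked key (`preSpec_eq`,
`extSpec_eq`). Differing-point hiding allows the key to be generated for a fixed point instead of
s*, at cost δ. Then s* occurs only as the point where the oracle is flipped and, in the extraction
game, as the challenge. The flip is noticed only by a query at s*. Queries are classical and each
hits at most one point, so on average over s* removing the flip costs at most q/2^ℓ, where the sizes
of the two programs bound the number q of queries (`sum_abs_game_sub_le`, from `Code.abs_val_sub_le`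
and `Code.sum_hits_le`). Without the flip, a uniform challenge and a uniform differing point are the
same thing. Adding the collision h = s*, one pair costs at most 2δ + (2q + 1)/2^ℓ.

A single negligible δ has to serve for all hybrids. As adversaries are non-uniform, the reduction
draws nothing at random: keys of all other pairs, challenges, candidate points and b are hard-wired.
Keys have polynomially bounded length (`TEPRF.exists_bounded`), so for each security parameter there
are finitely many choices, and the worst one defines one adversary against hiding
(`exists_hiding_bound`).

The rest of the work makes the extractor and the reduction concrete programs with verified outcomes
and running times. The reduction replaces oracle calls by evaluations of stored keys
(`runs_simCode`) and reuses the extractor to test the answers (`Runs.exists_guessCode`). It is first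
written with loops and then unrolled: a program that halts within N steps on an input has there the
same branches as its N-fold unrolling (`Runs.den_unroll`), whose size is polynomial in N because the
nesting depth of loops is constant (`Code.size_unroll_le`). -/

/-- All branches after `t` steps from a configuration. -/
def outs (O : Oracle) (t : ℕ) (γ : List Code × State) : List (List Code × State) :=
  (fun L => L.flatMap (step O))^[t] [γ]

theorem iterate_flatMap {α : Type} (f : α → List α) (t : ℕ) (L : List α) :
    (fun L => L.flatMap f)^[t] L = L.flatMap fun a => (fun L => L.flatMap f)^[t] [a] := by
  induction t generalizing L with
  | zero => simp
  | succ t ih =>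
    rw [Function.iterate_succ_apply, ih, List.flatMap_assoc]
    congr 1; funext a
    rw [Function.iterate_succ_apply, ih ([a].flatMap f)]
    simp

theorem outs_zero (O : Oracle) (γ : List Code × State) : outs O 0 γ = [γ] := rfl

theorem outs_succ (O : Oracle) (t : ℕ) (γ : List Code × State) :
    outs O (t + 1) γ = (step O γ).flatMap (outs O t) := by
  unfold outs
  rw [Function.iterate_succ_apply, iterate_flatMap]
  simp

theorem outs_succ' (O : Oracle) (t : ℕ) (γ : List Code × State) :
    outs O (t + 1) γ = (outs O t γ).flatMap (step O) := by
  unfold outs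
  rw [Function.iterate_succ_apply']

/-- Every branch of the programs `ks`, run one after the other, halts within `t` steps,
and `L` lists the final states. -/
def Runs (O : Oracle) (ks : List Code) (σ : State) (t : ℕ) (L : List State) : Prop :=
  outs O t (ks, σ) = L.map fun σ' => ([], σ')

theorem Runs.nil (O : Oracle) (σ : State) (t : ℕ) : Runs O [] σ t [σ] := by
  induction t with
  | zero => rfl
  | succ t ih =>
    unfold Runs at *
    rw [outs_succ']
    rw [ih]; simp [step]

theorem Runs.succ {O : Oracle} {ks : List Code} {σ : State} {t : ℕ} {L : List State}
    (h : Runs O ks σ t L) : Runs O ks σ (t + 1) L := by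
  unfold Runs at *
  rw [outs_succ', h, List.flatMap_map, List.map_eq_flatMap]
  rfl

theorem Runs.mono {O : Oracle} {ks : List Code} {σ : State} {t t' : ℕ} {L : List State}
    (h : Runs O ks σ t L) (ht : t ≤ t') : Runs O ks σ t' L := by
  induction ht with
  | refl => exact h
  | step _ ih => exact ih.succ

theorem Runs.of_step {O : Oracle} {ks ks' : List Code} {σ σ' : State} {t : ℕ} {L : List State}
    (hs : step O (ks, σ) = [(ks', σ')]) (h : Runs O ks' σ' t L) : Runs O ks σ (t + 1) L := by
  unfold Runs at *
  rw [outs_succ, hs]; simpa using h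

/-- A step looks only at the head of the stack of programs, so programs waiting behind it cannot
influence it. -/
theorem step_append (O : Oracle) (a : Code) (ks k : List Code) (σ : State) :
    step O (a :: ks ++ k, σ) = (step O (a :: ks, σ)).map fun γ => (γ.1 ++ k, γ.2) := by
  cases a with
  | skip => simp [step]
  | instr i => simp [step]
  | seq a b => simp [step]
  | ite r a b c =>
    simp only [step, List.cons_append]
    rcases σ.reg r with _ | ⟨_ | _, l⟩ <;> simp
  | loop r a =>
    simp only [step, List.cons_append]
    rcases σ.reg r with _ | ⟨_ | _, l⟩ <;> simp

/-- Branches may finish the first stack at different moments, whereas `t` is a common bound. A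
branch that is early simply starts `k` earlier, and this does no harm because halted configurations
stay put, so that `Runs.mono` absorbs the spare time. -/
theorem outs_append {O : Oracle} {k : List Code} {t' : ℕ} {M : State → List State} (t : ℕ) :
    ∀ (ks : List Code) (σ : State), (∀ γ ∈ outs O t (ks, σ), γ.1 = []) →
    (∀ γ ∈ outs O t (ks, σ), Runs O k γ.2 t' (M γ.2)) →
    Runs O (ks ++ k) σ (t + t') ((outs O t (ks, σ)).flatMap fun γ => M γ.2) := by
  induction t with
  | zero =>
    intro ks σ h1 h2
    simp only [outs_zero, List.mem_singleton, forall_eq] at h1 h2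
    subst h1
    simpa [outs_zero] using h2
  | succ t ih =>
    intro ks σ h1 h2
    rcases ks with _ | ⟨a, ks⟩
    · have h0 : outs O (t + 1) ([], σ) = [([], σ)] := Runs.nil O σ (t + 1)
      rw [h0] at h2 ⊢
      simp only [List.mem_singleton, forall_eq] at h2
      simpa using h2.mono (by omega)
    · simp only [outs_succ, List.mem_flatMap] at h1 h2
      unfold Runs
      rw [show t + 1 + t' = (t + t') + 1 by omega, outs_succ, step_append, List.flatMap_map,
        outs_succ, List.flatMap_assoc, List.map_flatMap]
      have : ∀ γ ∈ step O (a :: ks, σ), outs O (t + t') (γ.1 ++ k, γ.2) =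
          ((outs O t γ).flatMap fun γ => M γ.2).map fun σ' => ([], σ') := fun γ hγ =>
        ih γ.1 γ.2 (fun γ' h' => h1 γ' ⟨γ, hγ, h'⟩) (fun γ' h' => h2 γ' ⟨γ, hγ, h'⟩)
      simp only [List.flatMap_def]
      rw [List.map_congr_left this]
      simp only [List.flatMap_def]

theorem Runs.append {O : Oracle} {ks k : List Code} {σ : State} {t t' : ℕ} {L : List State}
    {M : State → List State} (h : Runs O ks σ t L) (h' : ∀ σ' ∈ L, Runs O k σ' t' (M σ')) :
    Runs O (ks ++ k) σ (t + t') (L.flatMap M) := by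
  have := outs_append (O := O) (k := k) (t' := t') (M := M) t ks σ
  unfold Runs at h
  rw [h] at this
  simpa [List.flatMap_map] using this (by simp) (by simpa using h')

theorem Runs.seq {O : Oracle} {a b : Code} {σ : State} {t t' : ℕ} {L : List State}
    {M : State → List State} (h : Runs O [a] σ t L) (h' : ∀ σ' ∈ L, Runs O [b] σ' t' (M σ')) :
    Runs O [.seq a b] σ (t + t' + 1) (L.flatMap M) :=
  Runs.of_step rfl (Runs.append (ks := [a]) (k := [b]) h h')

theorem Runs.loop {O : Oracle} {a : Code} {r : ℕ} {σ : State} {t t' : ℕ} {L : List State}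
    {M : State → List State} (hr : σ.reg r ≠ []) (h : Runs O [a] σ t L)
    (h' : ∀ σ' ∈ L, Runs O [.loop r a] σ' t' (M σ')) :
    Runs O [.loop r a] σ (t + t' + 1) (L.flatMap M) := by
  refine Runs.of_step ?_ (Runs.append (ks := [a]) (k := [.loop r a]) h h')
  simp only [step]
  rcases hl : σ.reg r with _ | ⟨_ | _, l⟩
  · exact absurd hl hr
  all_goals rfl

theorem Runs.instr (O : Oracle) (i : Instr) (σ : State) :
    Runs O [.instr i] σ 1 (i.apply O σ) := by
  unfold Runs
  rw [outs_succ]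
  simp only [step]
  rw [List.flatMap_map, List.map_eq_flatMap]
  rfl

theorem Runs.haltsIn {O : Oracle} {a : Code} {σ : State} {t t' : ℕ} {L : List State}
    (h : Runs O [a] σ t L) (ht : t ≤ t') : HaltsIn O t' a σ := by
  have h1 : configs O t' a σ = _ := h.mono ht
  intro γ hγ
  rw [h1] at hγ
  simp only [List.mem_map] at hγ
  obtain ⟨_, _, rfl⟩ := hγ
  rfl

theorem Runs.exec {O : Oracle} {a : Code} {σ : State} {t t' : ℕ} {L : List State}
    (h : Runs O [a] σ t L) (ht : t ≤ t') : exec O t' a σ = L := by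
  have h1 : configs O t' a σ = _ := h.mono ht
  simp [WMark.exec, h1, Function.comp_def]

theorem HaltsIn.runs {O : Oracle} {a : Code} {σ : State} {t : ℕ} (h : HaltsIn O t a σ) :
    Runs O [a] σ t (WMark.exec O t a σ) := by
  unfold Runs WMark.exec
  change configs O t a σ = _
  rw [List.map_map]
  conv_lhs => rw [← List.map_id (configs O t a σ)]
  refine List.map_congr_left fun γ hγ => ?_
  have := h γ hγ
  rcases γ with ⟨ks, σ'⟩
  simp at this
  simp [this]

/-! ### Runs with a single branch -/

/-- `a` has a single branch from `σ`, which halts in `σ'` within `t` steps. -/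
def Det (O : Oracle) (a : Code) (σ : State) (t : ℕ) (σ' : State) : Prop :=
  Runs O [a] σ t [σ']

section Det

variable {O : Oracle} {a b c : Code} {σ σ' σ'' : State} {t t' r : ℕ}

theorem Det.mono (h : Det O a σ t σ') (ht : t ≤ t') : Det O a σ t' σ' := Runs.mono h ht

theorem Det.congr (h : Det O a σ t σ') (ht : t ≤ t') (hσ : σ' = σ'') : Det O a σ t' σ'' :=
  hσ ▸ Runs.mono h ht

theorem Det.skip : Det O .skip σ 1 σ := Runs.of_step rfl (Runs.nil O σ 0)

theorem Det.push {x : Bool} : Det O (.instr (.push r x)) σ 1 (σ.set r (x :: σ.reg r)) :=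
  Runs.instr O _ σ

theorem Det.pop : Det O (.instr (.pop r)) σ 1 (σ.set r (σ.reg r).tail) := Runs.instr O _ σ

theorem Det.gate {g : Gate} : Det O (.instr (.gate g)) σ 1
    ⟨σ.reg, (g.map fun r => (σ.reg r).length).apply σ.ket⟩ := Runs.instr O _ σ

theorem Det.seq (h : Det O a σ t σ') (h' : Det O b σ' t' σ'') :
    Det O (.seq a b) σ (t + t' + 1) σ'' := by
  have := Runs.seq (M := fun _ => [σ'']) h (t' := t') (b := b) (by simp only [List.mem_singleton, forall_eq]; exact h')
  simpa [Det] using this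

theorem Det.seqRuns {L : List State} (h : Det O a σ t σ') (h' : Runs O [b] σ' t' L) :
    Runs O [.seq a b] σ (t + t' + 1) L := by
  have := Runs.seq (M := fun _ => L) h (t' := t') (b := b) (by simpa using h')
  simpa using this

theorem Det.ite_true {l : List Bool} (hr : σ.reg r = true :: l) (h : Det O a σ t σ') :
    Det O (.ite r a b c) σ (t + 1) σ' := Runs.of_step (by simp [step, hr]) h

theorem Det.ite_false {l : List Bool} (hr : σ.reg r = false :: l) (h : Det O b σ t σ') :
    Det O (.ite r a b c) σ (t + 1) σ' := Runs.of_step (by simp [step, hr]) h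

theorem Det.ite_nil (hr : σ.reg r = []) (h : Det O c σ t σ') :
    Det O (.ite r a b c) σ (t + 1) σ' := Runs.of_step (by simp [step, hr]) h

theorem Det.loop_nil (hr : σ.reg r = []) : Det O (.loop r a) σ 1 σ :=
  Runs.of_step (by simp only [step, hr]) (Runs.nil O σ 0)

theorem Det.loop_cons (hr : σ.reg r ≠ []) (h : Det O a σ t σ')
    (h' : Det O (.loop r a) σ' t' σ'') : Det O (.loop r a) σ (t + t' + 1) σ'' := by
  have := Runs.loop (M := fun _ => [σ'']) hr h (t' := t') (by simp only [List.mem_singleton, forall_eq]; exact h')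
  simpa [Det] using this

end Det

/-! ### The meaning of programs without loops -/

/-- The final states of all branches of a loop-free program. -/
def Code.den (O : Oracle) : Code → State → List State
  | skip, σ => [σ]
  | instr i, σ => i.apply O σ
  | seq a b, σ => (a.den O σ).flatMap (b.den O)
  | ite r a b c, σ =>
      match σ.reg r with
      | [] => c.den O σ
      | true :: _ => a.den O σ
      | false :: _ => b.den O σ
  -- A default value that keeps the list of branches nonempty and the norm unchanged; it is compared
  -- with actual runs only for loop-free programs.
  | loop _ _, σ => [σ]

/-- Needed in `splits_unroll`: some branch must reach the remaining programs in order to conclude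
that steps are left for them. -/
theorem Code.den_ne_nil (O : Oracle) (a : Code) (σ : State) : a.den O σ ≠ [] := by
  induction a generalizing σ with
  | skip => simp [den]
  | instr i => cases i <;> simp [den, Instr.apply]
  | seq a b iha ihb =>
    obtain ⟨σ', h⟩ := List.exists_mem_of_ne_nil _ (iha σ)
    obtain ⟨σ'', h'⟩ := List.exists_mem_of_ne_nil _ (ihb σ')
    exact List.ne_nil_of_mem (List.mem_flatMap.2 ⟨σ', h, h'⟩)
  | ite r a b c iha ihb ihc =>
    simp only [den]
    rcases σ.reg r with _ | ⟨_ | _, l⟩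
    exacts [ihc σ, ihb σ, iha σ]
  | loop r a _ => simp [den]

theorem Code.LoopFree.runs {O : Oracle} {a : Code} (h : a.LoopFree) (σ : State) :
    Runs O [a] σ a.size (a.den O σ) := by
  induction a generalizing σ with
  | skip => exact Det.skip
  | instr i => exact Runs.instr O i σ
  | seq a b iha ihb => exact Runs.seq (iha h.1 σ) fun σ' _ => ihb h.2 σ'
  | ite r a b c iha ihb ihc =>
    simp only [Code.den, Code.size]
    rcases hr : σ.reg r with _ | ⟨_ | _, l⟩
    · exact Runs.of_step (by simp [step, hr]) ((ihc h.2.2 σ).mono (by omega))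
    · exact Runs.of_step (by simp [step, hr]) ((ihb h.2.1 σ).mono (by omega))
    · exact Runs.of_step (by simp [step, hr]) ((iha h.1 σ).mono (by omega))
  | loop r a _ => exact h.elim

theorem Code.LoopFree.run_eq {O : Oracle} {a : Code} (h : a.LoopFree) (σ : State) :
    a.run O σ = a.den O σ := (h.runs σ).exec le_rfl

/-! ### Unrolling of loops -/

def Code.rep : ℕ → Code → Code
  | 0, _ => skip
  | n + 1, a => seq a (rep n a)

/-- Every loop is replaced by `N` conditional copies of its body. -/
def Code.unroll (N : ℕ) : Code → Code
  | skip => skip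
  | instr i => instr i
  | seq a b => seq (a.unroll N) (b.unroll N)
  | ite r a b c => ite r (a.unroll N) (b.unroll N) (c.unroll N)
  | loop r a => rep N (ite r (a.unroll N) (a.unroll N) skip)

theorem Code.rep_loopFree {a : Code} (h : a.LoopFree) (n : ℕ) : (rep n a).LoopFree := by
  induction n with
  | zero => trivial
  | succ n ih => exact ⟨h, ih⟩

theorem Code.unroll_loopFree (N : ℕ) (a : Code) : (a.unroll N).LoopFree := by
  induction a with
  | skip => trivial
  | instr i => trivial
  | seq a b iha ihb => exact ⟨iha, ihb⟩
  | ite r a b c iha ihb ihc => exact ⟨iha, ihb, ihc⟩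
  | loop r a ih => exact rep_loopFree (a := .ite r (a.unroll N) (a.unroll N) skip) ⟨ih, ih, trivial⟩ N

/-- This is why superfluous copies of a loop body are harmless: once the guard is empty, each of
them does nothing. -/
theorem Code.den_rep_nil {O : Oracle} {r : ℕ} {σ : State} (hr : σ.reg r = []) (a : Code) (n : ℕ) :
    (rep n (ite r a a skip)).den O σ = [σ] := by
  induction n with
  | zero => rfl
  | succ n ih => simp [rep, den, hr, ih]

theorem outs_eq_of_halted {O : Oracle} {t t' : ℕ} {γ : List Code × State}
    (h : ∀ γ' ∈ outs O t γ, γ'.1 = []) (ht : t ≤ t') : outs O t' γ = outs O t γ := by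
  induction ht with
  | refl => rfl
  | step _ ih =>
    rw [outs_succ', ih]
    conv_rhs => rw [← List.flatMap_singleton' (outs O t γ)]
    simp only [List.flatMap_def]
    congr 1
    refine List.map_congr_left fun γ' hγ' => ?_
    have := h γ' hγ'
    rcases γ' with ⟨ks, σ'⟩
    simp only at this
    subst this
    rfl

/-- All branches of the programs `ks` halt within `t` steps. -/
def Halts (O : Oracle) (t : ℕ) (ks : List Code) (σ : State) : Prop :=
  ∀ γ ∈ outs O t (ks, σ), γ.1 = []

theorem Halts.mono {O : Oracle} {t t' : ℕ} {ks : List Code} {σ : State} (h : Halts O t ks σ)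
    (ht : t ≤ t') : Halts O t' ks σ := by
  intro γ hγ
  rw [outs_eq_of_halted h ht] at hγ
  exact h γ hγ

theorem Halts.of_step {O : Oracle} {t : ℕ} {ks ks' : List Code} {σ σ' : State}
    (h : Halts O (t + 1) ks σ) (hs : step O (ks, σ) = [(ks', σ')]) : Halts O t ks' σ' := by
  intro γ hγ
  exact h γ (by rw [outs_succ, hs]; simpa using hγ)

theorem Halts.exists_succ {O : Oracle} {t : ℕ} {a : Code} {k : List Code} {σ : State}
    (h : Halts O t (a :: k) σ) : ∃ s, t = s + 1 := by
  rcases t with _ | s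
  · have := h (a :: k, σ) (by simp [outs_zero])
    simp at this
  · exact ⟨s, rfl⟩

/-- `D` is the meaning of the first program `a` of `a :: k`, which halt in `t` steps. -/
def Splits (O : Oracle) (t : ℕ) (a : Code) (k : List Code) (σ : State) (D : List State) : Prop :=
  (∀ σ' ∈ D, Halts O t k σ' ) ∧
    outs O (t + 1) (a :: k, σ) = D.flatMap fun σ' => outs O t (k, σ')

theorem Splits.of_step {O : Oracle} {t : ℕ} {a a' : Code} {k : List Code} {σ : State}
    {D : List State} (hs : step O (a :: k, σ) = [(a' :: k, σ)]) (h : Splits O t a' k σ D) :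
    Splits O (t + 1) a k σ D := by
  refine ⟨fun σ' h' => (h.1 σ' h').mono (by omega), ?_⟩
  rw [outs_succ, hs, List.flatMap_singleton, h.2]
  simp only [List.flatMap_def]
  congr 1
  exact List.map_congr_left fun σ' h' => (outs_eq_of_halted (h.1 σ' h') (by omega)).symm

/-- The form covers both `seq` and an entered loop, each of which puts two programs on the stack.
The budgets `t` and `s` belong to the two programs; since everything has halted by then, the
difference between them can be padded away. -/
theorem Splits.seq {O : Oracle} {t s : ℕ} {a b c : Code} {k : List Code} {σ : State}
    {D : List State} {D' : State → List State} (hs : step O (c :: k, σ) = [(a :: b :: k, σ)])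
    (hst : s + 1 ≤ t) (h : Splits O t a (b :: k) σ D)
    (h' : ∀ σ' ∈ D, Splits O s b k σ' (D' σ')) (hb : ∀ σ' ∈ D, Halts O (s + 1) (b :: k) σ'):
    Splits O (t + 1) c k σ (D.flatMap D') := by
  constructor
  · intro σ' hσ
    obtain ⟨σ₁, h1, h2⟩ := List.mem_flatMap.1 hσ
    exact ((h' σ₁ h1).1 σ' h2).mono (by omega)
  · rw [outs_succ, hs, List.flatMap_singleton, h.2, List.flatMap_assoc]
    simp only [List.flatMap_def]
    congr 1
    refine List.map_congr_left fun σ' h1 => ?_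
    rw [outs_eq_of_halted (hb σ' h1) hst, (h' σ' h1).2, List.flatMap_def]
    congr 1
    exact List.map_congr_left fun σ₂ h2 =>
      (outs_eq_of_halted ((h' σ' h1).1 σ₂ h2) (by omega)).symm

/-- The induction is on the number of steps, not on the program, because an entered loop puts itself
back on the stack. Every pass through a loop costs at least one step, so a loop that halts within `t
+ 1` steps needs at most `t + 1` copies of its body. In the second statement the number `m` of
copies left is separate from `N`: it decreases from pass to pass, while the loops inside the body
are always unrolled `N` times. -/
theorem splits_unroll (O : Oracle) (N t : ℕ) :
    (∀ a k σ, Halts O (t + 1) (a :: k) σ → t + 1 ≤ N →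
      Splits O t a k σ ((a.unroll N).den O σ)) ∧
    (∀ r a k σ m, Halts O (t + 1) (.loop r a :: k) σ → t + 1 ≤ N → t + 1 ≤ m →
      Splits O t (.loop r a) k σ
        ((Code.rep m (.ite r (a.unroll N) (a.unroll N) .skip)).den O σ)) := by
  induction t using Nat.strong_induction_on with
  | _ t ih =>
  have hl : ∀ r a k σ m, Halts O (t + 1) (.loop r a :: k) σ → t + 1 ≤ N → t + 1 ≤ m →
      Splits O t (.loop r a) k σ
        ((Code.rep m (.ite r (a.unroll N) (a.unroll N) .skip)).den O σ) := by
    intro r a k σ m h hN hm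
    by_cases hr : σ.reg r = []
    · have hs : step O (.loop r a :: k, σ) = [(k, σ)] := by simp only [step, hr]
      rw [Code.den_rep_nil hr]
      refine ⟨?_, ?_⟩
      · simpa using h.of_step hs
      · rw [outs_succ, hs]; simp
    · have hs : step O (.loop r a :: k, σ) = [(a :: .loop r a :: k, σ)] := by
        simp only [step]
        rcases hl : σ.reg r with _ | ⟨_ | _, l⟩
        · exact absurd hl hr
        all_goals rfl
      have h1 := h.of_step hs
      obtain ⟨t, rfl⟩ := h1.exists_succ
      obtain ⟨m, rfl⟩ : ∃ m', m = m' + 1 := ⟨m - 1, by omega⟩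
      have ha := (ih t (by omega)).1 a _ _ h1 (by omega)
      have hd : (Code.rep (m + 1) (.ite r (a.unroll N) (a.unroll N) .skip)).den O σ =
          ((a.unroll N).den O σ).flatMap
            ((Code.rep m (.ite r (a.unroll N) (a.unroll N) .skip)).den O) := by
        simp only [Code.rep, Code.den]
        rcases hl : σ.reg r with _ | ⟨_ | _, l⟩
        · exact absurd hl hr
        all_goals rfl
      rw [hd]
      -- Some branch leaves the body with the loop still on the stack. It needs at least one more
      -- step, and this provides the smaller budget `s` for the induction hypothesis.
      obtain ⟨σ₀, h₀⟩ := List.exists_mem_of_ne_nil _ (Code.den_ne_nil O (a.unroll N) σ)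
      obtain ⟨s, rfl⟩ := (ha.1 σ₀ h₀).exists_succ
      exact Splits.seq hs le_rfl ha (fun σ' h' => (ih s (by omega)).2 r a k σ' m (ha.1 σ' h')
        (by omega) (by omega)) ha.1
  refine ⟨?_, hl⟩
  intro a k σ h hN
  cases a with
  | skip => exact ⟨by simpa [Code.unroll, Code.den] using h.of_step rfl, by
      rw [outs_succ]; simp [step, Code.unroll, Code.den]⟩
  | instr i =>
    refine ⟨?_, ?_⟩
    · intro σ' h' γ hγ
      refine h γ ?_
      rw [outs_succ]
      refine List.mem_flatMap.2 ⟨(k, σ'), ?_, hγ⟩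
      exact List.mem_map.2 ⟨σ', h', rfl⟩
    · rw [outs_succ]
      simp only [step, Code.unroll, Code.den, List.flatMap_map]
  | seq a b =>
    have h1 := h.of_step rfl
    obtain ⟨t, rfl⟩ := h1.exists_succ
    have ha := (ih t (by omega)).1 a _ _ h1 (by omega)
    obtain ⟨σ₀, h₀⟩ := List.exists_mem_of_ne_nil _ (Code.den_ne_nil O (a.unroll N) σ)
    obtain ⟨s, rfl⟩ := (ha.1 σ₀ h₀).exists_succ
    exact Splits.seq rfl le_rfl ha (fun σ' h' => (ih s (by omega)).1 b k σ' (ha.1 σ' h')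
      (by omega)) ha.1
  | ite r a b c =>
    rcases hr : σ.reg r with _ | ⟨_ | _, l⟩
    · have hs : step O (.ite r a b c :: k, σ) = [(c :: k, σ)] := by simp [step, hr]
      have h1 := h.of_step hs
      obtain ⟨t, rfl⟩ := h1.exists_succ
      simp only [Code.unroll, Code.den, hr]
      exact Splits.of_step hs ((ih t (by omega)).1 c _ _ h1 (by omega))
    · have hs : step O (.ite r a b c :: k, σ) = [(b :: k, σ)] := by simp [step, hr]
      have h1 := h.of_step hs
      obtain ⟨t, rfl⟩ := h1.exists_succ
      simp only [Code.unroll, Code.den, hr]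
      exact Splits.of_step hs ((ih t (by omega)).1 b _ _ h1 (by omega))
    · have hs : step O (.ite r a b c :: k, σ) = [(a :: k, σ)] := by simp [step, hr]
      have h1 := h.of_step hs
      obtain ⟨t, rfl⟩ := h1.exists_succ
      simp only [Code.unroll, Code.den, hr]
      exact Splits.of_step hs ((ih t (by omega)).1 a _ _ h1 (by omega))
  | loop r a => exact hl r a k σ N h hN hN

/-- A program that halts within `N` steps may be replaced by its `N`-fold unrolling. -/
theorem Runs.den_unroll {O : Oracle} {a : Code} {σ : State} {t N : ℕ} {L : List State}
    (h : Runs O [a] σ t L) (ht : t ≤ N) : (a.unroll N).den O σ = L := by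
  have hh : Halts O t [a] σ := by
    intro γ hγ
    unfold Runs at h
    rw [h] at hγ
    simp only [List.mem_map] at hγ
    obtain ⟨_, _, rfl⟩ := hγ
    rfl
  obtain ⟨s, rfl⟩ := hh.exists_succ
  have h1 := ((splits_unroll O N s).1 a [] σ hh ht).2
  unfold Runs at h
  rw [h] at h1
  have h2 : ∀ σ', outs O s ([], σ') = [([], σ')] := fun σ' => Runs.nil O σ' s
  simp only [h2] at h1
  rw [← List.map_eq_flatMap] at h1
  exact ((List.map_injective_iff.2 fun _ _ h => (Prod.ext_iff.1 h).2) h1).symm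

end WMark
end

noncomputable section

namespace WMark

/-! ### Length of registers, renaming of registers -/

/-- With a general oracle a call could write an answer of any length; `noOracle` only answers with
the empty string. The resulting bound by the running time limits the length of generated keys and
the cost of clearing work registers. -/
theorem Instr.length_apply_le (i : Instr) (σ σ' : State) (h : σ' ∈ i.apply noOracle σ) (r : ℕ) :
    (σ'.reg r).length ≤ (σ.reg r).length + 1 := by
  cases i <;> simp only [Instr.apply, List.map_cons, List.map_nil,
    List.mem_cons, List.not_mem_nil, or_false] at h
  case push r' b => subst h; by_cases hr : r = r' <;> simp [State.set, hr]
  case pop r' =>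
    subst h; by_cases hr : r = r' <;> simp [State.set, hr]; omega
  case coin r' =>
    rcases h with rfl | rfl <;> by_cases hr : r = r' <;> simp [hr]
  case gate g => subst h; simp
  case measure r₁ r' =>
    rcases h with rfl | rfl <;> by_cases hr : r = r' <;> simp [hr]
  case call i r₁ r' =>
    subst h; by_cases hr : r = r' <;> simp [State.set, hr, noOracle]

theorem length_step_le (γ γ' : List Code × State) (h : γ' ∈ step noOracle γ) (r : ℕ) :
    (γ'.2.reg r).length ≤ (γ.2.reg r).length + 1 := by
  rcases γ with ⟨_ | ⟨a, k⟩, σ⟩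
  · simp only [step, List.mem_singleton] at h; subst h; simp
  cases a with
  | skip => simp only [step, List.mem_singleton] at h; subst h; simp
  | seq a b => simp only [step, List.mem_singleton] at h; subst h; simp
  | instr i =>
    simp only [step, List.mem_map] at h
    obtain ⟨σ', h', rfl⟩ := h
    exact i.length_apply_le σ σ' h' r
  | ite r a b c =>
    simp only [step] at h
    rcases hr : σ.reg r with _ | ⟨_ | _, l⟩ <;> rw [hr] at h <;>
      simp only [List.mem_singleton] at h <;> subst h <;> simp
  | loop r a =>
    simp only [step] at h
    rcases hr : σ.reg r with _ | ⟨_, l⟩ <;> rw [hr] at h <;>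
      simp only [List.mem_singleton] at h <;> subst h <;> simp

theorem length_outs_le (t : ℕ) (γ γ' : List Code × State) (h : γ' ∈ outs noOracle t γ) (r : ℕ) :
    (γ'.2.reg r).length ≤ (γ.2.reg r).length + t := by
  induction t generalizing γ' with
  | zero => simp only [outs_zero, List.mem_singleton] at h; subst h; simp
  | succ t ih =>
    rw [outs_succ'] at h
    obtain ⟨γ₁, h1, h2⟩ := List.mem_flatMap.1 h
    have := ih γ₁ h1
    have := length_step_le γ₁ γ' h2 r
    omega

theorem length_exec_le {t : ℕ} {a : Code} {σ σ' : State} (h : σ' ∈ exec noOracle t a σ) (r : ℕ) :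
    (σ'.reg r).length ≤ (σ.reg r).length + t := by
  obtain ⟨γ, h1, rfl⟩ := List.mem_map.1 h
  exact length_outs_le t ([a], σ) γ h1 r

def Instr.shift (K : ℕ) : Instr → Instr
  | push r b => push (r + K) b
  | pop r => pop (r + K)
  | coin r => coin (r + K)
  | gate g => gate (g.map (· + K))
  | measure r r' => measure (r + K) (r' + K)
  | call i r r' => call i (r + K) (r' + K)

/-- The same program with registers `K, K + 1, …` instead of `0, 1, …`. -/
def Code.shift (K : ℕ) : Code → Code
  | skip => skip
  | instr i => instr (i.shift K)
  | seq a b => seq (a.shift K) (b.shift K)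
  | ite r a b c => ite (r + K) (a.shift K) (b.shift K) (c.shift K)
  | loop r a => loop (r + K) (a.shift K)

/-- The program is deterministic and only uses registers below `m`. -/
def Code.DetBelow (m : ℕ) : Code → Prop
  | skip => True
  | instr (.push r _) => r < m
  | instr (.pop r) => r < m
  | instr _ => False
  | seq a b => a.DetBelow m ∧ b.DetBelow m
  | ite r a b c => r < m ∧ a.DetBelow m ∧ b.DetBelow m ∧ c.DetBelow m
  | loop r a => r < m ∧ a.DetBelow m

theorem Code.DetBelow.mono {m m' : ℕ} (hm : m ≤ m') {a : Code} (h : a.DetBelow m) :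
    a.DetBelow m' := by
  induction a with
  | skip => trivial
  | instr i => cases i <;> simp only [DetBelow] at h ⊢ <;> omega
  | seq a b iha ihb => exact ⟨iha h.1, ihb h.2⟩
  | ite r a b c iha ihb ihc => exact ⟨h.1.trans_le hm, iha h.2.1, ihb h.2.2.1, ihc h.2.2.2⟩
  | loop r a ih => exact ⟨h.1.trans_le hm, ih h.2⟩

theorem Code.exists_detBelow {a : Code} (h : a.All Instr.IsDeterministic) :
    ∃ m, a.DetBelow m := by
  induction a with
  | skip => exact ⟨0, trivial⟩
  | instr i =>
    cases i with
    | push r b => exact ⟨r + 1, Nat.lt_succ_self r⟩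
    | pop r => exact ⟨r + 1, Nat.lt_succ_self r⟩
    | _ => exact h.elim
  | seq a b iha ihb =>
    obtain ⟨m, hm⟩ := iha h.1
    obtain ⟨m', hm'⟩ := ihb h.2
    exact ⟨m + m', hm.mono (by omega), hm'.mono (by omega)⟩
  | ite r a b c iha ihb ihc =>
    obtain ⟨m, hm⟩ := iha h.1
    obtain ⟨m', hm'⟩ := ihb h.2.1
    obtain ⟨m'', hm''⟩ := ihc h.2.2
    exact ⟨m + m' + m'' + r + 1, by omega, hm.mono (by omega), hm'.mono (by omega),
      hm''.mono (by omega)⟩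
  | loop r a ih =>
    obtain ⟨m, hm⟩ := ih h
    exact ⟨m + r + 1, by omega, hm.mono (by omega)⟩

/-- The registers below `m` of `σ` are placed at `K, …, K + m - 1`. -/
def embed (K m : ℕ) (base : ℕ → List Bool) (ψ : Ket) (σ : State) : State :=
  ⟨fun r => if K ≤ r ∧ r < K + m then σ.reg (r - K) else base r, ψ⟩

theorem embed_reg {K m r : ℕ} (base : ℕ → List Bool) (ψ : Ket) (σ : State) (hr : r < m) :
    (embed K m base ψ σ).reg (r + K) = σ.reg r := by
  simp [embed, show r + K < K + m by omega]

theorem embed_set {K m r : ℕ} (base : ℕ → List Bool) (ψ : Ket) (σ : State) (hr : r < m)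
    (l : List Bool) : (embed K m base ψ σ).set (r + K) l = embed K m base ψ (σ.set r l) := by
  simp only [embed, State.set, State.mk.injEq, and_true]
  funext r'
  by_cases h : r' = r + K
  · subst h; simp [show r + K < K + m by omega]
  · by_cases h' : K ≤ r' ∧ r' < K + m
    · simp [h, h', show r' - K ≠ r by omega]
    · simp [h, h']

/-- A deterministic program touches neither the qubits nor the oracle nor registers beyond `m`.
Hence inside a window of a larger machine it runs in lockstep with its run in isolation, whatever
`O`, `ψ` and the other registers are. The second part is the invariant that carries this over to
many steps. -/
theorem step_embed (O : Oracle) {K m : ℕ} (base : ℕ → List Bool) (ψ : Ket) (ks : List Code)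
    (σ : State) (h : ∀ a ∈ ks, a.DetBelow m) :
    step O (ks.map (Code.shift K), embed K m base ψ σ) =
      (step noOracle (ks, σ)).map (fun γ => (γ.1.map (Code.shift K), embed K m base ψ γ.2)) ∧
    ∀ γ ∈ step noOracle (ks, σ), ∀ a ∈ γ.1, a.DetBelow m := by
  rcases ks with _ | ⟨a, k⟩
  · simp [step]
  have hk : ∀ a ∈ k, a.DetBelow m := fun a h' => h a (by simp [h'])
  have ha := h a (by simp)
  cases a with
  | skip => exact ⟨by simp [step, Code.shift], by simpa [step] using hk⟩
  | instr i =>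
    cases i with
    | push r b =>
      simp only [Code.DetBelow] at ha
      refine ⟨?_, by simpa [step, Instr.apply] using hk⟩
      simp [step, Code.shift, Instr.shift, Instr.apply, embed_set base ψ σ ha,
        embed_reg base ψ σ ha]
    | pop r =>
      simp only [Code.DetBelow] at ha
      refine ⟨?_, by simpa [step, Instr.apply] using hk⟩
      simp [step, Code.shift, Instr.shift, Instr.apply, embed_set base ψ σ ha,
        embed_reg base ψ σ ha]
    | _ => exact ha.elim
  | seq a b =>
    refine ⟨by simp [step, Code.shift], ?_⟩
    simpa [step] using ⟨ha.1, ha.2, hk⟩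
  | ite r a b c =>
    simp only [step, Code.shift, List.map_cons, embed_reg base ψ σ ha.1]
    rcases σ.reg r with _ | ⟨_ | _, l⟩
    · simpa using ⟨ha.2.2.2, hk⟩
    · simpa using ⟨ha.2.2.1, hk⟩
    · simpa using ⟨ha.2.1, hk⟩
  | loop r a =>
    simp only [step, Code.shift, List.map_cons, embed_reg base ψ σ ha.1]
    rcases σ.reg r with _ | ⟨_, l⟩
    · simpa using hk
    · simpa [Code.shift] using ⟨ha.2, ha, hk⟩

theorem outs_embed (O : Oracle) {K m : ℕ} (base : ℕ → List Bool) (ψ : Ket) (t : ℕ)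
    (ks : List Code) (σ : State) (h : ∀ a ∈ ks, a.DetBelow m) :
    outs O t (ks.map (Code.shift K), embed K m base ψ σ) =
      (outs noOracle t (ks, σ)).map
        (fun γ => (γ.1.map (Code.shift K), embed K m base ψ γ.2)) := by
  induction t generalizing ks σ with
  | zero => simp [outs_zero]
  | succ t ih =>
    obtain ⟨h1, h2⟩ := step_embed O (K := K) base ψ ks σ h
    rw [outs_succ, outs_succ, h1, List.flatMap_map, List.map_flatMap]
    simp only [List.flatMap_def]
    congr 1
    exact List.map_congr_left fun γ hγ => ih γ.1 γ.2 (h2 γ hγ)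

theorem length_outs_detBelow {m : ℕ} (t : ℕ) (ks : List Code) (σ : State)
    (h : ∀ a ∈ ks, a.DetBelow m) : (outs noOracle t (ks, σ)).length = 1 := by
  induction t generalizing ks σ with
  | zero => simp [outs_zero]
  | succ t ih =>
    -- Only the invariance of `Code.DetBelow` is used here, so the window and its surroundings are
    -- arbitrary.
    have h2 := (step_embed noOracle (K := 0) (fun _ => []) zeroKet ks σ h).2
    obtain ⟨γ, hγ⟩ : ∃ γ, step noOracle (ks, σ) = [γ] := by
      rcases ks with _ | ⟨a, k⟩
      · exact ⟨_, rfl⟩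
      have ha := h a (by simp)
      cases a with
      | skip => exact ⟨_, rfl⟩
      | instr i =>
        cases i with
        | push r b => exact ⟨_, rfl⟩
        | pop r => exact ⟨_, rfl⟩
        | _ => exact ha.elim
      | seq a b => exact ⟨_, rfl⟩
      | ite r a b c =>
        simp only [step]
        rcases σ.reg r with _ | ⟨_ | _, l⟩ <;> exact ⟨_, rfl⟩
      | loop r a =>
        simp only [step]
        rcases σ.reg r with _ | ⟨_, l⟩ <;> exact ⟨_, rfl⟩
    rw [outs_succ, hγ, List.flatMap_singleton]
    exact ih _ _ (h2 γ (by simp [hγ]))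

/-! ### Elementary programs -/

/-- Pops a bit of register `r` and continues according to its value. -/
def readBit (r : ℕ) (B : Bool → Code) : Code :=
  .ite r (.seq (.instr (.pop r)) (B true)) (.seq (.instr (.pop r)) (B false)) .skip

/-- Runs `B` on all bits of register `r`, which is emptied. -/
def drain (r : ℕ) (B : Bool → Code) : Code := .loop r (readBit r B)

def clear (r : ℕ) : Code := .loop r (.instr (.pop r))

/-- Parses the encoding of a list at the top of register `r`, where `B` processes an item; the
register `f` is a flag. -/
def parse (r f : ℕ) (B : Code) : Code :=
  .seq (.instr (.push f true)) (.loop f (.ite r (.seq (.instr (.pop r)) B)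
    (.seq (.instr (.pop r)) (.instr (.pop f))) .skip))

def pushBit (r : ℕ) (x : Bool) : Code := .instr (.push r x)

/-- Puts a fixed string in front of the content of register `r`. -/
def pushList (r : ℕ) : List Bool → Code
  | [] => .skip
  | x :: l => .seq (pushList r l) (pushBit r x)

variable {O : Oracle}

theorem runs_readBit {r : ℕ} {B : Bool → Code} {σ : State} {t : ℕ} {L : List State} {x : Bool}
    {l : List Bool} (hr : σ.reg r = x :: l) (h : Runs O [B x] (σ.set r l) t L) :
    Runs O [readBit r B] σ (t + 3) L := by
  have hp : Det O (.instr (.pop r)) σ 1 (σ.set r l) := by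
    have := Det.pop (O := O) (σ := σ) (r := r)
    rwa [hr] at this
  have h1 : Runs O [.seq (.instr (.pop r)) (B x)] σ (t + 2) L :=
    (hp.seqRuns h).mono (by omega)
  cases x
  · exact Runs.of_step (by simp [step, readBit, hr]) h1
  · exact Runs.of_step (by simp [step, readBit, hr]) h1

theorem det_readBit {r : ℕ} {B : Bool → Code} {σ σ' : State} {t : ℕ} {x : Bool}
    {l : List Bool} (hr : σ.reg r = x :: l) (h : Det O (B x) (σ.set r l) t σ') :
    Det O (readBit r B) σ (t + 3) σ' := runs_readBit hr h

theorem det_pushBit {r : ℕ} {x : Bool} {σ : State} :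
    Det O (pushBit r x) σ 1 (σ.set r (x :: σ.reg r)) := Det.push

theorem State.set_set (σ : State) (r : ℕ) (l l' : List Bool) :
    (σ.set r l).set r l' = σ.set r l' := by simp [State.set]

theorem State.set_reg (σ : State) (r : ℕ) (l : List Bool) : (σ.set r l).reg r = l := by
  simp [State.set]

theorem State.set_self (σ : State) (r : ℕ) : σ.set r (σ.reg r) = σ := by
  simp [State.set]

theorem State.set_reg_ne (σ : State) {r r' : ℕ} (h : r' ≠ r) (l : List Bool) :
    (σ.set r l).reg r' = σ.reg r' := by simp [State.set, h]

theorem det_pushList {r : ℕ} {l : List Bool} {σ : State} :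
    Det O (pushList r l) σ (2 * l.length + 1) (σ.set r (l ++ σ.reg r)) := by
  induction l with
  | nil => simpa [State.set_self, pushList] using Det.skip
  | cons x l ih =>
    refine (ih.seq det_pushBit).congr (by simp; omega) ?_
    rw [State.set_set, State.set_reg]
    rfl

/-- A loop rule with a built-in invariant: `S l s` is the state when `l` is still to be read and `s`
has been accumulated, so that the loop computes a left fold. The constant `4` is three steps for
reading the bit and one for testing the guard. -/
theorem det_drain {α : Type} {r tB : ℕ} {B : Bool → Code} {S : List Bool → α → State}
    {g : α → Bool → α} (hreg : ∀ l s, (S l s).reg r = l)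
    (hset : ∀ x l s, (S (x :: l) s).set r l = S l s)
    (hstep : ∀ x l s, Det O (B x) (S l s) tB (S l (g s x))) (l : List Bool) (s : α) :
    Det O (drain r B) (S l s) (l.length * (tB + 4) + 1) (S [] (l.foldl g s)) := by
  induction l generalizing s with
  | nil => exact (Det.loop_nil (hreg [] s)).mono (by simp)
  | cons x l ih =>
    have h1 : Det O (readBit r B) (S (x :: l) s) (tB + 3) (S l (g s x)) :=
      det_readBit (hreg _ _) (by rw [hset]; exact hstep x l s)
    refine (Det.loop_cons (by simp [hreg]) h1 (ih (g s x))).congr ?_ rfl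
    simp only [List.length_cons]
    ring_nf; omega

theorem det_clear {r : ℕ} {σ : State} :
    Det O (clear r) σ ((σ.reg r).length * 2 + 1) (σ.set r []) := by
  suffices h : ∀ l, ∀ σ : State, σ.reg r = l →
      Det O (clear r) σ (l.length * 2 + 1) (σ.set r []) from h _ σ rfl
  intro l
  induction l with
  | nil =>
    intro σ h
    exact (Det.loop_nil h).congr (by simp) (by rw [← h, State.set_self])
  | cons x l ih =>
    intro σ h
    refine (Det.loop_cons (by simp [h]) Det.pop (ih _ (by rw [State.set_reg, h]; rfl))).congr
      (by simp; omega) (State.set_set _ _ _ _)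

/-- The analogue of `det_drain` for self-delimiting lists. The loop is guarded not by the input,
which continues after the list, but by a flag in register `f`; it is removed when the terminating
`0` is read. The flag is present while an item is processed, which is why `hstep` has `[true]`
there. -/
theorem det_parse {α β : Type} {r f tB : ℕ} {B : Code} {S : List Bool → List Bool → α → State}
    {g : α → β → α} {enc : β → List Bool}
    (hr : ∀ l x s, (S l x s).reg r = l) (hf : ∀ l x s, (S l x s).reg f = x)
    (hsr : ∀ l l' x s, (S l x s).set r l' = S l' x s)
    (hsf : ∀ l x x' s, (S l x s).set f x' = S l x' s)
    (items : List β)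
    (hstep : ∀ b ∈ items, ∀ l s, Det O B (S (enc b ++ l) [true] s) tB (S l [true] (g s b)))
    (l : List Bool) (s : α) :
    Det O (parse r f B) (S (encList enc items ++ l) [] s) (items.length * (tB + 4) + 8)
      (S l [] (items.foldl g s)) := by
  have h1 : ∀ s, Det O (.loop f (.ite r (.seq (.instr (.pop r)) B)
      (.seq (.instr (.pop r)) (.instr (.pop f))) .skip)) (S (encList enc items ++ l) [true] s)
      (items.length * (tB + 4) + 6) (S l [] (items.foldl g s)) := by
    induction items with
    | nil =>
      intro s
      have h2 : S (encList enc [] ++ l) [true] s = S (false :: l) [true] s := rfl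
      rw [h2]
      refine (Det.loop_cons (by simp [hf]) (Det.ite_false (l := l) (hr _ _ _)
        (Det.seq Det.pop Det.pop)) (Det.loop_nil ?_)).congr (by simp) ?_
      · simp [hr, hsr, hf, hsf]
      · simp [hr, hsr, hf, hsf]
    | cons b items ih =>
      intro s
      have h2 : S (encList enc (b :: items) ++ l) [true] s =
          S (true :: (enc b ++ (encList enc items ++ l))) [true] s := by
        simp [encList]
      rw [h2]
      have h3 := hstep b (by simp) (encList enc items ++ l) s
      refine (Det.loop_cons (by simp [hf]) (Det.ite_true (hr _ _ _) (Det.seq Det.pop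
        (t' := tB) (σ'' := S (encList enc items ++ l) [true] (g s b)) ?_))
        (ih (fun b hb => hstep b (by simp [hb])) (g s b))).congr ?_ rfl
      · rw [hr, hsr]; exact h3
      · simp only [List.length_cons]; ring_nf; omega
  refine (Det.seq Det.push (σ'' := S l [] (items.foldl g s)) ?_).congr (t :=
    1 + (items.length * (tB + 4) + 6) + 1) (by omega) rfl
  rw [hf, hsf]
  exact h1 s

/-! ### The evaluation subroutine -/

/-- Clears the registers `K, …, K + m - 1`. -/
def clearRange (K : ℕ) : ℕ → Code
  | 0 => .skip
  | m + 1 => .seq (clearRange K m) (clear (K + m))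

theorem det_clearRange {K m b : ℕ} {σ : State} (h : ∀ r < m, (σ.reg (K + r)).length ≤ b) :
    Det O (clearRange K m) σ (m * (2 * b + 2) + 1)
      ⟨fun r => if K ≤ r ∧ r < K + m then [] else σ.reg r, σ.ket⟩ := by
  induction m with
  | zero =>
    refine Det.skip.congr (by omega) ?_
    rcases σ with ⟨ρ, ψ⟩
    simp only [State.mk.injEq, and_true]
    funext r
    simp
  | succ m ih =>
    refine ((ih fun r hr => h r (by omega)).seq (det_clear (r := K + m))).congr ?_ ?_
    · have := h m (by omega)
      simp only [show ¬ (K ≤ K + m ∧ K + m < K + m) by omega, if_false]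
      nlinarith
    · simp only [State.set, State.mk.injEq, and_true]
      funext r
      by_cases hr : r = K + m
      · subst hr; simp
      · simp only [Function.update_of_ne hr]
        by_cases hr' : K ≤ r ∧ r < K + m
        · simp [hr', show r < K + (m + 1) by omega]
        · simp only [hr', if_false, show ¬ (K ≤ r ∧ r < K + (m + 1)) by omega]

/-- Runs the deterministic program `a` with registers `K, …, K + m - 1`, pushes the
first bit of its output to register `p` and clears the registers. -/
def subroutine (K m p : ℕ) (a : Code) : Code :=
  .seq (a.shift K) (.seq (.ite K (pushBit p true) (pushBit p false) .skip) (clearRange K m))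

theorem polynomial_eval_mono (T : Polynomial ℕ) : Monotone fun n => T.eval n := by
  intro a b h
  simp only [Polynomial.eval_eq_sum_range]
  gcongr

/-- Apart from the two inputs the window is empty, so the start state is an embedding of
`inputState`. Registers grow by at most one bit per step, which bounds the time for wiping the
window; afterwards it can be used for the next call. -/
theorem det_subroutine {K m p t : ℕ} {a : Code} {base : ℕ → List Bool} {ψ : Ket} {x y : List Bool}
    {v : Bool} (ha : a.DetBelow m) (hm : 2 ≤ m) (hp : p < K) (hb : ∀ r < m, base (K + r) = [])
    (hh : HaltsIn noOracle t a (inputState x y zeroKet))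
    (hv : ∀ σ ∈ exec noOracle t a (inputState x y zeroKet), σ.reg 0 = [v]) :
    Det O (subroutine K m p a) ⟨Function.update (Function.update base K x) (K + 1) y, ψ⟩
      (t + m * (2 * (x.length + y.length + t) + 2) + 5) ⟨Function.update base p (v :: base p), ψ⟩
    := by
  have hsingle := length_outs_detBelow (m := m) t [a] (inputState x y zeroKet) (by simpa using ha)
  have hruns := hh.runs
  have hlen : (exec noOracle t a (inputState x y zeroKet)).length = 1 := by
    rw [exec, List.length_map]; exact hsingle
  obtain ⟨σ, hσ⟩ := List.length_eq_one_iff.1 hlen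
  rw [hσ] at hruns hv
  have hlr : ∀ r, (σ.reg r).length ≤ x.length + y.length + t := by
    intro r
    have := length_exec_le (σ' := σ) (by rw [hσ]; simp) r
    refine this.trans ?_
    simp only [inputState]
    split_ifs <;> simp
  have h0 : (⟨Function.update (Function.update base K x) (K + 1) y, ψ⟩ : State) =
      embed K m base ψ (inputState x y zeroKet) := by
    simp only [embed, State.mk.injEq, and_true, inputState]
    funext r
    by_cases h1 : r = K + 1
    · subst h1; simp; omega
    by_cases h2 : r = K
    · subst h2; simp; omega
    rw [Function.update_of_ne h1, Function.update_of_ne h2]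
    split_ifs with h3 h4 h4
    · omega
    · omega
    · have := hb (r - K) (by omega)
      rwa [show K + (r - K) = r by omega] at this
    · rfl
  have h1 : Det O (a.shift K) (embed K m base ψ (inputState x y zeroKet)) t
      (embed K m base ψ σ) := by
    have := outs_embed O (K := K) base ψ t [a] (inputState x y zeroKet) (by simpa using ha)
    unfold Det Runs
    unfold Runs at hruns
    simp only [List.map_cons, List.map_nil] at this
    rw [this, hruns]
    rfl
  have hreg : (embed K m base ψ σ).reg K = [v] := by
    have := embed_reg (K := K) base ψ σ (show 0 < m by omega)
    rw [zero_add] at this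
    rw [this]; exact hv σ (by simp)
  have h2 : Det O (.ite K (pushBit p true) (pushBit p false) .skip) (embed K m base ψ σ) 2
      ((embed K m base ψ σ).set p (v :: base p)) := by
    have hpb : (embed K m base ψ σ).reg p = base p := by
      simp [embed, show ¬ K ≤ p by omega]
    rw [← hpb]
    cases v
    · exact Det.ite_false hreg det_pushBit
    · exact Det.ite_true hreg det_pushBit
  rw [h0]
  refine (h1.seq (h2.seq (det_clearRange (b := x.length + y.length + t) ?_))).congr ?_ ?_
  · intro r hr
    rw [State.set_reg_ne _ (by omega), add_comm K r, embed_reg base ψ σ hr]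
    exact hlr r
  · omega
  · simp only [State.set, embed, State.mk.injEq, and_true]
    funext r
    by_cases h3 : r = p
    · subst h3; simp [show ¬ K ≤ r by omega]
    · rw [Function.update_of_ne h3, Function.update_of_ne h3]
      split_ifs with h4
      · have := hb (r - K) (by omega)
        rw [show K + (r - K) = r by omega] at this
        exact this.symm
      · rfl

end WMark
end

noncomputable section

namespace WMark

/-! ### Register files -/

/-- The contents of the registers `0, …, 10`, followed by those of the remaining ones. -/
def rf (a b c d e f g h i j k : List Bool) (τ : ℕ → List Bool) : ℕ → List Bool
  | 0 => a
  | 1 => b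
  | 2 => c
  | 3 => d
  | 4 => e
  | 5 => f
  | 6 => g
  | 7 => h
  | 8 => i
  | 9 => j
  | 10 => k
  | n + 11 => τ n

theorem State.set_eq_mk {ρ ρ' : ℕ → List Bool} {ψ : Ket} {n : ℕ} {l : List Bool}
    (h : ∀ r, Function.update ρ n l r = ρ' r) : State.set ⟨ρ, ψ⟩ n l = ⟨ρ', ψ⟩ := by
  simp only [State.set, State.mk.injEq, and_true]
  exact funext h

section rf

variable {a b c d e f g h i j k l : List Bool} {τ : ℕ → List Bool} {ψ : Ket}

@[simp] theorem rf_0 : rf a b c d e f g h i j k τ 0 = a := rfl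

@[simp] theorem rf_set_0 : State.set ⟨rf a b c d e f g h i j k τ, ψ⟩ 0 l =
    ⟨rf l b c d e f g h i j k τ, ψ⟩ :=
  State.set_eq_mk fun r => by
    match r with
    | 0 | 1 | 2 | 3 | 4 | 5 | 6 | 7 | 8 | 9 | 10 | _ + 11 => simp [rf]

@[simp] theorem rf_1 : rf a b c d e f g h i j k τ 1 = b := rfl

@[simp] theorem rf_set_1 : State.set ⟨rf a b c d e f g h i j k τ, ψ⟩ 1 l =
    ⟨rf a l c d e f g h i j k τ, ψ⟩ :=
  State.set_eq_mk fun r => by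
    match r with
    | 0 | 1 | 2 | 3 | 4 | 5 | 6 | 7 | 8 | 9 | 10 | _ + 11 => simp [rf]

@[simp] theorem rf_2 : rf a b c d e f g h i j k τ 2 = c := rfl

@[simp] theorem rf_set_2 : State.set ⟨rf a b c d e f g h i j k τ, ψ⟩ 2 l =
    ⟨rf a b l d e f g h i j k τ, ψ⟩ :=
  State.set_eq_mk fun r => by
    match r with
    | 0 | 1 | 2 | 3 | 4 | 5 | 6 | 7 | 8 | 9 | 10 | _ + 11 => simp [rf]

@[simp] theorem rf_3 : rf a b c d e f g h i j k τ 3 = d := rfl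

@[simp] theorem rf_set_3 : State.set ⟨rf a b c d e f g h i j k τ, ψ⟩ 3 l =
    ⟨rf a b c l e f g h i j k τ, ψ⟩ :=
  State.set_eq_mk fun r => by
    match r with
    | 0 | 1 | 2 | 3 | 4 | 5 | 6 | 7 | 8 | 9 | 10 | _ + 11 => simp [rf]

@[simp] theorem rf_4 : rf a b c d e f g h i j k τ 4 = e := rfl

@[simp] theorem rf_set_4 : State.set ⟨rf a b c d e f g h i j k τ, ψ⟩ 4 l =
    ⟨rf a b c d l f g h i j k τ, ψ⟩ :=
  State.set_eq_mk fun r => by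
    match r with
    | 0 | 1 | 2 | 3 | 4 | 5 | 6 | 7 | 8 | 9 | 10 | _ + 11 => simp [rf]

@[simp] theorem rf_5 : rf a b c d e f g h i j k τ 5 = f := rfl

@[simp] theorem rf_set_5 : State.set ⟨rf a b c d e f g h i j k τ, ψ⟩ 5 l =
    ⟨rf a b c d e l g h i j k τ, ψ⟩ :=
  State.set_eq_mk fun r => by
    match r with
    | 0 | 1 | 2 | 3 | 4 | 5 | 6 | 7 | 8 | 9 | 10 | _ + 11 => simp [rf]

@[simp] theorem rf_6 : rf a b c d e f g h i j k τ 6 = g := rfl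

@[simp] theorem rf_set_6 : State.set ⟨rf a b c d e f g h i j k τ, ψ⟩ 6 l =
    ⟨rf a b c d e f l h i j k τ, ψ⟩ :=
  State.set_eq_mk fun r => by
    match r with
    | 0 | 1 | 2 | 3 | 4 | 5 | 6 | 7 | 8 | 9 | 10 | _ + 11 => simp [rf]

@[simp] theorem rf_7 : rf a b c d e f g h i j k τ 7 = h := rfl

@[simp] theorem rf_set_7 : State.set ⟨rf a b c d e f g h i j k τ, ψ⟩ 7 l =
    ⟨rf a b c d e f g l i j k τ, ψ⟩ :=
  State.set_eq_mk fun r => by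
    match r with
    | 0 | 1 | 2 | 3 | 4 | 5 | 6 | 7 | 8 | 9 | 10 | _ + 11 => simp [rf]

@[simp] theorem rf_8 : rf a b c d e f g h i j k τ 8 = i := rfl

@[simp] theorem rf_set_8 : State.set ⟨rf a b c d e f g h i j k τ, ψ⟩ 8 l =
    ⟨rf a b c d e f g h l j k τ, ψ⟩ :=
  State.set_eq_mk fun r => by
    match r with
    | 0 | 1 | 2 | 3 | 4 | 5 | 6 | 7 | 8 | 9 | 10 | _ + 11 => simp [rf]

@[simp] theorem rf_9 : rf a b c d e f g h i j k τ 9 = j := rfl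

@[simp] theorem rf_set_9 : State.set ⟨rf a b c d e f g h i j k τ, ψ⟩ 9 l =
    ⟨rf a b c d e f g h i l k τ, ψ⟩ :=
  State.set_eq_mk fun r => by
    match r with
    | 0 | 1 | 2 | 3 | 4 | 5 | 6 | 7 | 8 | 9 | 10 | _ + 11 => simp [rf]

@[simp] theorem rf_10 : rf a b c d e f g h i j k τ 10 = k := rfl

@[simp] theorem rf_set_10 : State.set ⟨rf a b c d e f g h i j k τ, ψ⟩ 10 l =
    ⟨rf a b c d e f g h i j l τ, ψ⟩ :=
  State.set_eq_mk fun r => by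
    match r with
    | 0 | 1 | 2 | 3 | 4 | 5 | 6 | 7 | 8 | 9 | 10 | _ + 11 => simp [rf]

@[simp] theorem rf_add (n : ℕ) : rf a b c d e f g h i j k τ (n + 11) = τ n := rfl

@[simp] theorem rf_set_add (n : ℕ) : State.set ⟨rf a b c d e f g h i j k τ, ψ⟩ (n + 11) l =
    ⟨rf a b c d e f g h i j k (Function.update τ n l), ψ⟩ :=
  State.set_eq_mk fun r => by
    match r with
    | 0 | 1 | 2 | 3 | 4 | 5 | 6 | 7 | 8 | 9 | 10 => simp [rf]
    | r + 11 => by_cases h : r = n <;> simp [rf, h]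

@[simp] theorem rf_11 : rf a b c d e f g h i j k τ 11 = τ 0 := rfl

@[simp] theorem rf_12 : rf a b c d e f g h i j k τ 12 = τ 1 := rfl

@[simp] theorem rf_set_11 : State.set ⟨rf a b c d e f g h i j k τ, ψ⟩ 11 l =
    ⟨rf a b c d e f g h i j k (Function.update τ 0 l), ψ⟩ := rf_set_add 0

@[simp] theorem rf_set_12 : State.set ⟨rf a b c d e f g h i j k τ, ψ⟩ 12 l =
    ⟨rf a b c d e f g h i j k (Function.update τ 1 l), ψ⟩ := rf_set_add 1

end rf

/-- `S` computes the function `v` of the strings in registers `11` and `12`, which are cleared,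
and pushes the value to register `9`; it needs the registers `11, …, m + 10`. -/
def Computes (S : Code) (m : ℕ) (T : Polynomial ℕ) (v : List Bool → List Bool → Bool) : Prop :=
  2 ≤ m ∧ ∀ (O : Oracle) (a b c d e f g h i j k : List Bool) (τ : ℕ → List Bool) (ψ : Ket)
    (x y : List Bool), (∀ r < m, τ r = []) →
    Det O S ⟨rf a b c d e f g h i j k (Function.update (Function.update τ 0 x) 1 y), ψ⟩
      (T.eval (x.length + y.length)) ⟨rf a b c d e f g h i (v x y :: j) k τ, ψ⟩

theorem TEPRF.exists_computes {ℓ : ℕ → ℕ} (F : TEPRF ℓ) :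
    ∃ S m T, Computes S m T F.Eval := by
  obtain ⟨a, T, ha, h⟩ := F.eval_poly
  obtain ⟨m, hm⟩ := Code.exists_detBelow ha
  -- Two additional registers guarantee that the window contains both input registers, even if `a`
  -- never mentions them.
  refine ⟨subroutine 11 (m + 2) 9 a, m + 2,
    T + Polynomial.C (m + 2) * (2 * (Polynomial.X + T) + 2) + 5, by omega, ?_⟩
  intro O b₀ b₁ b₂ b₃ b₄ b₅ b₆ b₇ b₈ b₉ b₁₀ τ ψ x y hτ
  have := det_subroutine (O := O) (K := 11) (m := m + 2) (p := 9) (ψ := ψ)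
    (base := rf b₀ b₁ b₂ b₃ b₄ b₅ b₆ b₇ b₈ b₉ b₁₀ τ) (hm.mono (by omega)) (by omega) (by omega)
    (fun r hr => by rw [add_comm, rf_add]; exact hτ r hr) (h x y).1 (h x y).2
  have e1 : (⟨Function.update (Function.update (rf b₀ b₁ b₂ b₃ b₄ b₅ b₆ b₇ b₈ b₉ b₁₀ τ) 11 x)
      (11 + 1) y, ψ⟩ : State) =
      State.set (State.set ⟨rf b₀ b₁ b₂ b₃ b₄ b₅ b₆ b₇ b₈ b₉ b₁₀ τ, ψ⟩ 11 x) 12 y := rfl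
  have e2 : (⟨Function.update (rf b₀ b₁ b₂ b₃ b₄ b₅ b₆ b₇ b₈ b₉ b₁₀ τ) 9 (F.Eval x y :: b₉),
      ψ⟩ : State) = State.set ⟨rf b₀ b₁ b₂ b₃ b₄ b₅ b₆ b₇ b₈ b₉ b₁₀ τ, ψ⟩ 9 (F.Eval x y :: b₉) :=
    rfl
  rw [e1] at this
  simp only [rf_9] at this
  rw [e2] at this
  simp only [rf_set_11, rf_set_12, rf_set_9] at this
  refine this.mono ?_
  simp

/-! ### Loading the challenge -/

/-- Flips the qubits at which the string has a `1`. -/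
def flipKet (l : List Bool) (ψ : Ket) : Ket := fun B =>
  ψ (symmDiff B ((Finset.range l.length).filter fun q => l.getD q false = true))

theorem flipKet_nil (ψ : Ket) : flipKet [] ψ = ψ := by
  funext B
  simp [flipKet, ← Finset.bot_eq_empty]

theorem filter_append_singleton (l : List Bool) (x : Bool) :
    ((Finset.range (l ++ [x]).length).filter fun q => (l ++ [x]).getD q false = true) =
      symmDiff (if x then {l.length} else ∅)
        ((Finset.range l.length).filter fun q => l.getD q false = true) := by
  ext q
  rcases lt_trichotomy q l.length with h | h | h
  · cases x <;> simp [Finset.mem_symmDiff, h, h.ne, Nat.lt_succ_of_lt h]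
  · subst h
    cases x <;> simp [Finset.mem_symmDiff]
  · cases x <;> simp [Finset.mem_symmDiff, h.ne', show ¬ q < l.length + 1 by omega,
      show ¬ q < l.length by omega]

theorem flipKet_append (l : List Bool) (x : Bool) (ψ : Ket) :
    flipKet (l ++ [x]) ψ = if x then (Gate.x l.length).apply (flipKet l ψ) else flipKet l ψ := by
  funext B
  unfold flipKet
  rw [filter_append_singleton]
  cases x
  · simp [← Finset.bot_eq_empty]
  · simp only [if_true, Gate.apply, symmDiff_assoc]

end WMark
end

noncomputable section

namespace WMark

/-! ### The extractor -/

/-- The data of one instance of the PRF in an extraction key: equivocating bit, point, two keys. -/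
abbrev Item := Bool × List Bool × List Bool × List Bool

def encItem (p : Item) : List Bool :=
  p.1 :: (encStr p.2.1 ++ encStr p.2.2.1 ++ encStr p.2.2.2)

/-- Reverses register `r` onto the top of register `r'`. -/
def moveRev (r r' : ℕ) : Code := drain r fun x => pushBit r' x

def parseStr (r f : ℕ) (B : Bool → Code) : Code := parse r f (readBit r B)

/-- Parses a point into register `12`, flipping the qubits where it has a `1`. -/
def loadPoint : Code :=
  .seq (parseStr 0 8 fun x => .seq (pushBit 3 x) (.seq (if x then .instr (.gate (.x 4)) else .skip)
    (pushBit 4 true))) (moveRev 3 12)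

def loadKey : Code := .seq (parseStr 0 8 (pushBit 3)) (moveRev 3 11)

/-- Adds the top of register `9` to the top of register `2`. -/
def addTop : Code :=
  readBit 9 fun x => if x then readBit 2 fun y => pushBit 2 (!y) else .skip

/-- Processes one instance of the PRF. -/
def loadItem (S : Code) : Code :=
  .seq (readBit 0 (pushBit 2)) (.seq loadPoint (.seq loadKey
    (.seq (parseStr 0 8 fun _ => .skip) (.seq S addTop))))

def parseNat (r f a : ℕ) : Code := parse r f (pushBit a true)

/-- Parses and applies a gate. -/
def runGate : Code :=
  readBit 1 fun x => readBit 1 fun y => .seq (parseNat 1 7 4) (.seq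
    (match x, y with
      | false, false => .instr (.gate (.x 4))
      | false, true => .instr (.gate (.h 4))
      | true, false => .instr (.gate (.t 4))
      | true, true => .seq (parseNat 1 7 5) (.seq (.instr (.gate (.cnot 4 5))) (clear 5)))
    (clear 4))

def addBits : Code :=
  drain 2 fun x => .seq (.instr (.measure 2 0))
    (if x then readBit 0 fun y => pushBit 0 (!y) else .skip)

/-- The extractor: loads the differing points, applies the circuit, measures, and compares
the outcome with the values of the first keys. -/
def extractor (S : Code) : Code :=
  .seq (parse 0 6 (parse 0 7 (loadItem S))) (.seq (clear 4) (.seq (parse 1 6 runGate) addBits))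

variable {O : Oracle}

section parts

variable {a b c d e f g h i j k l l' : List Bool} {τ : ℕ → List Bool} {ψ : Ket}

theorem foldl_cons_eq (l d : List Bool) :
    l.foldl (fun s x => x :: s) d = l.reverse ++ d := by
  induction l generalizing d with
  | nil => rfl
  | cons x l ih => simp [ih]

theorem foldl_cons_true (n : ℕ) (d : List Bool) :
    (List.replicate n ()).foldl (fun s _ => true :: s) d = List.replicate n true ++ d := by
  induction n generalizing d with
  | zero => rfl
  | succ n ih =>
    rw [List.replicate_succ, List.foldl_cons, ih, List.replicate_succ', List.append_assoc]
    rfl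

theorem det_moveRev12 : Det O (moveRev 3 12) ⟨rf a b c l e f g h i j k τ, ψ⟩
    (l.length * 5 + 1)
    ⟨rf a b c [] e f g h i j k (Function.update τ 1 (l.reverse ++ τ 1)), ψ⟩ := by
  have := det_drain (O := O) (r := 3) (tB := 1) (B := fun x => pushBit 12 x)
    (S := fun l s => ⟨rf a b c l e f g h i j k (Function.update τ 1 s), ψ⟩)
    (g := fun s x => x :: s) (by simp) (by simp)
    (fun x l s => det_pushBit.congr le_rfl (by simp)) l (τ 1)
  rw [foldl_cons_eq, Function.update_eq_self] at this
  exact this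

theorem det_moveRev11 : Det O (moveRev 3 11) ⟨rf a b c l e f g h i j k τ, ψ⟩
    (l.length * 5 + 1)
    ⟨rf a b c [] e f g h i j k (Function.update τ 0 (l.reverse ++ τ 0)), ψ⟩ := by
  have := det_drain (O := O) (r := 3) (tB := 1) (B := fun x => pushBit 11 x)
    (S := fun l s => ⟨rf a b c l e f g h i j k (Function.update τ 0 s), ψ⟩)
    (g := fun s x => x :: s) (by simp) (by simp)
    (fun x l s => det_pushBit.congr le_rfl (by simp)) l (τ 0)
  rw [foldl_cons_eq, Function.update_eq_self] at this
  exact this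

theorem foldl_load (l : List Bool) (s : List Bool × List Bool) :
    l.foldl (fun s x => (x :: s.1, s.2 ++ [x])) s = (l.reverse ++ s.1, s.2 ++ l) := by
  induction l generalizing s with
  | nil => simp
  | cons x l ih => simp [ih]

/-- The point is appended to the bits loaded before, the number of which is in register `4`. -/
theorem det_loadPoint (s bits : List Bool) (hτ : τ 1 = []) : Det O loadPoint
    ⟨rf (encStr s ++ l) b c [] (List.replicate bits.length true) f g h [] j k τ, flipKet bits ψ⟩
    (s.length * 20 + 20)
    ⟨rf l b c [] (List.replicate (bits ++ s).length true) f g h [] j k (Function.update τ 1 s),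
      flipKet (bits ++ s) ψ⟩ := by
  have h1 := det_parse (O := O) (r := 0) (f := 8) (tB := 8)
    (B := readBit 0 fun x => .seq (pushBit 3 x)
      (.seq (if x then .instr (.gate (.x 4)) else .skip) (pushBit 4 true)))
    (S := fun l x s => ⟨rf l b c s.1 (List.replicate s.2.length true) f g h x j k τ,
      flipKet s.2 ψ⟩)
    (g := fun (s : List Bool × List Bool) x => (x :: s.1, s.2 ++ [x])) (enc := fun x => [x])
    (by simp) (by simp) (by simp) (by simp) s
    (fun x _ l s => by
      refine det_readBit (t := 5) rfl ?_
      cases x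
      · refine (det_pushBit.seq (Det.skip.seq det_pushBit)).congr le_rfl ?_
        simp [flipKet_append, List.replicate_succ]
      · refine (det_pushBit.seq (Det.gate.seq det_pushBit)).congr le_rfl ?_
        simp [flipKet_append, List.replicate_succ, Gate.map])
    l ([], bits)
  rw [foldl_load] at h1
  refine (h1.seq det_moveRev12).congr ?_ ?_
  · simp; omega
  · simp [hτ]

theorem det_loadKey (s : List Bool) (hτ : τ 0 = []) : Det O loadKey
    ⟨rf (encStr s ++ l) b c [] e f g h [] j k τ, ψ⟩ (s.length * 20 + 20)
    ⟨rf l b c [] e f g h [] j k (Function.update τ 0 s), ψ⟩ := by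
  have h1 := det_parse (O := O) (r := 0) (f := 8) (tB := 4) (B := readBit 0 (pushBit 3))
    (S := fun l x s => ⟨rf l b c s e f g h x j k τ, ψ⟩)
    (g := fun (s : List Bool) x => x :: s) (enc := fun x => [x])
    (by simp) (by simp) (by simp) (by simp) s
    (fun x _ l s => by
      refine det_readBit (t := 1) rfl ?_
      exact det_pushBit.congr le_rfl (by simp))
    l []
  rw [foldl_cons_eq] at h1
  refine (h1.seq det_moveRev11).congr ?_ ?_
  · simp; omega
  · simp [hτ]

theorem det_skipStr (s : List Bool) : Det O (parseStr 0 8 fun _ => .skip)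
    ⟨rf (encStr s ++ l) b c d e f g h [] j k τ, ψ⟩ (s.length * 20 + 20)
    ⟨rf l b c d e f g h [] j k τ, ψ⟩ := by
  have h1 := det_parse (O := O) (r := 0) (f := 8) (tB := 4) (B := readBit 0 fun _ => .skip)
    (S := fun l x (_ : Unit) => ⟨rf l b c d e f g h x j k τ, ψ⟩)
    (g := fun s (_ : Bool) => s) (enc := fun x => [x])
    (by simp) (by simp) (by simp) (by simp) s
    (fun x _ l s => by
      refine det_readBit (t := 1) rfl ?_
      exact Det.skip.congr le_rfl (by simp))
    l ()
  exact h1.congr (by omega) rfl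

theorem det_addTop (x y : Bool) : Det O addTop
    ⟨rf a b (y :: c) d e f g h i (x :: j) k τ, ψ⟩ 7
    ⟨rf a b (xor y x :: c) d e f g h i j k τ, ψ⟩ := by
  refine det_readBit (t := 4) rfl ?_
  cases x
  · exact Det.skip.congr (by omega) (by simp)
  · simp only [if_true]
    refine det_readBit (t := 1) (x := y) (l := c) (by simp) ?_
    exact det_pushBit.congr le_rfl (by simp)

/-- The bit that has to be added to the output of the circuit. -/
def Item.bit (v : List Bool → List Bool → Bool) (p : Item) : Bool := xor p.1 (v p.2.2.1 p.2.1)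

/-- Register `2` collects the correction bits in reverse order. Register `4` counts the loaded bits
in unary, so that the next point goes to the next free qubits. The second key is parsed but ignored,
because the correction bit only involves the first one. -/
theorem det_loadItem {S : Code} {m : ℕ} {T : Polynomial ℕ} {v : List Bool → List Bool → Bool}
    (hS : Computes S m T v) (hτ : ∀ r < m, τ r = []) (p : Item) (bits : List Bool) (n : ℕ)
    (hn : p.2.1.length + p.2.2.1.length + p.2.2.2.length ≤ n) :
    Det O (loadItem S) ⟨rf (encItem p ++ l) b c [] (List.replicate bits.length true) f g h [] [] k τ,
        flipKet bits ψ⟩ (20 * n + T.eval n + 100)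
      ⟨rf l b (p.bit v :: c) [] (List.replicate (bits ++ p.2.1).length true) f g h [] [] k τ,
        flipKet (bits ++ p.2.1) ψ⟩ := by
  obtain ⟨x, s, k₀, k₁⟩ := p
  simp only at hn
  have hT : T.eval (k₀.length + s.length) ≤ T.eval n := polynomial_eval_mono T (by omega)
  have hm := hS.1
  have h0 : Det O (readBit 0 (pushBit 2))
      ⟨rf (encItem (x, s, k₀, k₁) ++ l) b c [] (List.replicate bits.length true) f g h [] [] k τ,
        flipKet bits ψ⟩ 4
      ⟨rf (encStr s ++ (encStr k₀ ++ (encStr k₁ ++ l))) b (x :: c) []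
        (List.replicate bits.length true) f g h [] [] k τ, flipKet bits ψ⟩ := by
    refine det_readBit (t := 1) (x := x) (l := encStr s ++ (encStr k₀ ++ (encStr k₁ ++ l))) ?_ ?_
    · simp [encItem]
    · exact det_pushBit.congr le_rfl (by simp)
  refine (h0.seq ((det_loadPoint s bits (hτ 1 (by omega))).seq ((det_loadKey k₀ ?_).seq
    ((det_skipStr k₁).seq ((?_ : Det O S _ (T.eval (k₀.length + s.length))
      ⟨rf l b (x :: c) [] (List.replicate (bits ++ s).length true) f g h [] [v k₀ s] k τ,
        flipKet (bits ++ s) ψ⟩).seq (det_addTop _ _)))))).congr ?_ rfl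
  · rw [Function.update_of_ne (by omega)]; exact hτ 0 (by omega)
  · rw [Function.update_comm (by omega)]
    exact hS.2 _ _ _ _ _ _ _ _ _ _ _ _ _ _ _ _ hτ
  · omega

end parts

end WMark
end

/-! ### Correctness and running time of the extractor -/

noncomputable section

namespace WMark

/-- A number is encoded as a list of empty items, so `det_parse` reads it as well. -/
theorem encNat_eq (n : ℕ) :
    encNat n = encList (fun _ : Unit => []) (List.replicate n ()) := by
  simp only [encNat, encList]
  congr 1
  induction n with
  | zero => rfl
  | succ n ih => simp only [List.replicate_succ, List.flatMap_cons, ← ih]; rfl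

theorem length_le_length_encList {α : Type} (f : α → List Bool) (l : List α) :
    l.length ≤ (encList f l).length := by
  induction l with
  | nil => simp
  | cons a l ih => simp only [encList, List.flatMap_cons, List.length_append,
      List.length_cons] at ih ⊢; omega

theorem length_item_le {α : Type} (f : α → List Bool) {l : List α} {a : α} (h : a ∈ l) :
    (f a).length ≤ (encList f l).length := by
  induction l with
  | nil => simp at h
  | cons b l ih =>
    simp only [encList, List.flatMap_cons, List.length_append, List.length_cons] at ih ⊢
    rcases List.mem_cons.1 h with rfl | h
    · omega
    · have := ih h; omega

theorem length_le_encStr (s : List Bool) : s.length ≤ (encStr s).length :=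
  length_le_length_encList _ s

variable {O : Oracle}

section parts

variable {a b c d e f g h i j k l l' : List Bool} {τ : ℕ → List Bool} {ψ : Ket}

theorem det_parseNat4 (n : ℕ) : Det O (parseNat 1 7 4)
    ⟨rf a (encNat n ++ l) c d e f g [] i j k τ, ψ⟩ (n * 5 + 8)
    ⟨rf a l c d (List.replicate n true ++ e) f g [] i j k τ, ψ⟩ := by
  have h1 := det_parse (O := O) (r := 1) (f := 7) (tB := 1) (B := pushBit 4 true)
    (S := fun l x s => ⟨rf a l c d s f g x i j k τ, ψ⟩)
    (g := fun s _ => true :: s) (enc := fun _ : Unit => [])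
    (by simp) (by simp) (by simp) (by simp) (List.replicate n ())
    (fun x _ l s => det_pushBit.congr le_rfl (by simp)) l e
  rw [foldl_cons_true, ← encNat_eq] at h1
  simpa [parseNat] using h1

theorem det_parseNat5 (n : ℕ) : Det O (parseNat 1 7 5)
    ⟨rf a (encNat n ++ l) c d e f g [] i j k τ, ψ⟩ (n * 5 + 8)
    ⟨rf a l c d e (List.replicate n true ++ f) g [] i j k τ, ψ⟩ := by
  have h1 := det_parse (O := O) (r := 1) (f := 7) (tB := 1) (B := pushBit 5 true)
    (S := fun l x s => ⟨rf a l c d e s g x i j k τ, ψ⟩)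
    (g := fun s _ => true :: s) (enc := fun _ : Unit => [])
    (by simp) (by simp) (by simp) (by simp) (List.replicate n ())
    (fun x _ l s => det_pushBit.congr le_rfl (by simp)) l f
  rw [foldl_cons_true, ← encNat_eq] at h1
  simpa [parseNat] using h1

theorem det_runGate (G : Gate) : Det O runGate
    ⟨rf a (encGate G ++ l) c d [] [] g [] i j k τ, ψ⟩ (20 * (encGate G).length + 40)
    ⟨rf a l c d [] [] g [] i j k τ, G.apply ψ⟩ := by
  have key : ∀ (x y : Bool) (n : ℕ) (rest : List Bool) (B : Code) (t : ℕ),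
      encGate G = [x, y] ++ encNat n ++ rest →
      (Det O B ⟨rf a (rest ++ l) c d (List.replicate n true) [] g [] i j k τ, ψ⟩ t
        ⟨rf a l c d (List.replicate n true) [] g [] i j k τ, G.apply ψ⟩) →
      t ≤ 12 * rest.length + 15 →
      Det O (.seq (parseNat 1 7 4) (.seq B (clear 4)))
        ⟨rf a (encNat n ++ (rest ++ l)) c d [] [] g [] i j k τ, ψ⟩ (20 * (encGate G).length + 34)
        ⟨rf a l c d [] [] g [] i j k τ, G.apply ψ⟩ := by
    intro x y n rest B t hG hB ht
    refine ((det_parseNat4 n).seq (Det.seq (by simpa using hB) det_clear)).congr ?_ (by simp)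
    simp only [hG, encNat, List.length_append, List.length_replicate, rf_4, List.length_cons,
      List.length_nil]
    omega
  have hrd : ∀ (x y : Bool) (n : ℕ) (rest : List Bool) (B : Bool → Bool → Code),
      encGate G = [x, y] ++ encNat n ++ rest →
      Det O (B x y)
        ⟨rf a (encNat n ++ (rest ++ l)) c d [] [] g [] i j k τ, ψ⟩ (20 * (encGate G).length + 34)
        ⟨rf a l c d [] [] g [] i j k τ, G.apply ψ⟩ →
      Det O (readBit 1 fun x => readBit 1 fun y => B x y)
        ⟨rf a (encGate G ++ l) c d [] [] g [] i j k τ, ψ⟩ (20 * (encGate G).length + 40)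
        ⟨rf a l c d [] [] g [] i j k τ, G.apply ψ⟩ := by
    intro x y n rest B hG hB
    refine det_readBit (x := x) (l := y :: (encNat n ++ (rest ++ l)))
      (t := 20 * (encGate G).length + 37) (by simp [hG]) ?_
    refine det_readBit (x := y) (l := (encNat n ++ (rest ++ l)))
      (t := 20 * (encGate G).length + 34) (by simp) ?_
    simpa using hB
  cases G with
  | x n =>
    refine hrd false false n [] _ (by simp [encGate]) (key false false n [] _ 1 (by simp [encGate])
      ?_ (by simp))
    exact Det.gate.congr le_rfl (by simp [Gate.map])
  | h n =>
    refine hrd false true n [] _ (by simp [encGate]) (key false true n [] _ 1 (by simp [encGate])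
      ?_ (by simp))
    exact Det.gate.congr le_rfl (by simp [Gate.map])
  | t n =>
    refine hrd true false n [] _ (by simp [encGate]) (key true false n [] _ 1 (by simp [encGate])
      ?_ (by simp))
    exact Det.gate.congr le_rfl (by simp [Gate.map])
  | cnot n n' =>
    refine hrd true true n (encNat n') _ (by simp [encGate]) (key true true n (encNat n') _
      (7 * n' + 15) (by simp [encGate]) ?_ (by simp [encNat]; omega))
    refine ((det_parseNat5 n').seq (Det.gate.seq det_clear)).congr ?_ ?_
    · simp; omega
    · simp [Gate.map]

theorem det_runCircuit (C : Circuit) (n : ℕ) (hn : (encCircuit C).length ≤ n) :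
    Det O (parse 1 6 runGate) ⟨rf a (encCircuit C) c d [] [] [] [] i j k τ, ψ⟩
      (n * (20 * n + 44) + 8) ⟨rf a [] c d [] [] [] [] i j k τ, C.apply ψ⟩ := by
  have h1 := det_parse (O := O) (r := 1) (f := 6) (tB := 20 * n + 40) (B := runGate)
    (S := fun l x s => ⟨rf a l c d [] [] x [] i j k τ, s⟩)
    (g := fun φ g => Gate.apply g φ) (enc := encGate)
    (by simp) (by simp) (by simp) (by simp) C
    (fun x hx l s => (det_runGate x).mono (by
      have := (length_item_le encGate hx).trans hn; omega)) [] ψ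
  rw [List.append_nil] at h1
  refine h1.congr ?_ rfl
  have := (length_le_length_encList encGate C).trans hn
  gcongr

/-- Projection to the vectors with value `x` of qubit `q`. -/
def proj (q : ℕ) (x : Bool) (ψ : Ket) : Ket := fun B => if decide (q ∈ B) = x then ψ B else 0

/-- The branches of the measurement of all qubits at the end of the extractor. -/
def measured (rest : List Bool → ℕ → List Bool) : List Bool → List Bool → Ket → List State
  | [], a, ψ => [⟨rest a, ψ⟩]
  | x :: c, a, ψ => [false, true].flatMap fun y =>
      measured rest c (xor y x :: a) (proj c.length y ψ)

/-- Register `2` is at the same time the stack of correction bits and the address of the qubit to be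
measured: after a pop its length is the index of the qubit to which the popped bit belongs. Qubits
are thus measured from the last to the first, and pushing the results leaves them in the right order
in register `0`. -/
theorem runs_addBits (c a : List Bool) (ψ : Ket) :
    Runs O [addBits] ⟨rf a b c d e f g h i j k τ, ψ⟩ (c.length * 20 + 1)
      (measured (fun a => rf a b [] d e f g h i j k τ) c a ψ) := by
  induction c generalizing a ψ with
  | nil => exact Det.loop_nil rfl
  | cons x c ih =>
    have h1 : Runs O [readBit 2 fun x => .seq (.instr (.measure 2 0))
        (if x then readBit 0 fun y => pushBit 0 (!y) else .skip)]
        ⟨rf a b (x :: c) d e f g h i j k τ, ψ⟩ 10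
        ([false, true].map fun y => ⟨rf (xor y x :: a) b c d e f g h i j k τ,
          proj c.length y ψ⟩) := by
      refine runs_readBit (t := 7) rfl ?_
      rw [rf_set_2]
      have h2 := Runs.instr O (.measure 2 0) ⟨rf a b c d e f g h i j k τ, ψ⟩
      have h3 : ∀ y : Bool, (⟨Function.update (rf a b c d e f g h i j k τ) 0 (y :: a),
          fun B => if decide (c.length ∈ B) = y then ψ B else 0⟩ : State) =
          ⟨rf (y :: a) b c d e f g h i j k τ, proj c.length y ψ⟩ := fun y => by
        have := rf_set_0 (a := a) (b := b) (c := c) (d := d) (e := e) (f := f) (g := g) (h := h)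
          (i := i) (j := j) (k := k) (τ := τ) (l := y :: a) (ψ := proj c.length y ψ)
        exact this
      rw [show (Instr.measure 2 0).apply O ⟨rf a b c d e f g h i j k τ, ψ⟩ = [false, true].map
        fun y => ⟨rf (y :: a) b c d e f g h i j k τ, proj c.length y ψ⟩ from
        List.map_congr_left fun y _ => h3 y] at h2
      have h4 := Runs.mono (t' := 7) (Runs.seq (t' := 5) h2 (M := fun σ => [σ.set 0 (match σ.reg 0 with
        | [] => [] | y :: l => xor y x :: l)])
        (b := if x then readBit 0 fun y => pushBit 0 (!y) else .skip) ?_) (by omega)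
      · simpa using h4
      intro σ hσ
      have : ∃ y, σ = ⟨rf (y :: a) b c d e f g h i j k τ, proj c.length y ψ⟩ := by
        simp only [List.map_cons, List.map_nil, List.mem_cons, List.not_mem_nil, or_false] at hσ
        rcases hσ with h | h
        exacts [⟨_, h⟩, ⟨_, h⟩]
      obtain ⟨y, rfl⟩ := this
      cases x
      · exact Det.skip.congr (by omega) (by simp)
      · simp only [if_true]
        refine Det.mono (t := 4) (det_readBit (t := 1) (x := y) (l := a) (by simp) ?_) (by omega)
        exact det_pushBit.congr le_rfl (by simp)
    refine (Runs.loop (by simp) h1 (M := fun σ => measured (fun a => rf a b [] d e f g h i j k τ)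
      c (σ.reg 0) σ.ket) (t' := c.length * 20 + 1) ?_).mono (by simp; omega)
    intro σ hσ
    simp only [List.map_cons, List.map_nil, List.mem_cons, List.not_mem_nil, or_false] at hσ
    rcases hσ with rfl | rfl
    · exact ih _ _
    · exact ih _ _

/-- The output of the extractor is the list of the bits of the items plus the outcomes. -/
theorem runs_extractor {S : Code} {m : ℕ} {T : Polynomial ℕ} {v : List Bool → List Bool → Bool}
    (hS : Computes S m T v) (hτ : ∀ r < m, τ r = []) (items : List (List Item)) (C : Circuit)
    (n : ℕ) (hn : (encList (encList encItem) items).length + (encCircuit C).length ≤ n) :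
    Runs O [extractor S] ⟨rf (encList (encList encItem) items) (encCircuit C)
        [] [] [] [] [] [] [] [] k τ, ψ⟩
      ((n * (n * (20 * n + T.eval n + 104) + 12) + 8) + n * (20 * n + 44) + 22 * n + 50 + 2 * n ^ 3)
      (measured (fun a => rf a [] [] [] [] [] [] [] [] [] k τ)
        (items.flatten.map (Item.bit v)).reverse []
        (C.apply (flipKet (items.flatten.flatMap fun p => p.2.1) ψ))) := by
  have hlen : ∀ row ∈ items, row.length ≤ n := fun row hrow =>
    (length_le_length_encList encItem row).trans
      ((length_item_le (encList encItem) hrow).trans (by omega))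
  have hlen' : ∀ row ∈ items, ∀ p ∈ row,
      p.2.1.length + p.2.2.1.length + p.2.2.2.length ≤ n := fun row hrow p hp => by
    have h1 := length_item_le encItem hp
    have h2 := length_item_le (encList encItem) hrow
    have h3 := length_le_encStr p.2.1
    have h4 := length_le_encStr p.2.2.1
    have h5 := length_le_encStr p.2.2.2
    simp only [encItem, List.length_cons, List.length_append] at h1
    omega
  have hni : items.length ≤ n := (length_le_length_encList (encList encItem) items).trans
    (by omega)
  let S₁ : List Bool → List Bool → List Bool → List Bool × List Bool → State := fun l x y s =>
    ⟨rf l (encCircuit C) s.1 [] (List.replicate s.2.length true) [] x y [] [] k τ, flipKet s.2 ψ⟩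
  let step₁ : List Bool × List Bool → Item → List Bool × List Bool := fun s p =>
    (p.bit v :: s.1, s.2 ++ p.2.1)
  have hrow : ∀ row ∈ items, ∀ l s, Det O (parse 0 7 (loadItem S))
      (S₁ (encList encItem row ++ l) [true] [] s) (n * (20 * n + T.eval n + 104) + 8)
      (S₁ l [true] [] (row.foldl step₁ s)) := fun row hr l s =>
    (det_parse (O := O) (r := 0) (f := 7) (tB := 20 * n + T.eval n + 100) (B := loadItem S)
      (S := fun l x s => S₁ l [true] x s) (g := step₁) (enc := encItem)
      (by simp [S₁]) (by simp [S₁]) (by simp [S₁]) (by simp [S₁]) row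
      (fun p hp l s => det_loadItem hS hτ p s.2 n (hlen' row hr p hp)) l s).mono
      (by have := hlen row hr; gcongr)
  have hfold : ∀ (row : List Item) (s : List Bool × List Bool), row.foldl step₁ s =
      ((row.map (Item.bit v)).reverse ++ s.1, s.2 ++ row.flatMap fun p => p.2.1) := by
    intro row
    induction row with
    | nil => simp
    | cons p row ih => intro s; simp [ih, step₁]
  have h1 := det_parse (O := O) (r := 0) (f := 6) (tB := n * (20 * n + T.eval n + 104) + 8)
    (B := parse 0 7 (loadItem S)) (S := fun l x s => S₁ l x [] s)
    (g := fun s (row : List Item) => row.foldl step₁ s) (enc := encList encItem)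
    (by simp [S₁]) (by simp [S₁]) (by simp [S₁]) (by simp [S₁]) items hrow [] ([], [])
  have hflat : items.foldl (fun s (row : List Item) => row.foldl step₁ s) ([], []) =
      ((items.flatten.map (Item.bit v)).reverse, items.flatten.flatMap fun p => p.2.1) := by
    rw [← List.foldl_flatten, hfold]
    simp
  rw [hflat, List.append_nil] at h1
  have h0 : S₁ (encList (encList encItem) items) [] [] ([], []) =
      ⟨rf (encList (encList encItem) items) (encCircuit C) [] [] [] [] [] [] [] [] k τ, ψ⟩ := by
    simp [S₁, flipKet_nil]
  rw [h0] at h1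
  -- A crude bound, by at most `n` rows of at most `n` items with points of at most `n` bits. It
  -- only serves to pay for clearing the qubit counter.
  have hbits : (items.flatten.flatMap fun p => p.2.1).length ≤ n ^ 3 := by
    rw [List.length_flatMap]
    refine (List.sum_le_card_nsmul _ n ?_).trans ?_
    · intro q hq
      obtain ⟨p, hp, rfl⟩ := List.mem_map.1 hq
      obtain ⟨row, hr, hp⟩ := List.mem_flatten.1 hp
      have := hlen' row hr p hp
      omega
    · rw [List.length_map, List.length_flatten, smul_eq_mul, pow_succ]
      gcongr
      refine (List.sum_le_card_nsmul _ n ?_).trans ?_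
      · intro q hq
        obtain ⟨row, hr, rfl⟩ := List.mem_map.1 hq
        exact hlen row hr
      · rw [List.length_map, smul_eq_mul, sq]; gcongr
  have hm2 : (items.flatten.map (Item.bit v)).reverse.length ≤ n := by
    rw [List.length_reverse, List.length_map]
    refine le_trans ?_ (Nat.le_of_add_right_le hn)
    clear * -
    induction items with
    | nil => simp
    | cons row items ih =>
      have := length_le_length_encList encItem row
      simp only [encList, List.flatMap_cons, List.length_append, List.length_cons,
        List.flatten_cons] at ih this ⊢
      omega
  have h2 := det_runCircuit (O := O) (a := []) (c := (items.flatten.map (Item.bit v)).reverse)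
    (d := []) (i := []) (j := []) (k := k) (τ := τ)
    (ψ := flipKet (items.flatten.flatMap fun p => p.2.1) ψ) C n (by omega)
  have h3 := runs_addBits (O := O) (b := []) (d := []) (e := []) (f := []) (g := []) (h := [])
    (i := []) (j := []) (k := k) (τ := τ) (items.flatten.map (Item.bit v)).reverse []
    (C.apply (flipKet (items.flatten.flatMap fun p => p.2.1) ψ))
  have h4 := det_clear (O := O) (r := 4) (σ := S₁ [] [] []
    ((items.flatten.map (Item.bit v)).reverse, items.flatten.flatMap fun p => p.2.1))
  simp only [S₁, rf_set_4, rf_4, List.length_replicate] at h4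
  refine (h1.seqRuns (h4.seqRuns (h2.seqRuns h3))).mono ?_
  have : items.length * (n * (20 * n + T.eval n + 104) + 8 + 4) ≤
    n * (n * (20 * n + T.eval n + 104) + 12) := by gcongr
  omega

end parts

/-! ### Outcome probabilities of the final measurement -/

theorem mem_measured {rest : List Bool → ℕ → List Bool} {c a : List Bool} {ψ : Ket} {σ : State}
    (h : σ ∈ measured rest c a ψ) : ∃ y φ, y.length = c.length ∧ σ = ⟨rest (y ++ a), φ⟩ := by
  induction c generalizing a ψ with
  | nil => exact ⟨[], ψ, rfl, by simpa [measured] using h⟩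
  | cons x c ih =>
    simp only [measured, List.mem_flatMap] at h
    obtain ⟨z, _, h⟩ := h
    obtain ⟨y, φ, hy, hσ⟩ := ih h
    exact ⟨y ++ [xor z x], φ, by simp [hy], by simpa using hσ⟩

theorem weight_append (L L' : List State) (E : State → Prop) :
    weight (L ++ L') E = weight L E + weight L' E := by
  simp [weight]

theorem weight_eq_zero {L : List State} {E : State → Prop} (h : ∀ σ ∈ L, ¬ E σ) :
    weight L E = 0 := by
  unfold weight
  refine List.sum_eq_zero fun x hx => ?_
  obtain ⟨σ, hσ, rfl⟩ := List.mem_map.1 hx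
  simp [h σ hσ]

open Classical in
/-- The probability that all measured bits have given values. -/
theorem weight_measured {rest : List Bool → ℕ → List Bool} (hrest : ∀ a, rest a 0 = a)
    (c a y : List Bool) (ψ : Ket) (hy : y.length = c.length) :
    weight (measured rest c a ψ) (fun σ => σ.reg 0 = y ++ a) =
      ∑' B, if ∀ q < c.length, decide (q ∈ B) = xor (y.getD q false) (c.reverse.getD q false)
        then ‖ψ B‖ ^ 2 else 0 := by
  induction c generalizing a y ψ with
  | nil =>
    have : y = [] := List.length_eq_zero_iff.1 hy
    subst this
    simp [measured, weight, hrest, normSq]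
  | cons x c ih =>
    obtain ⟨y, z, rfl⟩ : ∃ y' z, y = y' ++ [z] := by
      rcases List.eq_nil_or_concat y with rfl | ⟨y', z, h⟩
      · simp at hy
      · exact ⟨y', z, by simpa using h⟩
    have hy' : y.length = c.length := by simpa using hy
    -- Exactly one outcome `t` of the last qubit satisfies `xor t x = z`. In the other branch a
    -- wrong bit has been written, and later measurements only add bits in front of it.
    have hbad : ∀ t, xor t x ≠ z → weight (measured rest c (xor t x :: a) (proj c.length t ψ))
        (fun σ => σ.reg 0 = y ++ [z] ++ a) = 0 := by
      intro t ht
      refine weight_eq_zero fun σ hσ h => ht ?_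
      obtain ⟨y', φ, hy₁, rfl⟩ := mem_measured hσ
      simp only [hrest, List.append_assoc, List.singleton_append] at h
      exact (List.cons.inj (List.append_inj h (hy₁.trans hy'.symm)).2).1
    have hgood : ∀ t, xor t x = z → weight (measured rest c (xor t x :: a) (proj c.length t ψ))
        (fun σ => σ.reg 0 = y ++ [z] ++ a) = ∑' B, if ∀ q < (x :: c).length, decide (q ∈ B) =
          xor ((y ++ [z]).getD q false) ((x :: c).reverse.getD q false) then ‖ψ B‖ ^ 2 else 0 := by
      rintro t rfl
      rw [List.append_assoc, List.singleton_append, ih _ _ _ hy']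
      refine tsum_congr fun B => ?_
      have hiff : (∀ q < (x :: c).length, decide (q ∈ B) = xor ((y ++ [xor t x]).getD q false)
          ((x :: c).reverse.getD q false)) ↔ (∀ q < c.length, decide (q ∈ B) =
          xor (y.getD q false) (c.reverse.getD q false)) ∧ decide (c.length ∈ B) = t := by
        have e1 : ∀ q < c.length, xor ((y ++ [xor t x]).getD q false)
            ((x :: c).reverse.getD q false) = xor (y.getD q false) (c.reverse.getD q false) := by
          intro q hq
          rw [List.reverse_cons, List.getD_append _ _ _ _ (by omega),
            List.getD_append _ _ _ _ (by simpa using hq)]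
        have e2 : xor ((y ++ [xor t x]).getD c.length false)
            ((x :: c).reverse.getD c.length false) = t := by
          rw [List.reverse_cons, List.getD_append_right _ _ _ _ (by omega),
            List.getD_append_right _ _ _ _ (by simp)]
          simp [hy']
        constructor
        · intro h
          refine ⟨fun q hq => ?_, ?_⟩
          · rw [h q (by simp; omega), e1 q hq]
          · rw [h c.length (by simp), e2]
        · rintro ⟨h1, h2⟩ q hq
          rcases Nat.lt_succ_iff_lt_or_eq.1 (by simpa using hq) with h3 | rfl
          · rw [h1 q h3, e1 q h3]
          · rw [h2, e2]
      by_cases h1 : decide (c.length ∈ B) = t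
      · simp only [hiff, h1, and_true, proj, if_true]
      · simp only [hiff, h1, and_false, proj, if_false]
        simp
    simp only [measured, List.flatMap_cons, List.flatMap_nil, List.append_nil]
    rw [weight_append]
    by_cases h0 : xor false x = z
    · rw [hgood false h0, hbad true (by rw [← h0]; cases x <;> simp), add_zero]
    · rw [hbad false h0, hgood true (by cases x <;> cases z <;> simp_all), zero_add]

end WMark
end

noncomputable section

namespace WMark

/-! ### Simulation of an oracle by a program -/

/-- Copies register `r` to the front of register `r'`. -/
def copyReg (r r' : ℕ) : Code :=
  .seq (drain r (pushBit 3)) (drain 3 fun x => .seq (pushBit r x) (pushBit r' x))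

/-- Takes bits from register `5`, which is padded with zeros, to register `3`, and puts a flag
into register `8` if they differ from the string `p`. -/
def takeBits : List Bool → Code
  | [] => .skip
  | x :: p =>
    let B : Bool → Code := fun y =>
      .seq (pushBit 3 y) (if y = x then .skip else pushBit 8 true)
    .seq (.ite 5 (.seq (.instr (.pop 5)) (B true)) (.seq (.instr (.pop 5)) (B false)) (B false))
      (takeBits p)

/-- An evaluation key, where `none` stands for the key in register `10`, and a point at which
the value is flipped. -/
abbrev Entry := Option (List Bool) × Option (List Bool)

def loadEntryKey : Option (List Bool) → Code
  | none => copyReg 10 11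
  | some key => pushList 11 key

def initFlag : Option (List Bool) → Code
  | none => pushBit 8 true
  | some _ => .skip

/-- Evaluates one instance of the PRF at the next `l` bits of register `5`. -/
def entryCode (S : Code) (l : ℕ) (e : Entry) : Code :=
  .seq (initFlag e.2)
    (.seq (takeBits (e.2.getD (List.replicate l false))) (.seq (moveRev 3 12)
      (.seq (loadEntryKey e.1)
        (.seq S (.seq (.ite 8 .skip .skip (readBit 9 fun x => pushBit 9 (!x))) (clear 8))))))

def rowCode (S : Code) (l : ℕ) : List Entry → Code
  | [] => .skip
  | e :: row => .seq (entryCode S l e) (rowCode S l row)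

/-- Answers a query in register `r + 11` in register `r' + 11`. -/
def queryCode (S : Code) (l : ℕ) (row : List Entry) (r r' : ℕ) : Code :=
  .seq (copyReg (r + 11) 5) (.seq (rowCode S l row) (.seq (clear 5) (.seq (clear (r' + 11))
    (moveRev 9 (r' + 11)))))

/-- Missing bits are read as zeros, in agreement with the convention of `readBits` for queries to
the oracles. -/
def padTake : ℕ → List Bool → List Bool
  | 0, _ => []
  | l + 1, q => q.headD false :: padTake l q.tail

def Entry.val (v : List Bool → List Bool → Bool) (key : List Bool) (e : Entry) (x : List Bool) :
    Bool := xor (v (e.1.getD key) x) (decide (e.2 = some x))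

def rowVal (v : List Bool → List Bool → Bool) (key : List Bool) (l : ℕ) :
    List Entry → List Bool → List Bool
  | [], _ => []
  | e :: row, q => e.val v key (padTake l q) :: rowVal v key l row (q.drop l)

theorem length_padTake (l : ℕ) (q : List Bool) : (padTake l q).length = l := by
  induction l generalizing q with
  | zero => rfl
  | succ l ih => simp [padTake, ih]

theorem length_rowVal (v : List Bool → List Bool → Bool) (key : List Bool) (l : ℕ)
    (row : List Entry) (q : List Bool) : (rowVal v key l row q).length = row.length := by
  induction row generalizing q with
  | nil => rfl
  | cons e row ih => simp [rowVal, ih]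

variable {O : Oracle}

/-! ### Correctness and running time of the simulated oracle -/

section parts

variable {a b c d e f g h i j k l l' : List Bool} {τ : ℕ → List Bool} {ψ : Ket}

theorem det_copyQuery (n : ℕ) : Det O (copyReg (n + 11) 5)
    ⟨rf a b c [] e f g h i j k τ, ψ⟩ (12 * (τ n).length + 3)
    ⟨rf a b c [] e (τ n ++ f) g h i j k τ, ψ⟩ := by
  have h1 := det_drain (O := O) (r := n + 11) (tB := 1) (B := pushBit 3)
    (S := fun l s => ⟨rf a b c s e f g h i j k (Function.update τ n l), ψ⟩)
    (g := fun s x => x :: s) (by simp) (by simp)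
    (fun x l s => det_pushBit.congr le_rfl (by simp)) (τ n) []
  have h2 := det_drain (O := O) (r := 3) (tB := 3)
    (B := fun x => .seq (pushBit (n + 11) x) (pushBit 5 x))
    (S := fun l s => ⟨rf a b c l e (s ++ f) g h i j k (Function.update τ n s), ψ⟩)
    (g := fun s x => x :: s) (by simp) (by simp)
    (fun x l s => (det_pushBit.seq det_pushBit).congr le_rfl (by simp))
    (τ n).reverse []
  rw [foldl_cons_eq] at h1 h2
  simp only [List.reverse_reverse, List.append_nil, Function.update_eq_self] at h1 h2
  exact (h1.seq h2).congr (by simp; omega) rfl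

theorem det_copyKey : Det O (copyReg 10 11)
    ⟨rf a b c [] e f g h i j k τ, ψ⟩ (12 * k.length + 3)
    ⟨rf a b c [] e f g h i j k (Function.update τ 0 (k ++ τ 0)), ψ⟩ := by
  have h1 := det_drain (O := O) (r := 10) (tB := 1) (B := pushBit 3)
    (S := fun l s => ⟨rf a b c s e f g h i j l τ, ψ⟩)
    (g := fun s x => x :: s) (by simp) (by simp)
    (fun x l s => det_pushBit.congr le_rfl (by simp)) k []
  have h2 := det_drain (O := O) (r := 3) (tB := 3)
    (B := fun x => .seq (pushBit 10 x) (pushBit 11 x))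
    (S := fun l s => ⟨rf a b c l e f g h i j s (Function.update τ 0 (s ++ τ 0)), ψ⟩)
    (g := fun s x => x :: s) (by simp) (by simp)
    (fun x l s => (det_pushBit.seq det_pushBit).congr le_rfl (by simp))
    k.reverse []
  rw [foldl_cons_eq] at h1 h2
  simp only [List.reverse_reverse, List.append_nil, List.nil_append,
    Function.update_eq_self] at h1 h2
  exact (h1.seq h2).congr (by simp; omega) rfl

/-- Every mismatch pushes a flag and none is ever removed, so register `8` stays empty exactly if it
was empty before and the block agrees with `p`. How many flags there are is irrelevant, hence the
existential quantifier. -/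
theorem det_takeBits (p q : List Bool) : ∃ i', (i' = [] ↔ i = [] ∧ padTake p.length q = p) ∧
    i'.length ≤ i.length + p.length ∧
    Det O (takeBits p) ⟨rf a b c d e q g h i j k τ, ψ⟩ (8 * p.length + 1)
      ⟨rf a b c ((padTake p.length q).reverse ++ d) e (q.drop p.length) g h i' j k τ, ψ⟩ := by
  induction p generalizing q d i with
  | nil => exact ⟨i, by simp [padTake], by simp, Det.skip.congr (by simp) (by simp [padTake])⟩
  | cons x p ih =>
    obtain ⟨i', h1, h2, h3⟩ := ih (q := q.tail) (d := q.headD false :: d)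
      (i := if q.headD false = x then i else true :: i)
    refine ⟨i', ?_, ?_, ?_⟩
    · rw [h1]
      by_cases hx : q.headD false = x
      · simp only [hx, if_true, List.length_cons, padTake, List.cons.injEq, true_and]
      · simp only [hx, if_false, List.length_cons, padTake, List.cons.injEq, false_and, and_false,
          reduceCtorEq]
    · refine h2.trans ?_
      split_ifs <;> simp <;> omega
    · have hB : ∀ y, Det O (.seq (pushBit 3 y) (if y = x then .skip else pushBit 8 true))
          ⟨rf a b c d e q.tail g h i j k τ, ψ⟩ 3
          ⟨rf a b c (y :: d) e q.tail g h (if y = x then i else true :: i) j k τ, ψ⟩ := by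
        intro y
        by_cases hy : y = x
        · simp only [hy, if_true]
          exact (det_pushBit.seq Det.skip).congr le_rfl (by simp)
        · simp only [hy, if_false]
          exact (det_pushBit.seq det_pushBit).congr le_rfl (by simp)
      have hp : ∀ y q', q = y :: q' → Det O (.seq (.instr (.pop 5))
          (.seq (pushBit 3 y) (if y = x then .skip else pushBit 8 true)))
          ⟨rf a b c d e q g h i j k τ, ψ⟩ 5
          ⟨rf a b c (y :: d) e q.tail g h (if y = x then i else true :: i) j k τ, ψ⟩ := by
        rintro y q' rfl
        have h1 : Det O (.instr (.pop 5)) ⟨rf a b c d e (y :: q') g h i j k τ, ψ⟩ 1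
            ⟨rf a b c d e q' g h i j k τ, ψ⟩ := Det.pop.congr le_rfl (by simp)
        exact h1.seq (hB y)
      have h4 : Det O (.ite 5 (.seq (.instr (.pop 5)) (.seq (pushBit 3 true)
          (if true = x then .skip else pushBit 8 true))) (.seq (.instr (.pop 5))
          (.seq (pushBit 3 false) (if false = x then .skip else pushBit 8 true)))
          (.seq (pushBit 3 false) (if false = x then .skip else pushBit 8 true)))
          ⟨rf a b c d e q g h i j k τ, ψ⟩ 6
          ⟨rf a b c (q.headD false :: d) e q.tail g h
            (if q.headD false = x then i else true :: i) j k τ, ψ⟩ := by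
        rcases q with _ | ⟨_ | _, q⟩
        · exact (Det.ite_nil rfl (hB false)).mono (by omega)
        · exact Det.ite_false rfl (hp false q rfl)
        · exact Det.ite_true rfl (hp true q rfl)
      refine (h4.seq h3).congr ?_ ?_
      · simp; omega
      · simp [padTake, List.drop_tail]

variable {S : Code} {m : ℕ} {T : Polynomial ℕ} {v : List Bool → List Bool → Bool}

/-- A bound for the running time of `entryCode`. -/
def entryTime (T : Polynomial ℕ) (n : ℕ) : ℕ := T.eval n + 40 * n + 40

/-- The value is negated if register `8` is empty after the comparison. If there is no point to
flip, a flag is raised beforehand, so the comparison cannot succeed, and the block of zeros it is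
compared with only fixes the number of bits to be read. -/
theorem det_entryCode (hS : Computes S m T v) (hτ : ∀ r < m, τ r = []) (x : Entry) (n s : ℕ)
    (hx : ∀ p ∈ x.2, p.length = s) (hk : (x.1.getD k).length + s ≤ n) (q : List Bool) :
    Det O (entryCode S s x) ⟨rf a b c [] e q g h [] j k τ, ψ⟩ (entryTime T n)
      ⟨rf a b c [] e (q.drop s) g h [] (x.val v k (padTake s q) :: j) k τ, ψ⟩ := by
  obtain ⟨ok, fl⟩ := x
  have hm := hS.1
  have hlen : (fl.getD (List.replicate s false)).length = s := by
    cases fl with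
    | none => simp
    | some p => simpa using hx p rfl
  have h1 : Det O (initFlag fl)
      ⟨rf a b c [] e q g h [] j k τ, ψ⟩ 1
      ⟨rf a b c [] e q g h (if fl = none then [true] else []) j k τ, ψ⟩ := by
    cases fl with
    | none => exact det_pushBit.congr le_rfl (by simp)
    | some p => exact Det.skip.congr le_rfl (by simp)
  obtain ⟨i', hi1, hi2, h2⟩ := det_takeBits (O := O) (a := a) (b := b) (c := c) (d := []) (e := e)
    (g := g) (h := h) (i := if fl = none then [true] else []) (j := j) (k := k) (τ := τ)
    (ψ := ψ) (fl.getD (List.replicate s false)) q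
  rw [hlen] at hi1 hi2 h2
  rw [List.append_nil] at h2
  have hi : i' = [] ↔ fl = some (padTake s q) := by
    rw [hi1]
    cases fl with
    | none => simp
    | some p => simp [eq_comm]
  have h3 := det_moveRev12 (O := O) (a := a) (b := b) (c := c) (e := e) (f := q.drop s) (g := g)
    (h := h) (i := i') (j := j) (k := k) (τ := τ) (ψ := ψ) (l := (padTake s q).reverse ++ [])
  simp only [List.append_nil, List.reverse_reverse, hτ 1 (by omega), List.length_reverse,
    length_padTake] at h3
  have h4 : Det O (loadEntryKey ok)
      ⟨rf a b c [] e (q.drop s) g h i' j k (Function.update τ 1 (padTake s q)), ψ⟩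
      (12 * (ok.getD k).length + 3)
      ⟨rf a b c [] e (q.drop s) g h i' j k (Function.update (Function.update τ 0 (ok.getD k))
        1 (padTake s q)), ψ⟩ := by
    cases ok with
    | none =>
      refine det_copyKey.congr le_rfl ?_
      simp [Function.update_of_ne, hτ 0 (by omega), Function.update_comm]
    | some key =>
      refine det_pushList.congr (by simp; omega) ?_
      simp [Function.update_of_ne, hτ 0 (by omega), Function.update_comm]
  have h5 := hS.2 O a b c [] e (q.drop s) g h i' j k τ ψ (ok.getD k) (padTake s q) hτ
  rw [length_padTake] at h5
  have h6 : Det O (.ite 8 .skip .skip (readBit 9 fun x => pushBit 9 (!x)))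
      ⟨rf a b c [] e (q.drop s) g h i' (v (ok.getD k) (padTake s q) :: j) k τ, ψ⟩ 5
      ⟨rf a b c [] e (q.drop s) g h i' (Entry.val v k (ok, fl) (padTake s q) :: j) k τ, ψ⟩ := by
    rcases hi' : i' with _ | ⟨y, i''⟩
    · have hfl := hi.1 hi'
      refine Det.ite_nil rfl (det_readBit (t := 1) (x := v (ok.getD k) (padTake s q)) (l := j)
        rfl ?_)
      exact det_pushBit.congr le_rfl (by simp [Entry.val, hfl])
    · have hfl : ¬ fl = some (padTake s q) := fun h => by simp [hi.2 h] at hi'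
      have h0 : Det O .skip
          ⟨rf a b c [] e (q.drop s) g h (y :: i'') (v (ok.getD k) (padTake s q) :: j) k τ, ψ⟩ 1
          ⟨rf a b c [] e (q.drop s) g h (y :: i'') (Entry.val v k (ok, fl) (padTake s q) :: j)
            k τ, ψ⟩ := Det.skip.congr le_rfl (by simp [Entry.val, hfl])
      cases y
      · exact (Det.ite_false rfl h0).mono (by omega)
      · exact (Det.ite_true rfl h0).mono (by omega)
  have hT : T.eval ((ok.getD k).length + s) ≤ T.eval n := polynomial_eval_mono T hk
  have hi3 : i'.length ≤ s + 1 := by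
    refine hi2.trans ?_
    split_ifs <;> simp <;> omega
  refine (h1.seq (h2.seq (h3.seq (h4.seq (h5.seq (h6.seq det_clear)))))).congr ?_ ?_
  · simp only [rf_8, entryTime]
    simp only at hk
    omega
  · simp

theorem det_rowCode (hS : Computes S m T v) (hτ : ∀ r < m, τ r = []) (row : List Entry) (n s : ℕ)
    (hx : ∀ x ∈ row, (∀ p ∈ x.2, p.length = s) ∧ (x.1.getD k).length + s ≤ n) (q : List Bool) :
    ∃ q', q'.length ≤ q.length ∧
    Det O (rowCode S s row) ⟨rf a b c [] e q g h [] j k τ, ψ⟩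
      (row.length * (entryTime T n + 1) + 1)
      ⟨rf a b c [] e q' g h [] ((rowVal v k s row q).reverse ++ j) k τ, ψ⟩ := by
  induction row generalizing q j with
  | nil => exact ⟨q, le_rfl, Det.skip.congr (by simp) (by simp [rowVal])⟩
  | cons x row ih =>
    obtain ⟨q', hq, h2⟩ := ih (j := x.val v k (padTake s q) :: j)
      (fun x h => hx x (by simp [h])) (q.drop s)
    refine ⟨q', hq.trans (by simp), ?_⟩
    have h1 := det_entryCode (O := O) (a := a) (b := b) (c := c) (e := e) (g := g) (h := h)
      (j := j) (ψ := ψ) hS hτ x n s (hx x (by simp)).1 (hx x (by simp)).2 q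
    refine (h1.seq h2).congr ?_ ?_
    · simp only [List.length_cons]; ring_nf; omega
    · simp [rowVal]

theorem det_queryCode (hS : Computes S m T v) (hτ : ∀ r < m, τ r = []) (row : List Entry)
    (n s B : ℕ) (hx : ∀ x ∈ row, (∀ p ∈ x.2, p.length = s) ∧ (x.1.getD k).length + s ≤ n)
    (r r' : ℕ) (hr : (τ r).length ≤ B) (hr' : (τ r').length ≤ B) :
    Det O (queryCode S s row r r') ⟨rf a b c [] e [] g h [] [] k τ, ψ⟩
      (row.length * (entryTime T n + 6) + 16 * B + 20)
      ⟨rf a b c [] e [] g h [] [] k (Function.update τ r' (rowVal v k s row (τ r))), ψ⟩ := by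
  have h1 := det_copyQuery (O := O) (a := a) (b := b) (c := c) (e := e) (f := []) (g := g) (h := h)
    (i := []) (j := []) (k := k) (τ := τ) (ψ := ψ) r
  rw [List.append_nil] at h1
  obtain ⟨q', hq, h2⟩ := det_rowCode (O := O) (a := a) (b := b) (c := c) (e := e) (g := g) (h := h)
    (j := []) (ψ := ψ) hS hτ row n s hx (τ r)
  have h5 := det_drain (O := O) (r := 9) (tB := 1) (B := fun x => pushBit (r' + 11) x)
    (S := fun l s => ⟨rf a b c [] e [] g h [] l k (Function.update τ r' s), ψ⟩)
    (g := fun s x => x :: s) (by simp) (by simp)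
    (fun x l s => det_pushBit.congr le_rfl (by simp))
    ((rowVal v k s row (τ r)).reverse ++ []) []
  rw [foldl_cons_eq] at h5
  have h4 : Det O (clear (r' + 11)) ⟨rf a b c [] e [] g h [] ((rowVal v k s row (τ r)).reverse ++ [])
      k τ, ψ⟩ ((τ r').length * 2 + 1)
      ⟨rf a b c [] e [] g h [] ((rowVal v k s row (τ r)).reverse ++ []) k
        (Function.update τ r' []), ψ⟩ := det_clear.congr (by simp) (by simp)
  have h3 : Det O (clear 5) ⟨rf a b c [] e q' g h [] ((rowVal v k s row (τ r)).reverse ++ [])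
      k τ, ψ⟩ (q'.length * 2 + 1)
      ⟨rf a b c [] e [] g h [] ((rowVal v k s row (τ r)).reverse ++ []) k τ, ψ⟩ :=
    det_clear.congr (by simp) (by simp)
  refine (h1.seq (h2.seq (h3.seq (h4.seq h5)))).congr ?_ (by simp)
  simp only [List.append_nil, List.length_reverse, length_rowVal]
  have : row.length * (entryTime T n + 6) = row.length * (entryTime T n + 1) + row.length * 5 := by
    ring
  omega

end parts

end WMark
end

noncomputable section

namespace WMark

/-- The continuation is indexed by the simulated branch `x` and not by the state `f x` that
represents it. No inverse of `f` is needed, since a continuation as a function of the state can be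
read off from `outs`. -/
theorem Runs.seqMap {O : Oracle} {α : Type} {a b : Code} {σ : State} {t t' : ℕ} {L : List α}
    {f : α → State} {N : α → List State} (h : Runs O [a] σ t (L.map f))
    (h' : ∀ x ∈ L, Runs O [b] (f x) t' (N x)) :
    Runs O [.seq a b] σ (t + t' + 1) (L.flatMap N) := by
  have h1 : ∀ x ∈ L, (outs O t' ([b], f x)).map Prod.snd = N x := fun x hx => by
    have := h' x hx
    unfold Runs at this
    simp [this, Function.comp_def]
  have h2 := Runs.seq (b := b) (t' := t') h
    (M := fun τ => (outs O t' ([b], τ)).map Prod.snd) (by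
      intro τ hτ
      obtain ⟨x, hx, rfl⟩ := List.mem_map.1 hτ
      rw [h1 x hx]
      exact h' x hx)
  rw [List.flatMap_map] at h2
  have h3 : (L.flatMap fun x => (outs O t' ([b], f x)).map Prod.snd) = L.flatMap N := by
    rw [List.flatMap_def, List.flatMap_def, List.map_congr_left h1]
  rwa [h3] at h2

/-! ### Simulation of a program with oracle -/

/-- The registers `m, m + 1, …` have the given contents, the registers below are empty. -/
def tailReg (m : ℕ) (ρ : ℕ → List Bool) : ℕ → List Bool := fun r =>
  if r < m then [] else ρ (r - m)

theorem tailReg_of_lt {m r : ℕ} (ρ : ℕ → List Bool) (h : r < m) : tailReg m ρ r = [] := by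
  simp [tailReg, h]

theorem tailReg_add (m r : ℕ) (ρ : ℕ → List Bool) : tailReg m ρ (r + m) = ρ r := by
  simp [tailReg]

theorem update_tailReg (m r : ℕ) (ρ : ℕ → List Bool) (l : List Bool) :
    Function.update (tailReg m ρ) (r + m) l = tailReg m (Function.update ρ r l) := by
  funext r'
  by_cases h : r' = r + m
  · subst h; simp [tailReg]
  · rw [Function.update_of_ne h]
    unfold tailReg
    split_ifs with h'
    · rfl
    · rw [Function.update_of_ne (by omega)]

/-- A state of the simulated program and the key in register `10`. -/
def simState (m : ℕ) (k : List Bool) (σ : State) : State :=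
  ⟨rf [] [] [] [] [] [] [] [] [] [] k (tailReg m σ.reg), σ.ket⟩

theorem simState_reg (m : ℕ) (k : List Bool) (σ : State) (r : ℕ) :
    (simState m k σ).reg (r + (m + 11)) = σ.reg r := by
  rw [← add_assoc]
  exact tailReg_add m r σ.reg

theorem simState_update (m : ℕ) (k : List Bool) (σ : State) (r : ℕ) (l : List Bool) (φ : Ket) :
    (⟨Function.update (simState m k σ).reg (r + (m + 11)) l, φ⟩ : State) =
      simState m k ⟨Function.update σ.reg r l, φ⟩ := by
  rw [← add_assoc]
  have := rf_set_add (a := []) (b := []) (c := []) (d := []) (e := []) (f := []) (g := [])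
    (h := []) (i := []) (j := []) (k := k) (τ := tailReg m σ.reg) (ψ := φ) (l := l) (r + m)
  rw [update_tailReg] at this
  exact this

/-- The program in which oracle calls are replaced by programs that evaluate the given keys. -/
def simCode (S : Code) (s m : ℕ) (rows : List (List Entry)) : Code → Code
  | .skip => .skip
  | .instr (.call i r r') => queryCode S s (rows.getD i []) (r + m) (r' + m)
  | .instr i => .instr (i.shift (m + 11))
  | .seq a b => .seq (simCode S s m rows a) (simCode S s m rows b)
  | .ite r a b c => .ite (r + (m + 11)) (simCode S s m rows a) (simCode S s m rows b)
      (simCode S s m rows c)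
  | .loop r a => .loop r a

/-- The oracle that evaluates the keys in a table. -/
def tableOracle (v : List Bool → List Bool → Bool) (k : List Bool) (s : ℕ)
    (rows : List (List Entry)) : Oracle := fun i q => rowVal v k s (rows.getD i []) q

/-- A bound for the length of keys and points in a table, and for the number of its columns. -/
def TableBound (k : List Bool) (s n u : ℕ) (rows : List (List Entry)) : Prop :=
  ∀ row ∈ rows, row.length ≤ u ∧
    ∀ x ∈ row, (∀ p ∈ x.2, p.length = s) ∧ (x.1.getD k).length + s ≤ n

variable {O' : Oracle}

def simTime (T : Polynomial ℕ) (n u B : ℕ) : ℕ := u * (entryTime T n + 6) + 16 * B + 20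

section

variable {S : Code} {m : ℕ} {T : Polynomial ℕ} {v : List Bool → List Bool → Bool}

theorem TableBound.getD {k : List Bool} {s n u : ℕ} {rows : List (List Entry)}
    (h : TableBound k s n u rows) (i : ℕ) : (rows.getD i []).length ≤ u ∧
      ∀ x ∈ rows.getD i [], (∀ p ∈ x.2, p.length = s) ∧ (x.1.getD k).length + s ≤ n := by
  by_cases hi : i < rows.length
  · rw [List.getD_eq_getElem _ _ hi]
    exact h _ (List.getElem_mem hi)
  · rw [List.getD_eq_default _ _ (by omega)]
    simp

/-- The cost of a simulated query depends on the length of its registers, so the induction carries a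
bound `B` for all simulated registers, which grows by at most one per instruction. The requirement
`u ≤ B` makes the answer of a query fit into this bound. The cap `B'` is global, so that every
instruction is charged the same time. -/
theorem runs_simCode (hS : Computes S m T v) {k : List Bool} {s n u B' : ℕ}
    {rows : List (List Entry)} (hrows : TableBound k s n u rows) (a : Code) (ha : a.LoopFree) :
    ∀ (B : ℕ) (σ : State), (∀ r, (σ.reg r).length ≤ B) → u ≤ B → B + a.size ≤ B' →
    Runs O' [simCode S s m rows a] (simState m k σ) (a.size * (simTime T n u B' + 2))
      ((a.den (tableOracle v k s rows) σ).map (simState m k)) ∧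
    ∀ σ' ∈ a.den (tableOracle v k s rows) σ, ∀ r, (σ'.reg r).length ≤ B + a.size := by
  induction a with
  | skip =>
    intro B σ hσ hu hB
    refine ⟨Det.skip.mono (by simp [Code.size]), ?_⟩
    intro σ' h' r
    simp only [Code.den, List.mem_singleton] at h'
    subst h'
    exact (hσ r).trans (by omega)
  | instr i =>
    intro B σ hσ hu hB
    have hrun : ∀ i : Instr, (i.shift (m + 11)).apply O' (simState m k σ) =
        (i.apply (tableOracle v k s rows) σ).map (simState m k) →
        Runs O' [.instr (i.shift (m + 11))] (simState m k σ)
        ((Code.instr i).size * (simTime T n u B' + 2))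
        (((Code.instr i).den (tableOracle v k s rows) σ).map (simState m k)) := fun i hi => by
      have := Runs.instr O' (i.shift (m + 11)) (simState m k σ)
      rw [hi] at this
      exact this.mono (by simp [Code.size])
    have hupd : ∀ (r r' : ℕ) (l : List Bool) (d : ℕ), l.length ≤ B + d →
        (Function.update σ.reg r l r').length ≤ B + d := by
      intro r r' l d h
      by_cases hr : r' = r
      · subst hr; simpa using h
      · rw [Function.update_of_ne hr]; exact (hσ r').trans (by omega)
    cases i with
    | push r x =>
      refine ⟨hrun _ ?_, ?_⟩
      · simp only [Instr.shift, Instr.apply, State.set, simState_reg, simState_update,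
          List.map_cons, List.map_nil]
        rfl
      · simp only [Code.den, Instr.apply, List.mem_singleton, forall_eq, State.set, Code.size]
        exact fun r' => hupd _ _ _ _ (by have := hσ r; simp; omega)
    | pop r =>
      refine ⟨hrun _ ?_, ?_⟩
      · simp only [Instr.shift, Instr.apply, State.set, simState_reg, simState_update,
          List.map_cons, List.map_nil]
        rfl
      · simp only [Code.den, Instr.apply, List.mem_singleton, forall_eq, State.set, Code.size]
        exact fun r' => hupd _ _ _ _ (by have := hσ r; simp; omega)
    | coin r =>
      refine ⟨hrun _ ?_, ?_⟩
      · simp only [Instr.shift, Instr.apply, simState_reg, simState_update,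
          List.map_cons, List.map_nil]
        rfl
      · simp only [Code.den, Instr.apply, List.map_cons, List.map_nil, List.mem_cons,
          List.not_mem_nil, or_false, Code.size]
        rintro σ' (rfl | rfl) r' <;> exact hupd _ _ _ _ (by have := hσ r; simp; omega)
    | gate g =>
      refine ⟨hrun _ ?_, ?_⟩
      · simp only [Instr.shift, Instr.apply, List.map_cons, List.map_nil]
        have hg : ((g.map (· + (m + 11))).map fun r => ((simState m k σ).reg r).length) =
            g.map fun r => (σ.reg r).length := by
          cases g <;> simp only [Gate.map, simState_reg]
        rw [hg]
        rfl
      · simp only [Code.den, Instr.apply, List.mem_singleton, forall_eq]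
        exact fun r' => (hσ r').trans (by omega)
    | measure r r₁ =>
      refine ⟨hrun _ ?_, ?_⟩
      · simp only [Instr.shift, Instr.apply, simState_reg, simState_update,
          List.map_cons, List.map_nil]
        rfl
      · simp only [Code.den, Instr.apply, List.map_cons, List.map_nil, List.mem_cons,
          List.not_mem_nil, or_false, Code.size]
        rintro σ' (rfl | rfl) r' <;> exact hupd _ _ _ _ (by have := hσ r₁; simp; omega)
    | call i r r₁ =>
      have hg := hrows.getD i
      constructor
      · have h1 := det_queryCode (O := O') (a := []) (b := []) (c := []) (e := []) (g := [])
          (h := []) (k := k) (τ := tailReg m σ.reg) (ψ := σ.ket) hS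
          (fun r hr => tailReg_of_lt _ hr) (rows.getD i []) n s B hg.2 (r + m) (r₁ + m)
          (by rw [tailReg_add]; exact hσ r) (by rw [tailReg_add]; exact hσ r₁)
        rw [tailReg_add, update_tailReg] at h1
        refine h1.mono ?_
        simp only [Code.size, one_mul, simTime]
        have : (rows.getD i []).length * (entryTime T n + 6) ≤ u * (entryTime T n + 6) := by
          gcongr; exact hg.1
        omega
      · simp only [Code.den, Instr.apply, List.mem_singleton, forall_eq, State.set, Code.size]
        refine fun r' => hupd _ _ _ _ ?_
        rw [tableOracle, length_rowVal]
        omega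
  | seq a b iha ihb =>
    intro B σ hσ hu hB
    simp only [Code.size] at hB
    obtain ⟨h1, h2⟩ := iha ha.1 B σ hσ hu (by omega)
    have hb := fun σ' (h' : σ' ∈ a.den (tableOracle v k s rows) σ) =>
      ihb ha.2 (B + a.size) σ' (h2 σ' h') (by omega) (by omega)
    constructor
    · have h3 := Runs.seqMap (b := simCode S s m rows b) h1 fun σ' h' => (hb σ' h').1
      rw [Code.den, List.map_flatMap]
      exact h3.mono (by simp only [Code.size]; ring_nf; omega)
    · intro σ' h' r
      obtain ⟨σ₁, h3, h4⟩ := List.mem_flatMap.1 h'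
      exact ((hb σ₁ h3).2 σ' h4 r).trans (by simp only [Code.size]; omega)
  | ite r a b c iha ihb ihc =>
    intro B σ hσ hu hB
    simp only [Code.size] at hB
    have hr' := simState_reg m k σ r
    have ht : ∀ x, x = a.size ∨ x = b.size ∨ x = c.size → x * (simTime T n u B' + 2) + 1 ≤
        (Code.ite r a b c).size * (simTime T n u B' + 2) := by
      intro x hx
      have : (x + 1) * (simTime T n u B' + 2) ≤
        (Code.ite r a b c).size * (simTime T n u B' + 2) := by
        gcongr; simp only [Code.size]; omega
      refine le_trans ?_ this
      ring_nf; omega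
    simp only [Code.den]
    rcases hr : σ.reg r with _ | ⟨_ | _, l⟩
    · rw [hr] at hr'
      obtain ⟨h1, h2⟩ := ihc ha.2.2 B σ hσ hu (by omega)
      refine ⟨(Runs.of_step (by simp [step, hr', simCode]) h1).mono (ht _ (by simp)), ?_⟩
      exact fun σ' h' r => (h2 σ' h' r).trans (by simp only [Code.size]; omega)
    · rw [hr] at hr'
      obtain ⟨h1, h2⟩ := ihb ha.2.1 B σ hσ hu (by omega)
      refine ⟨(Runs.of_step (by simp [step, hr', simCode]) h1).mono (ht _ (by simp)), ?_⟩
      exact fun σ' h' r => (h2 σ' h' r).trans (by simp only [Code.size]; omega)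
    · rw [hr] at hr'
      obtain ⟨h1, h2⟩ := iha ha.1 B σ hσ hu (by omega)
      refine ⟨(Runs.of_step (by simp [step, hr', simCode]) h1).mono (ht _ (by simp)), ?_⟩
      exact fun σ' h' r => (h2 σ' h' r).trans (by simp only [Code.size]; omega)
  | loop r a _ => exact ha.elim

end

/-! ### Composing strings -/

/-- Puts the encoding of the string in register `10` in front of register `r`. -/
def emitKey (r : ℕ) : Code :=
  .seq (drain 10 (pushBit 3)) (.seq (pushBit r false)
    (drain 3 fun x => .seq (pushBit 10 x) (.seq (pushBit r x) (pushBit r true))))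

/-- A part of a string: a fixed string, or the encoding of the string in register `10`. -/
abbrev Piece := Option (List Bool)

def emit (r : ℕ) : List Piece → Code
  | [] => .skip
  | some l :: ps => .seq (emit r ps) (pushList r l)
  | none :: ps => .seq (emit r ps) (emitKey r)

def piecesVal (k : List Bool) (ps : List Piece) : List Bool :=
  ps.flatMap fun p => p.getD (encStr k)

def pieceList {α : Type} (f : α → List Piece) (l : List α) : List Piece :=
  (l.flatMap fun a => some [true] :: f a) ++ [some [false]]

theorem piecesVal_pieceList {α : Type} (k : List Bool) (f : α → List Piece) (l : List α) :
    piecesVal k (pieceList f l) = encList (fun a => piecesVal k (f a)) l := by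
  simp [piecesVal, pieceList, encList, List.flatMap_assoc]

theorem encStr_cons (x : Bool) (l : List Bool) : encStr (x :: l) = true :: x :: encStr l := rfl

variable {O : Oracle}

section parts

variable {a b c d e f g h i j k l l' : List Bool} {τ : ℕ → List Bool} {ψ : Ket}

theorem det_emitKey0 : Det O (emitKey 0) ⟨rf a b c [] e f g h i j k τ, ψ⟩ (20 * k.length + 20)
    ⟨rf (encStr k ++ a) b c [] e f g h i j k τ, ψ⟩ := by
  have h1 := det_drain (O := O) (r := 10) (tB := 1) (B := pushBit 3)
    (S := fun l s => ⟨rf a b c s e f g h i j l τ, ψ⟩)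
    (g := fun s x => x :: s) (by simp) (by simp)
    (fun x l s => det_pushBit.congr le_rfl (by simp)) k []
  have h2 := det_drain (O := O) (r := 3) (tB := 5)
    (B := fun x => .seq (pushBit 10 x) (.seq (pushBit 0 x) (pushBit 0 true)))
    (S := fun l s => ⟨rf (encStr s ++ a) b c l e f g h i j s τ, ψ⟩)
    (g := fun s x => x :: s) (by simp) (by simp)
    (fun x l s => (det_pushBit.seq (det_pushBit.seq det_pushBit)).congr le_rfl
      (by simp [encStr_cons])) k.reverse []
  rw [foldl_cons_eq] at h1 h2
  simp only [List.reverse_reverse, List.append_nil] at h1 h2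
  have h3 : Det O (pushBit 0 false) ⟨rf a b c k.reverse e f g h i j [] τ, ψ⟩ 1
    ⟨rf (encStr [] ++ a) b c k.reverse e f g h i j [] τ, ψ⟩ :=
    det_pushBit.congr le_rfl (by simp [encStr, encList])
  exact (h1.seq (h3.seq h2)).congr (by simp; omega) rfl

theorem det_emitKey_add (n : ℕ) : Det O (emitKey (n + 11)) ⟨rf a b c [] e f g h i j k τ, ψ⟩
    (20 * k.length + 20)
    ⟨rf a b c [] e f g h i j k (Function.update τ n (encStr k ++ τ n)), ψ⟩ := by
  have h1 := det_drain (O := O) (r := 10) (tB := 1) (B := pushBit 3)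
    (S := fun l s => ⟨rf a b c s e f g h i j l τ, ψ⟩)
    (g := fun s x => x :: s) (by simp) (by simp)
    (fun x l s => det_pushBit.congr le_rfl (by simp)) k []
  have h2 := det_drain (O := O) (r := 3) (tB := 5)
    (B := fun x => .seq (pushBit 10 x) (.seq (pushBit (n + 11) x) (pushBit (n + 11) true)))
    (S := fun l s => ⟨rf a b c l e f g h i j s (Function.update τ n (encStr s ++ τ n)), ψ⟩)
    (g := fun s x => x :: s) (by simp) (by simp)
    (fun x l s => (det_pushBit.seq (det_pushBit.seq det_pushBit)).congr le_rfl
      (by simp [encStr_cons])) k.reverse []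
  rw [foldl_cons_eq] at h1 h2
  simp only [List.reverse_reverse, List.append_nil] at h1 h2
  have h3 : Det O (pushBit (n + 11) false) ⟨rf a b c k.reverse e f g h i j [] τ, ψ⟩ 1
    ⟨rf a b c k.reverse e f g h i j [] (Function.update τ n (encStr [] ++ τ n)), ψ⟩ :=
    det_pushBit.congr le_rfl (by simp [encStr, encList])
  exact (h1.seq (h3.seq h2)).congr (by simp; omega) rfl

/-- A bound for the running time of `emit`. -/
def emitTime (k : List Bool) (ps : List Piece) : ℕ :=
  20 * (piecesVal k ps).length + 24 * ps.length + 1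

theorem length_encStr (s : List Bool) : (encStr s).length = 2 * s.length + 1 := by
  induction s with
  | nil => rfl
  | cons x s ih => rw [encStr_cons]; simp [ih]; omega

theorem det_emit0 (ps : List Piece) : Det O (emit 0 ps) ⟨rf a b c [] e f g h i j k τ, ψ⟩
    (emitTime k ps) ⟨rf (piecesVal k ps ++ a) b c [] e f g h i j k τ, ψ⟩ := by
  induction ps with
  | nil => exact Det.skip.congr (by simp [emitTime]) (by simp [piecesVal])
  | cons p ps ih =>
    cases p with
    | none =>
      refine (ih.seq det_emitKey0).congr ?_ (by simp [piecesVal])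
      simp only [emitTime, piecesVal, List.flatMap_cons, Option.getD_none, List.length_append,
        length_encStr, List.length_cons]
      omega
    | some l =>
      refine (ih.seq det_pushList).congr ?_ (by simp [piecesVal])
      simp only [emitTime, piecesVal, List.flatMap_cons, Option.getD_some, List.length_append,
        List.length_cons]
      omega

theorem det_emit_add (n : ℕ) (ps : List Piece) : Det O (emit (n + 11) ps)
    ⟨rf a b c [] e f g h i j k τ, ψ⟩ (emitTime k ps)
    ⟨rf a b c [] e f g h i j k (Function.update τ n (piecesVal k ps ++ τ n)), ψ⟩ := by
  induction ps with
  | nil => exact Det.skip.congr (by simp [emitTime]) (by simp [piecesVal])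
  | cons p ps ih =>
    cases p with
    | none =>
      refine (ih.seq (det_emitKey_add n)).congr ?_ (by simp [piecesVal])
      simp only [emitTime, piecesVal, List.flatMap_cons, Option.getD_none, List.length_append,
        length_encStr, List.length_cons]
      omega
    | some l =>
      refine (ih.seq det_pushList).congr ?_ (by simp [piecesVal])
      simp only [emitTime, piecesVal, List.flatMap_cons, Option.getD_some, List.length_append,
        List.length_cons]
      omega

end parts

end WMark
end

noncomputable section

namespace WMark

/-! ### The reduction -/

/-- The strings that are hard-wired into the reduction, where `none` stands for the key that it is
given: the keys of the evaluation oracles, the marked keys, and the challenges together with the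
keys against which the answers are checked. -/
structure Wiring where
  rows : List (List Entry)
  marks : List (List (Option (List Bool)))
  checks : List (List (List Bool × Option (List Bool)))

def keyPiece (x : Option (List Bool)) : List Piece := [x.map encStr]

/-- An item for the extractor with equivocating bit `0` and an empty second key. Its correction bit
is the expected answer itself, so the extractor outputs `0` for it exactly if the prediction is
correct. -/
def checkPieces (x : List Bool × Option (List Bool)) : List Piece :=
  [some (false :: encStr x.1), x.2.map encStr, some (encStr [])]

def Wiring.markPieces (D : Wiring) : List Piece := pieceList (pieceList keyPiece) D.marks

def Wiring.itemPieces (D : Wiring) : List Piece := pieceList (pieceList checkPieces) D.checks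

def Wiring.markStr (D : Wiring) (k : List Bool) : List Bool :=
  encList (fun row => encList encStr (row.map fun x => x.getD k)) D.marks

def Wiring.items (D : Wiring) (k : List Bool) : List (List Item) :=
  D.checks.map fun row => row.map fun x => (false, x.1, x.2.getD k, [])

theorem piecesVal_keyPiece (k : List Bool) (x : Option (List Bool)) :
    piecesVal k (keyPiece x) = encStr (x.getD k) := by
  cases x <;> simp [piecesVal, keyPiece]

theorem encList_map {α β : Type} (f : β → List Bool) (g : α → β) (l : List α) :
    encList f (l.map g) = encList (fun a => f (g a)) l := by
  simp [encList, List.flatMap_map]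

theorem Wiring.piecesVal_markPieces (D : Wiring) (k : List Bool) :
    piecesVal k D.markPieces = D.markStr k := by
  simp only [markPieces, markStr, piecesVal_pieceList, piecesVal_keyPiece, encList_map]

theorem Wiring.piecesVal_itemPieces (D : Wiring) (k : List Bool) :
    piecesVal k D.itemPieces = encList (encList encItem) (D.items k) := by
  simp only [itemPieces, items, piecesVal_pieceList, encList_map]
  congr 2; funext row
  congr 1; funext x
  rcases x with ⟨x, _ | y⟩ <;> simp [piecesVal, checkPieces, encItem]

def setup : Code := .seq (clear 1) (.seq (clear 2) (.seq (moveRev 0 3) (moveRev 3 10)))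

/-- Puts a `1` into register `0` if all bits there are `0`. -/
def checkZero : Code :=
  .seq (drain 0 fun x => if x then pushBit 3 true else .skip)
    (.ite 3 .skip .skip (pushBit 0 true))

/-- The program of the reduction, with loops. -/
def guessCode (S : Code) (s m : ℕ) (D : Wiring) (pre post : Code) (C : Circuit) : Code :=
  .seq setup (.seq (simCode S s m D.rows pre) (.seq (clear (m + 11))
    (.seq (emit (m + 11) D.markPieces) (.seq (simCode S s m D.rows post)
      (.seq (emit 0 D.itemPieces) (.seq (pushList 1 (encCircuit C))
        (.seq (extractor S) checkZero)))))))

variable {O : Oracle}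

/-! ### Correctness and running time of the reduction -/

section parts

variable {a b c d e f g h i j k l l' : List Bool} {τ : ℕ → List Bool} {ψ : Ket}

theorem det_setup : Det O setup ⟨rf k b c [] e f g h i j [] τ, ψ⟩
    (2 * b.length + 2 * c.length + 10 * k.length + 10) ⟨rf [] [] [] [] e f g h i j k τ, ψ⟩ := by
  have h1 : Det O (clear 1) ⟨rf k b c [] e f g h i j [] τ, ψ⟩ (b.length * 2 + 1)
    ⟨rf k [] c [] e f g h i j [] τ, ψ⟩ := det_clear.congr (by simp) (by simp)
  have h2 : Det O (clear 2) ⟨rf k [] c [] e f g h i j [] τ, ψ⟩ (c.length * 2 + 1)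
    ⟨rf k [] [] [] e f g h i j [] τ, ψ⟩ := det_clear.congr (by simp) (by simp)
  have h3 := det_drain (O := O) (r := 0) (tB := 1) (B := fun x => pushBit 3 x)
    (S := fun l s => ⟨rf l [] [] s e f g h i j [] τ, ψ⟩)
    (g := fun s x => x :: s) (by simp) (by simp)
    (fun x l s => det_pushBit.congr le_rfl (by simp)) k []
  have h4 := det_drain (O := O) (r := 3) (tB := 1) (B := fun x => pushBit 10 x)
    (S := fun l s => ⟨rf [] [] [] l e f g h i j s τ, ψ⟩)
    (g := fun s x => x :: s) (by simp) (by simp)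
    (fun x l s => det_pushBit.congr le_rfl (by simp)) k.reverse []
  rw [foldl_cons_eq] at h3 h4
  simp only [List.reverse_reverse, List.append_nil] at h3 h4
  exact (h1.seq (h2.seq (h3.seq h4))).congr (by simp; omega) rfl

theorem det_checkZero : ∃ d, Det O checkZero ⟨rf a b c [] e f g h i j k τ, ψ⟩ (5 * a.length + 4)
    ⟨rf (if a.all (fun x => !x) then [true] else []) b c d e f g h i j k τ, ψ⟩ := by
  have hd : a.foldl (fun s x => if x then true :: s else s) [] = [] ↔
      a.all (fun x => !x) = true := by
    suffices h : ∀ s : List Bool, a.foldl (fun s x => if x then true :: s else s) s = [] ↔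
        s = [] ∧ a.all (fun x => !x) = true by simpa using h []
    induction a with
    | nil => simp
    | cons x a ih =>
      intro s
      rw [List.foldl_cons, ih]
      cases x <;> simp
  have h1 := det_drain (O := O) (r := 0) (tB := 1)
    (B := fun x => if x then pushBit 3 true else .skip)
    (S := fun l s => ⟨rf l b c s e f g h i j k τ, ψ⟩)
    (g := fun s x => if x then true :: s else s) (by simp) (by simp)
    (fun x l s => by
      cases x
      · exact Det.skip.congr le_rfl (by simp)
      · exact det_pushBit.congr le_rfl (by simp)) a []
  refine ⟨a.foldl (fun s x => if x then true :: s else s) [], ?_⟩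
  generalize hD : a.foldl (fun s x => if x then true :: s else s) [] = D at h1 hd ⊢
  have h2 : Det O (.ite 3 .skip .skip (pushBit 0 true)) ⟨rf [] b c D e f g h i j k τ, ψ⟩ 2
      ⟨rf (if a.all (fun x => !x) then [true] else []) b c D e f g h i j k τ, ψ⟩ := by
    rcases D with _ | ⟨_ | _, D⟩
    · rw [if_pos (hd.1 rfl)]
      exact Det.ite_nil rfl (det_pushBit.congr le_rfl (by simp))
    · rw [if_neg (fun h => by simpa using hd.2 h)]
      exact Det.ite_false rfl Det.skip
    · rw [if_neg (fun h => by simpa using hd.2 h)]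
      exact Det.ite_true rfl Det.skip
  exact (h1.seq h2).congr (by omega) rfl

end parts

/-- A bound for the running time of the extractor. -/
def extractorTime (T : Polynomial ℕ) (n : ℕ) : ℕ :=
  (n * (n * (20 * n + T.eval n + 104) + 12) + 8) + n * (20 * n + 44) + 22 * n + 50 + 2 * n ^ 3

/-- A bound for the running time of the reduction. -/
def guessTime (T : Polynomial ℕ) (X : ℕ) : ℕ :=
  2 * (X * (simTime T X X (4 * X) + 2)) + extractorTime T (2 * X) + 50 * X + 50

theorem weight_flatMap {α : Type} (L : List α) (M : α → List State) (E : State → Prop) :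
    weight (L.flatMap M) E = (L.map fun x => weight (M x) E).sum := by
  induction L with
  | nil => simp [weight]
  | cons x L ih => rw [List.flatMap_cons, weight_append, ih]; simp

theorem length_items_flatten_le (items : List (List Item)) :
    items.flatten.length ≤ (encList (encList encItem) items).length := by
  induction items with
  | nil => simp
  | cons row items ih =>
    have := length_le_length_encList encItem row
    simp only [encList, List.flatMap_cons, List.length_append, List.length_cons,
      List.flatten_cons] at ih this ⊢
    omega

open Classical in
/-- The probability that the measurement of the first qubits yields the bits in a list. -/
def listProb (φ : Ket) (bits : List Bool) : ℝ :=
  ∑' B, if ∀ q < bits.length, decide (q ∈ B) = bits.getD q false then ‖φ B‖ ^ 2 else 0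

/-- The probability that the prediction is correct on all challenges. -/
def Wiring.value (v : List Bool → List Bool → Bool) (s : ℕ) (D : Wiring) (pre post : Code)
    (C : Circuit) (k : List Bool) (ψ : Ket) : ℝ :=
  ((pre.den (tableOracle v k s D.rows) ⟨fun _ => [], ψ⟩).map fun σ =>
    ((post.den (tableOracle v k s D.rows) (σ.set 0 (D.markStr k))).map fun σ' =>
      listProb (C.apply (flipKet ((D.items k).flatten.flatMap fun p => p.2.1) σ'.ket))
        ((D.items k).flatten.map (Item.bit v))).sum).sum

/-- The extractor adds the expected answers to the measured ones, so an output of zeros only is the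
event that all predictions are right, and `checkZero` turns this into the guess `1`. The final
states are left unspecified because junk remains in work registers; only the weight of this event
matters. -/
theorem Runs.exists_guessCode {S : Code} {m : ℕ} {T : Polynomial ℕ}
    {v : List Bool → List Bool → Bool} (hS : Computes S m T v) {s X : ℕ} {D : Wiring}
    {pre post : Code} {C : Circuit} {k : List Bool} {ψ : Ket} {s₁ : List Bool} {β : Bool}
    (hD : TableBound k s X X D.rows) (hpre : pre.LoopFree) (hpost : post.LoopFree)
    (h1 : s₁.length ≤ X) (h2 : k.length ≤ X) (h3 : pre.size ≤ X) (h4 : post.size ≤ X)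
    (h5 : emitTime k D.markPieces ≤ X) (h6 : emitTime k D.itemPieces ≤ X)
    (h7 : (encCircuit C).length ≤ X) :
    ∃ L, Runs O [guessCode S s m D pre post C]
      ⟨rf k s₁ [β] [] [] [] [] [] [] [] [] fun _ => [], ψ⟩ (guessTime T X) L ∧
      weight L (fun σ => (σ.reg 0).headD false = true) = D.value v s pre post C k ψ := by
  have hmark : (D.markStr k).length ≤ X := by
    rw [← D.piecesVal_markPieces]
    refine le_trans ?_ h5
    unfold emitTime; omega
  have hitem : (encList (encList encItem) (D.items k)).length ≤ X := by
    rw [← D.piecesVal_itemPieces]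
    refine le_trans ?_ h6
    unfold emitTime; omega
  set out : State → List State := fun σ' =>
    measured (fun a => rf a [] [] [] [] [] [] [] [] [] k (tailReg m σ'.reg))
        ((D.items k).flatten.map (Item.bit v)).reverse []
        (C.apply (flipKet ((D.items k).flatten.flatMap fun p => p.2.1) σ'.ket)) with hout
  have hlast : ∀ σ', ∃ L, Runs O [.seq (emit 0 D.itemPieces) (.seq (pushList 1 (encCircuit C))
        (.seq (extractor S) checkZero))] (simState m k σ')
        (extractorTime T (2 * X) + 10 * X + 20) L ∧
      weight L (fun σ => (σ.reg 0).headD false = true) =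
        listProb (C.apply (flipKet ((D.items k).flatten.flatMap fun p => p.2.1) σ'.ket))
        ((D.items k).flatten.map (Item.bit v)) := by
    intro σ'
    have e1 := det_emit0 (O := O) (a := []) (b := []) (c := []) (e := []) (f := []) (g := [])
      (h := []) (i := []) (j := []) (k := k) (τ := tailReg m σ'.reg) (ψ := σ'.ket) D.itemPieces
    have e2 : Det O (pushList 1 (encCircuit C))
        ⟨rf (piecesVal k D.itemPieces ++ []) [] [] [] [] [] [] [] [] [] k
          (tailReg m σ'.reg), σ'.ket⟩ (2 * (encCircuit C).length + 1)
        ⟨rf (piecesVal k D.itemPieces) (encCircuit C) [] [] [] [] [] [] [] [] k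
          (tailReg m σ'.reg), σ'.ket⟩ := det_pushList.congr le_rfl (by simp)
    rw [D.piecesVal_itemPieces] at e1 e2
    have e3 := runs_extractor (O := O) (k := k) (ψ := σ'.ket) hS
      (fun r hr => tailReg_of_lt σ'.reg hr) (D.items k) C (2 * X) (by omega)
    change Runs _ _ _ (extractorTime T (2 * X)) (out σ') at e3
    -- `checkZero` has one branch and does not change the vector. Hence it translates the event
    -- without changing the weights.
    have e4 : ∀ σ ∈ out σ', ∃ σ₁, Det O checkZero σ (5 * X + 4) σ₁ ∧
        σ₁.ket = σ.ket ∧ ((σ₁.reg 0).headD false = true ↔ σ.reg 0 =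
          List.replicate ((D.items k).flatten.map (Item.bit v)).length false ++ []) := by
      intro σ hσ
      obtain ⟨y, φ, hy, rfl⟩ := mem_measured hσ
      obtain ⟨d, hd⟩ := det_checkZero (O := O) (a := y ++ []) (b := []) (c := []) (e := [])
        (f := []) (g := []) (h := []) (i := []) (j := []) (k := k) (τ := tailReg m σ'.reg)
        (ψ := φ)
      refine ⟨_, hd.mono ?_, rfl, ?_⟩
      · have := length_items_flatten_le (D.items k)
        simp only [List.length_reverse, List.length_map] at hy
        simp only [List.append_nil]
        omega
      · simp only [rf_0, List.append_nil]
        rw [← List.length_reverse, ← hy, List.eq_replicate_iff]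
        split_ifs with hif
        · simpa using hif
        · simpa using hif
    choose! fin hfin1 hket hfin2 using e4
    refine ⟨_, (e1.seqRuns (e2.seqRuns (Runs.seq e3
      (M := fun σ => [fin σ]) (t' := 5 * X + 4) fun σ hσ => hfin1 σ hσ))).mono ?_, ?_⟩
    · omega
    · rw [weight_flatMap]
      have e5 : ∀ σ ∈ out σ', weight [fin σ] (fun σ => (σ.reg 0).headD false = true) =
          weight [σ] (fun σ => σ.reg 0 =
            List.replicate ((D.items k).flatten.map (Item.bit v)).length false ++ []) := by
        intro σ hσ
        simp only [weight, List.map_cons, List.map_nil, List.sum_cons, List.sum_nil, add_zero,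
          propext (hfin2 σ hσ), hket σ hσ]
        congr
      rw [List.map_congr_left e5, ← weight_flatMap, List.flatMap_singleton', hout,
        weight_measured (fun a => rf_0) _ _ _ _ (by simp)]
      unfold listProb
      refine tsum_congr fun B => ?_
      congr 1
      simp only [List.length_reverse, List.reverse_reverse, eq_iff_iff]
      refine forall₂_congr fun q hq => ?_
      rw [List.getD_replicate _ hq, Bool.false_xor]
  choose last hlast1 hlast2 using hlast
  have hinit : ∀ r, ((⟨fun _ => [], ψ⟩ : State).reg r).length ≤ X := fun r => by simp
  -- Simulated registers start with length at most `X` and have length at most `2 * X` after `pre`.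
  -- Together with the marked keys they stay below `3 * X` during `post`, so the cap `4 * X` serves
  -- for both simulations.
  obtain ⟨p1, p2⟩ := runs_simCode (O' := O) (B' := 4 * X) hS hD pre hpre X ⟨fun _ => [], ψ⟩ hinit
    le_rfl (by omega)
  have hmid : ∀ σ ∈ pre.den (tableOracle v k s D.rows) ⟨fun _ => [], ψ⟩,
      Runs O [.seq (clear (m + 11)) (.seq (emit (m + 11) D.markPieces)
        (.seq (simCode S s m D.rows post) (.seq (emit 0 D.itemPieces)
        (.seq (pushList 1 (encCircuit C)) (.seq (extractor S) checkZero)))))] (simState m k σ)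
        (X * (simTime T X X (4 * X) + 2) + extractorTime T (2 * X) + 20 * X + 30)
        ((post.den (tableOracle v k s D.rows) (σ.set 0 (D.markStr k))).flatMap last) := by
    intro σ hσ
    have q1 : Det O (clear (m + 11)) (simState m k σ) (4 * X + 1) (simState m k (σ.set 0 [])) := by
      refine det_clear.congr ?_ ?_
      · have e := simState_reg m k σ 0
        rw [zero_add] at e
        rw [e]
        have := p2 σ hσ 0
        omega
      · have := simState_update m k σ 0 [] σ.ket
        rw [zero_add] at this
        exact this
    have q2 : Det O (emit (m + 11) D.markPieces) (simState m k (σ.set 0 []))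
        (emitTime k D.markPieces) (simState m k (σ.set 0 (D.markStr k))) := by
      refine (det_emit_add m D.markPieces).congr le_rfl ?_
      rw [D.piecesVal_markPieces]
      have e1 := tailReg_add m 0 (σ.set 0 []).reg
      have e2 := update_tailReg m 0 (σ.set 0 []).reg (D.markStr k)
      rw [zero_add] at e1 e2
      rw [e1, State.set_reg, List.append_nil, e2]
      simp [simState, State.set]
    obtain ⟨q3, -⟩ := runs_simCode (O' := O) (B' := 4 * X) hS hD post hpost (2 * X)
      (σ.set 0 (D.markStr k)) (by
        intro r
        by_cases hr : r = 0
        · subst hr; rw [State.set_reg]; omega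
        · rw [State.set_reg_ne _ hr]
          have := p2 σ hσ r
          omega) (by omega) (by omega)
    refine (q1.seqRuns (q2.seqRuns (Runs.seqMap q3 fun σ' _ => hlast1 σ'))).mono ?_
    have : post.size * (simTime T X X (4 * X) + 2) ≤ X * (simTime T X X (4 * X) + 2) := by gcongr
    omega
  have hsetup := det_setup (O := O) (k := k) (b := s₁) (c := [β]) (e := []) (f := []) (g := [])
    (h := []) (i := []) (j := []) (τ := fun _ => []) (ψ := ψ)
  have htail : simState m k ⟨fun _ => [], ψ⟩ = ⟨rf [] [] [] [] [] [] [] [] [] [] k fun _ => [], ψ⟩ := by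
    have : tailReg m (fun _ => []) = fun _ => [] := by funext r; simp [tailReg]
    simp [simState, this]
  rw [← htail] at hsetup
  refine ⟨_, (hsetup.seqRuns (Runs.seqMap p1 hmid)).mono ?_, ?_⟩
  · have : pre.size * (simTime T X X (4 * X) + 2) ≤ X * (simTime T X X (4 * X) + 2) := by gcongr
    simp only [guessTime, List.length_cons, List.length_nil]
    omega
  · rw [weight_flatMap]
    unfold Wiring.value
    congr 1
    refine List.map_congr_left fun σ _ => ?_
    rw [weight_flatMap]
    congr 1
    exact List.map_congr_left fun σ' _ => hlast2 σ'

end WMark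
end

noncomputable section

namespace WMark

/-! ### Size of unrolled programs -/

/-- The nesting depth of loops. -/
def Code.depth : Code → ℕ
  | skip => 0
  | instr _ => 0
  | seq a b => max a.depth b.depth
  | ite _ a b c => max a.depth (max b.depth c.depth)
  | loop _ a => a.depth + 1

theorem Code.size_rep (n : ℕ) (a : Code) : (rep n a).size = n * (a.size + 1) + 1 := by
  induction n with
  | zero => simp [rep, size]
  | succ n ih => simp only [rep, size, ih]; ring

/-- Every level of nesting multiplies the size by a constant times `N + 1`. The bound is polynomial
in `N` for a fixed depth, which is why depth is tracked separately from size. -/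
theorem Code.size_unroll_le (N : ℕ) (a : Code) :
    (a.unroll N).size ≤ a.size * (5 * (N + 1)) ^ a.depth := by
  have hpos : 1 ≤ 5 * (N + 1) := by omega
  induction a with
  | skip => simp [unroll, size, depth]
  | instr i => simp [unroll, size, depth]
  | seq a b iha ihb =>
    have h1 : (5 * (N + 1)) ^ a.depth ≤ (5 * (N + 1)) ^ max a.depth b.depth :=
      Nat.pow_le_pow_right hpos (by omega)
    have h2 : (5 * (N + 1)) ^ b.depth ≤ (5 * (N + 1)) ^ max a.depth b.depth :=
      Nat.pow_le_pow_right hpos (by omega)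
    have h3 : 1 ≤ (5 * (N + 1)) ^ max a.depth b.depth := Nat.one_le_pow _ _ hpos
    simp only [unroll, size, depth]
    nlinarith [Nat.mul_le_mul_left a.size h1, Nat.mul_le_mul_left b.size h2]
  | ite r a b c iha ihb ihc =>
    set M := max a.depth (max b.depth c.depth) with hM
    have h1 : (5 * (N + 1)) ^ a.depth ≤ (5 * (N + 1)) ^ M := Nat.pow_le_pow_right hpos (by omega)
    have h2 : (5 * (N + 1)) ^ b.depth ≤ (5 * (N + 1)) ^ M := Nat.pow_le_pow_right hpos (by omega)
    have h4 : (5 * (N + 1)) ^ c.depth ≤ (5 * (N + 1)) ^ M := Nat.pow_le_pow_right hpos (by omega)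
    have h3 : 1 ≤ (5 * (N + 1)) ^ M := Nat.one_le_pow _ _ hpos
    simp only [unroll, size, depth, ← hM]
    nlinarith [Nat.mul_le_mul_left a.size h1, Nat.mul_le_mul_left b.size h2,
      Nat.mul_le_mul_left c.size h4]
  | loop r a ih =>
    simp only [unroll, size_rep, size, depth, pow_succ]
    set D := (5 * (N + 1)) ^ a.depth
    have h3 : 1 ≤ D := Nat.one_le_pow _ _ hpos
    have h4 : N ≤ N * D := Nat.le_mul_of_pos_right N h3
    nlinarith [Nat.mul_le_mul_left N ih]

/-! ### Polynomial bounds -/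

theorem PolyBounded.mono {f g : ℕ → ℕ} (h : PolyBounded g) (hfg : ∀ κ, f κ ≤ g κ) :
    PolyBounded f := by
  obtain ⟨p, hp⟩ := h
  exact ⟨p, fun κ => (hfg κ).trans (hp κ)⟩

theorem PolyBounded.const (c : ℕ) : PolyBounded fun _ => c := ⟨Polynomial.C c, fun κ => by simp⟩

theorem PolyBounded.id : PolyBounded fun κ => κ := ⟨Polynomial.X, fun κ => by simp⟩

theorem PolyBounded.add {f g : ℕ → ℕ} (hf : PolyBounded f) (hg : PolyBounded g) :
    PolyBounded fun κ => f κ + g κ := by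
  obtain ⟨p, hp⟩ := hf
  obtain ⟨q, hq⟩ := hg
  exact ⟨p + q, fun κ => by rw [Polynomial.eval_add]; exact add_le_add (hp κ) (hq κ)⟩

theorem PolyBounded.mul {f g : ℕ → ℕ} (hf : PolyBounded f) (hg : PolyBounded g) :
    PolyBounded fun κ => f κ * g κ := by
  obtain ⟨p, hp⟩ := hf
  obtain ⟨q, hq⟩ := hg
  exact ⟨p * q, fun κ => by rw [Polynomial.eval_mul]; exact Nat.mul_le_mul (hp κ) (hq κ)⟩

theorem PolyBounded.pow {f : ℕ → ℕ} (hf : PolyBounded f) (d : ℕ) :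
    PolyBounded fun κ => f κ ^ d := by
  obtain ⟨p, hp⟩ := hf
  exact ⟨p ^ d, fun κ => by rw [Polynomial.eval_pow]; exact Nat.pow_le_pow_left (hp κ) d⟩

theorem PolyBounded.eval (T : Polynomial ℕ) {f : ℕ → ℕ} (hf : PolyBounded f) :
    PolyBounded fun κ => T.eval (f κ) := by
  obtain ⟨p, hp⟩ := hf
  exact ⟨T.comp p, fun κ => by rw [Polynomial.eval_comp]; exact polynomial_eval_mono T (hp κ)⟩

theorem PolyBounded.entryTime (T : Polynomial ℕ) {f : ℕ → ℕ} (hf : PolyBounded f) :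
    PolyBounded fun κ => entryTime T (f κ) :=
  ((PolyBounded.eval T hf).add ((PolyBounded.const 40).mul hf)).add (.const 40)

theorem PolyBounded.guessTime (T : Polynomial ℕ) {f : ℕ → ℕ} (hf : PolyBounded f) :
    PolyBounded fun κ => guessTime T (f κ) := by
  have h2 : PolyBounded fun κ => 2 * f κ := (PolyBounded.const 2).mul hf
  have h4 : PolyBounded fun κ => 4 * f κ := (PolyBounded.const 4).mul hf
  have hs : PolyBounded fun κ => simTime T (f κ) (f κ) (4 * f κ) :=
    ((hf.mul ((PolyBounded.entryTime T hf).add (.const 6))).add ((PolyBounded.const 16).mul h4)).add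
      (.const 20)
  have he : PolyBounded fun κ => extractorTime T (2 * f κ) :=
    (((((h2.mul ((h2.mul ((((PolyBounded.const 20).mul h2).add (PolyBounded.eval T h2)).add
      (.const 104))).add (.const 12))).add (.const 8)).add
      (h2.mul (((PolyBounded.const 20).mul h2).add (.const 44)))).add
      ((PolyBounded.const 22).mul h2)).add (.const 50)).add ((PolyBounded.const 2).mul (h2.pow 3))
  exact ((((PolyBounded.const 2).mul (hf.mul (hs.add (.const 2)))).add he).add
    ((PolyBounded.const 50).mul hf)).add (.const 50)

/-! ### Size and depth of the reduction -/

theorem size_pushList (r : ℕ) (l : List Bool) : (pushList r l).size = 2 * l.length + 1 := by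
  induction l with
  | nil => rfl
  | cons x l ih => simp only [pushList, Code.size, ih, pushBit, List.length_cons]; omega

theorem depth_pushList (r : ℕ) (l : List Bool) : (pushList r l).depth = 0 := by
  induction l with
  | nil => rfl
  | cons x l ih => simp [pushList, Code.depth, ih, pushBit]

theorem loopFree_pushList (r : ℕ) (l : List Bool) : (pushList r l).LoopFree := by
  induction l with
  | nil => trivial
  | cons x l ih => exact ⟨ih, trivial⟩

theorem size_takeBits_le (p : List Bool) : (takeBits p).size ≤ 20 * p.length + 1 := by
  induction p with
  | nil => simp [takeBits, Code.size]
  | cons x p ih =>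
    cases x <;> simp [takeBits, Code.size, pushBit] <;> omega

theorem depth_takeBits (p : List Bool) : (takeBits p).depth = 0 := by
  induction p with
  | nil => rfl
  | cons x p ih =>
    cases x <;> simp [takeBits, Code.depth, pushBit, ih]

theorem size_loadEntryKey_le (x : Option (List Bool)) (k : List Bool) :
    (loadEntryKey x).size ≤ 2 * (x.getD k).length + 30 := by
  cases x with
  | none => simp [loadEntryKey, copyReg, drain, readBit, pushBit, Code.size]
  | some l => simp [loadEntryKey, size_pushList]

theorem size_entryCode_le (S : Code) {s n : ℕ} {k : List Bool} {x : Entry}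
    (hx : (∀ p ∈ x.2, p.length = s) ∧ (x.1.getD k).length + s ≤ n) :
    (entryCode S s x).size ≤ S.size + 20 * n + 100 := by
  obtain ⟨ok, fl⟩ := x
  have h1 := size_loadEntryKey_le ok k
  have h2 := size_takeBits_le (fl.getD (List.replicate s false))
  have h3 : (fl.getD (List.replicate s false)).length = s := by
    cases fl with
    | none => simp
    | some p => simpa using hx.1 p rfl
  have h4 : (initFlag fl).size = 1 := by cases fl <;> rfl
  have hx2 := hx.2
  simp only [entryCode, Code.size, h4, moveRev, drain, readBit, pushBit, clear]
  simp only at hx2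
  omega

theorem depth_entryCode_le (S : Code) (s : ℕ) (x : Entry) :
    (entryCode S s x).depth ≤ S.depth + 1 := by
  obtain ⟨ok, fl⟩ := x
  have h1 : (loadEntryKey ok).depth ≤ 1 := by
    cases ok with
    | none => simp [loadEntryKey, copyReg, drain, readBit, pushBit, Code.depth]
    | some l => simp [loadEntryKey, depth_pushList]
  have h4 : (initFlag fl).depth = 0 := by cases fl <;> rfl
  simp only [entryCode, Code.depth, h4, moveRev, drain, readBit, pushBit, clear, depth_takeBits]
  omega

theorem size_rowCode_le (S : Code) {s n : ℕ} {k : List Bool} {row : List Entry}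
    (hx : ∀ x ∈ row, (∀ p ∈ x.2, p.length = s) ∧ (x.1.getD k).length + s ≤ n) :
    (rowCode S s row).size ≤ row.length * (S.size + 20 * n + 101) + 1 := by
  induction row with
  | nil => simp [rowCode, Code.size]
  | cons x row ih =>
    have h1 := size_entryCode_le S (hx x (by simp))
    have h2 := ih fun x h => hx x (by simp [h])
    simp only [rowCode, Code.size, List.length_cons, add_mul]
    omega

theorem depth_rowCode_le (S : Code) (s : ℕ) (row : List Entry) :
    (rowCode S s row).depth ≤ S.depth + 1 := by
  induction row with
  | nil => simp [rowCode, Code.depth]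
  | cons x row ih =>
    have := depth_entryCode_le S s x
    simp only [rowCode, Code.depth]; omega

theorem size_simCode_le (S : Code) {s m n u : ℕ} {k : List Bool} {rows : List (List Entry)}
    (h : TableBound k s n u rows) (a : Code) :
    (simCode S s m rows a).size ≤ a.size * (u * (S.size + 20 * n + 101) + 100) := by
  set M := u * (S.size + 20 * n + 101) + 100 with hM
  have hM1 : 100 ≤ M := by omega
  induction a with
  | skip => simp [simCode, Code.size]; omega
  | instr i =>
    cases i with
    | call i r r' =>
      have h1 := size_rowCode_le S (h.getD i).2
      have h2 : (rows.getD i []).length * (S.size + 20 * n + 101) ≤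
        u * (S.size + 20 * n + 101) := by gcongr; exact (h.getD i).1
      simp only [simCode, queryCode, copyReg, moveRev, drain, readBit, pushBit, clear, Code.size]
      omega
    | _ => simp [simCode, Code.size]; omega
  | seq a b iha ihb => simp only [simCode, Code.size, add_mul]; omega
  | ite r a b c iha ihb ihc => simp only [simCode, Code.size, add_mul]; omega
  | loop r a ih => simp only [simCode, Code.size, add_mul]; nlinarith

/-- The simulated program contributes no loops of its own, so the depth comes from a single query
and is independent of the security parameter. -/
theorem depth_simCode_le (S : Code) (s m : ℕ) (rows : List (List Entry)) (a : Code)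
    (ha : a.LoopFree) : (simCode S s m rows a).depth ≤ S.depth + 1 := by
  induction a with
  | skip => simp [simCode, Code.depth]
  | instr i =>
    cases i with
    | call i r r' =>
      have h1 := depth_rowCode_le S s (rows.getD i [])
      simp only [simCode, queryCode, copyReg, moveRev, drain, readBit, pushBit, clear, Code.depth]
      omega
    | _ => simp [simCode, Code.depth]
  | seq a b iha ihb =>
    have := iha ha.1
    have := ihb ha.2
    simp only [simCode, Code.depth]; omega
  | ite r a b c iha ihb ihc =>
    have := iha ha.1
    have := ihb ha.2.1
    have := ihc ha.2.2
    simp only [simCode, Code.depth]; omega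
  | loop r a ih => exact ha.elim

theorem size_emit_le (r : ℕ) (k : List Bool) (ps : List Piece) :
    (emit r ps).size ≤ 2 * emitTime k ps := by
  induction ps with
  | nil => simp [emit, Code.size, emitTime]; omega
  | cons p ps ih =>
    cases p with
    | none =>
      simp only [emit, emitKey, drain, readBit, pushBit, Code.size, emitTime, piecesVal,
        List.flatMap_cons, Option.getD_none, List.length_append, length_encStr,
        List.length_cons] at ih ⊢
      omega
    | some l =>
      simp only [emit, size_pushList, Code.size, emitTime, piecesVal,
        List.flatMap_cons, Option.getD_some, List.length_append, List.length_cons] at ih ⊢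
      omega

theorem depth_emit_le (r : ℕ) (ps : List Piece) : (emit r ps).depth ≤ 1 := by
  induction ps with
  | nil => simp [emit, Code.depth]
  | cons p ps ih =>
    cases p with
    | none =>
      simp only [emit, emitKey, drain, readBit, pushBit, Code.depth]
      omega
    | some l =>
      simp only [emit, depth_pushList, Code.depth]
      omega

theorem depth_extractor_le (S : Code) : (extractor S).depth ≤ S.depth + 4 := by
  simp [extractor, parse, loadItem, readBit, loadPoint, loadKey, parseStr, moveRev, drain,
    addTop, runGate, parseNat, addBits, clear, pushBit, Code.depth]

/-- A bound for the size of the reduction before its loops are unrolled. -/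
def guessSize (S : Code) (X : ℕ) : ℕ :=
  2 * (X * (X * (S.size + 20 * X + 101) + 100)) + 10 * X + (extractor S).size + 200

theorem size_guessCode_le (S : Code) {s m X : ℕ} {D : Wiring} {pre post : Code} {C : Circuit}
    {k : List Bool} (hD : TableBound k s X X D.rows) (h3 : pre.size ≤ X) (h4 : post.size ≤ X)
    (h5 : emitTime k D.markPieces ≤ X) (h6 : emitTime k D.itemPieces ≤ X)
    (h7 : (encCircuit C).length ≤ X) :
    (guessCode S s m D pre post C).size ≤ guessSize S X := by
  have e1 := size_simCode_le S (m := m) hD pre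
  have e2 := size_simCode_le S (m := m) hD post
  have e3 := size_emit_le (m + 11) k D.markPieces
  have e4 := size_emit_le 0 k D.itemPieces
  have e5 : pre.size * (X * (S.size + 20 * X + 101) + 100) ≤
    X * (X * (S.size + 20 * X + 101) + 100) := by gcongr
  have e6 : post.size * (X * (S.size + 20 * X + 101) + 100) ≤
    X * (X * (S.size + 20 * X + 101) + 100) := by gcongr
  have e7 : setup.size ≤ 50 := by
    simp [setup, moveRev, drain, readBit, pushBit, clear, Code.size]
  have e8 : checkZero.size ≤ 50 := by
    simp [checkZero, drain, readBit, pushBit, Code.size]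
  have e9 := size_pushList 1 (encCircuit C)
  simp only [guessCode, Code.size, guessSize]
  have e10 : (clear (m + 11)).size = 2 := rfl
  omega

theorem depth_guessCode_le (S : Code) (s m : ℕ) (D : Wiring) {pre post : Code} (C : Circuit)
    (hpre : pre.LoopFree) (hpost : post.LoopFree) :
    (guessCode S s m D pre post C).depth ≤ S.depth + 4 := by
  have e1 := depth_simCode_le S s m D.rows pre hpre
  have e2 := depth_simCode_le S s m D.rows post hpost
  have e3 := depth_emit_le (m + 11) D.markPieces
  have e4 := depth_emit_le 0 D.itemPieces
  have e5 := depth_extractor_le S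
  have e7 : setup.depth ≤ 1 := by
    simp [setup, moveRev, drain, readBit, pushBit, clear, Code.depth]
  have e8 : checkZero.depth ≤ 1 := by
    simp [checkZero, drain, readBit, pushBit, Code.depth]
  have e9 := depth_pushList 1 (encCircuit C)
  have e10 : (clear (m + 11)).depth = 1 := rfl
  simp only [guessCode, Code.depth]
  omega

end WMark
end

noncomputable section

namespace WMark

/-! ### The adversary against differing-point hiding -/

theorem rf_nil : rf [] [] [] [] [] [] [] [] [] [] [] (fun _ => []) = fun _ => [] := by
  funext r
  match r with
  | 0 | 1 | 2 | 3 | 4 | 5 | 6 | 7 | 8 | 9 | 10 | _ + 11 => simp [rf]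

theorem readBits_ofFn {l : ℕ} (s : Fin l → Bool) : readBits l (List.ofFn s) = s := by
  funext i
  simp [readBits]

theorem expect_congr {α : Type} {p : PMF α} {f g : α → ℝ} (h : ∀ a ∈ p.support, f a = g a) :
    expect p f = expect p g := by
  unfold expect
  refine tsum_congr fun a => ?_
  by_cases ha : p a = 0
  · simp [ha]
  · rw [h a ((PMF.mem_support_iff p a).2 ha)]

/-- The bounds on the hard-wired strings that make the reduction efficient. -/
structure Wiring.Bounded (D : Wiring) (s X : ℕ) (k : List Bool) : Prop where
  rows : TableBound k s X X D.rows
  marks : emitTime k D.markPieces ≤ X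
  items : emitTime k D.itemPieces ≤ X

def pointsCode (s₀ s₁ : List Bool) (β : Bool) : Code :=
  .seq (pushList 0 s₀) (.seq (pushList 1 s₁) (pushBit 2 β))

theorem run_pointsCode (s₀ s₁ : List Bool) (β : Bool) (ψ : Ket) :
    (pointsCode s₀ s₁ β).run noOracle ⟨fun _ => [], ψ⟩ =
      [⟨rf s₀ s₁ [β] [] [] [] [] [] [] [] [] fun _ => [], ψ⟩] := by
  rw [show (⟨fun _ => [], ψ⟩ : State) = ⟨rf [] [] [] [] [] [] [] [] [] [] [] fun _ => [], ψ⟩ by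
    rw [rf_nil]]
  have h1 : Det noOracle (pushList 0 s₀)
      ⟨rf [] [] [] [] [] [] [] [] [] [] [] fun _ => [], ψ⟩ (2 * s₀.length + 1)
      ⟨rf s₀ [] [] [] [] [] [] [] [] [] [] fun _ => [], ψ⟩ := det_pushList.congr le_rfl (by simp)
  have h2 : Det noOracle (pushList 1 s₁)
      ⟨rf s₀ [] [] [] [] [] [] [] [] [] [] fun _ => [], ψ⟩ (2 * s₁.length + 1)
      ⟨rf s₀ s₁ [] [] [] [] [] [] [] [] [] fun _ => [], ψ⟩ := det_pushList.congr le_rfl (by simp)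
  have h3 : Det noOracle (pushBit 2 β)
      ⟨rf s₀ s₁ [] [] [] [] [] [] [] [] [] fun _ => [], ψ⟩ 1
      ⟨rf s₀ s₁ [β] [] [] [] [] [] [] [] [] fun _ => [], ψ⟩ := det_pushBit.congr le_rfl (by simp)
  refine Runs.exec (h1.seq (h2.seq h3)) ?_
  simp [pointsCode, Code.size, size_pushList, pushBit]

variable {ℓ : ℕ → ℕ} {S : Code} {m : ℕ} {T : Polynomial ℕ}

/-- The adversary with hard-wired points `s κ` and strings `D κ`. -/
def wiredAdversary (S : Code) (m : ℕ) (T : Polynomial ℕ) (A : ParAdversary) {X : ℕ → ℕ}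
    (hℓ : PolyBounded ℓ) (hX : PolyBounded X) (s : (κ : ℕ) → Bool → Fin (ℓ κ) → Bool)
    (β : ℕ → Bool) (D : ℕ → Wiring) (hD : ∀ κ, (D κ).Bounded (ℓ κ) (X κ) [])
    (h3 : ∀ κ, (A.preMark κ).size ≤ X κ) (h4 : ∀ κ, (A.postMark κ).size ≤ X κ)
    (h5 : ∀ κ, (encCircuit (A.predictor κ)).length ≤ X κ) : HidingAdversary where
  choose κ := pointsCode (List.ofFn (s κ false)) (List.ofFn (s κ true)) (β κ)
  guess κ := (guessCode S (ℓ κ) m (D κ) (A.preMark κ) (A.postMark κ) (A.predictor κ)).unroll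
    (guessTime T (X κ))
  qubits := A.qubits
  advice := A.advice
  choose_poly := ⟨fun κ => ⟨loopFree_pushList _ _, loopFree_pushList _ _, trivial⟩,
    (((PolyBounded.const 4).mul hℓ).add (.const 5)).mono fun κ => by
      simp [pointsCode, Code.size, size_pushList, pushBit]; omega⟩
  guess_poly := ⟨fun κ => Code.unroll_loopFree _ _, by
    have hs : PolyBounded fun κ => guessSize S (X κ) :=
      ((((PolyBounded.const 2).mul (hX.mul ((hX.mul (((PolyBounded.const S.size).add
        ((PolyBounded.const 20).mul hX)).add (.const 101))).add (.const 100)))).add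
        ((PolyBounded.const 10).mul hX)).add (.const _)).add (.const 200)
    -- The exponent `S.depth + 4` is a constant, because the evaluation program `S` belongs to the
    -- PRF and is uniform.
    refine (hs.mul (((PolyBounded.const 5).mul ((PolyBounded.guessTime T hX).add
      (.const 1))).pow (S.depth + 4))).mono fun κ => ?_
    refine (Code.size_unroll_le _ _).trans ?_
    gcongr
    · exact size_guessCode_le S (hD κ).rows (h3 κ) (h4 κ) (hD κ).marks (hD κ).items (h5 κ)
    · omega
    · exact depth_guessCode_le S _ _ _ _ (A.preMark_poly.1 κ) (A.postMark_poly.1 κ)⟩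
  qubits_poly := A.qubits_poly
  advice_state := A.advice_state

theorem hidingProb_wiredAdversary (F : TEPRF ℓ) (hS : Computes S m T F.Eval) (A : ParAdversary)
    {X : ℕ → ℕ} (hℓ : PolyBounded ℓ) (hX : PolyBounded X)
    (s : (κ : ℕ) → Bool → Fin (ℓ κ) → Bool) (β : ℕ → Bool) (D : ℕ → Wiring)
    (hD : ∀ κ, (D κ).Bounded (ℓ κ) (X κ) [])
    (h3 : ∀ κ, (A.preMark κ).size ≤ X κ) (h4 : ∀ κ, (A.postMark κ).size ≤ X κ)
    (h5 : ∀ κ, (encCircuit (A.predictor κ)).length ≤ X κ) (coin : Bool) (κ : ℕ)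
    (hℓX : ℓ κ ≤ X κ)
    (hkey : ∀ key ∈ (F.KG κ (s κ coin)).support,
      (if β κ then key.2 else key.1).length ≤ X κ ∧
      (D κ).Bounded (ℓ κ) (X κ) (if β κ then key.2 else key.1)) :
    F.hidingProb (wiredAdversary S m T A hℓ hX s β D hD h3 h4 h5) coin κ =
      expect (F.KG κ (s κ coin)) fun key => (D κ).value F.Eval (ℓ κ) (A.preMark κ) (A.postMark κ)
        (A.predictor κ) (if β κ then key.2 else key.1) (A.advice κ) := by
  unfold TEPRF.hidingProb
  simp only [wiredAdversary, run_pointsCode, List.map_cons, List.map_nil, List.sum_cons,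
    List.sum_nil, add_zero]
  have hpt : readBits (ℓ κ) (rf (List.ofFn (s κ false)) (List.ofFn (s κ true)) [β κ]
      [] [] [] [] [] [] [] [] (fun _ => []) (if coin then 1 else 0)) = s κ coin := by
    cases coin <;> simp [readBits_ofFn]
  rw [hpt]
  refine expect_congr fun key hk => ?_
  obtain ⟨hk1, hk2⟩ := hkey key hk
  change weight (Code.run noOracle _ (State.set ⟨rf _ _ _ _ _ _ _ _ _ _ _ _, _⟩ 0
    (if β κ then key.2 else key.1))) _ = _
  rw [rf_set_0]
  obtain ⟨L, hL1, hL2⟩ := Runs.exists_guessCode (O := noOracle) (ψ := A.advice κ) (β := β κ)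
    (s₁ := List.ofFn (s κ true)) (C := A.predictor κ) hS hk2.rows
    (A.preMark_poly.1 κ) (A.postMark_poly.1 κ) (by simpa using hℓX) hk1 (h3 κ) (h4 κ)
    hk2.marks hk2.items (h5 κ)
  -- For every key in the support the looping program halts within the number of unrolled copies, so
  -- unrolling changes nothing.
  rw [Code.LoopFree.run_eq (Code.unroll_loopFree _ _), hL1.den_unroll le_rfl, hL2]

end WMark
end

noncomputable section

namespace WMark

/-! ### Preservation of the norm -/

/-- The squared amplitudes are summable. -/
def Ket.L2 (ψ : Ket) : Prop := Summable fun B => ‖ψ B‖ ^ 2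

theorem normSq_nonneg (ψ : Ket) : 0 ≤ normSq ψ := tsum_nonneg fun _ => by positivity

/-- Covers the NOT, CNOT and `T` gates and the loading of a challenge: all of them permute the basis
vectors up to phases. -/
theorem normSq_comp {ψ φ : Ket} (e : Finset ℕ ≃ Finset ℕ) (h : ∀ B, ‖φ B‖ = ‖ψ (e B)‖)
    (hψ : ψ.L2) : φ.L2 ∧ normSq φ = normSq ψ := by
  have h' : (fun B => ‖φ B‖ ^ 2) = (fun B => ‖ψ B‖ ^ 2) ∘ e := by
    funext B; simp [h B]
  constructor
  · unfold Ket.L2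
    rw [h']
    exact e.summable_iff.2 hψ
  · unfold normSq
    rw [h']
    exact e.tsum_eq fun B => ‖ψ B‖ ^ 2

/-- Flips the qubits in a set. -/
def flipEquiv (a : Finset ℕ) : Finset ℕ ≃ Finset ℕ where
  toFun B := symmDiff B a
  invFun B := symmDiff B a
  left_inv B := symmDiff_symmDiff_cancel_right a B
  right_inv B := symmDiff_symmDiff_cancel_right a B

def cnotMap (a b : ℕ) (B : Finset ℕ) : Finset ℕ := if a ≠ b ∧ a ∈ B then symmDiff B {b} else B

theorem cnotMap_cnotMap (a b : ℕ) (B : Finset ℕ) : cnotMap a b (cnotMap a b B) = B := by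
  unfold cnotMap
  by_cases h : a ≠ b ∧ a ∈ B
  · have : a ≠ b ∧ a ∈ symmDiff B {b} := ⟨h.1, by simp [Finset.mem_symmDiff, h.1, h.2]⟩
    rw [if_pos h, if_pos this]
    exact symmDiff_symmDiff_cancel_right {b} B
  · rw [if_neg h, if_neg h]

/-- Basis vectors are paired by flipping qubit `a`. On each pair this is the parallelogram law, and
the sum over all `B` counts every pair twice on both sides. -/
theorem normSq_hadamard (a : ℕ) {ψ : Ket} (hψ : ψ.L2) :
    ((Gate.h a).apply ψ).L2 ∧ normSq ((Gate.h a).apply ψ) = normSq ψ := by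
  set φ := (Gate.h a).apply ψ with hφ
  have hpar : ∀ B, ‖φ B‖ ^ 2 + ‖φ (flipEquiv {a} B)‖ ^ 2 =
      ‖ψ B‖ ^ 2 + ‖ψ (flipEquiv {a} B)‖ ^ 2 := by
    have key : ∀ x y : ℂ, ‖(x + y) / (Real.sqrt 2 : ℂ)‖ ^ 2 + ‖(x - y) / (Real.sqrt 2 : ℂ)‖ ^ 2 =
        ‖x‖ ^ 2 + ‖y‖ ^ 2 := by
      intro x y
      have h2 : ‖(Real.sqrt 2 : ℂ)‖ ^ 2 = 2 := by
        rw [Complex.norm_real, Real.norm_eq_abs, sq_abs, Real.sq_sqrt (by norm_num)]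
      rw [norm_div, norm_div, div_pow, div_pow, h2]
      have := parallelogram_law_with_norm ℝ x y
      nlinarith [this]
    intro B
    by_cases ha : a ∈ B
    · have e1 : flipEquiv {a} B = B.erase a := by
        ext q; by_cases hq : q = a <;> simp [flipEquiv, Finset.mem_symmDiff, hq, ha]
      have e2 : insert a B = B := Finset.insert_eq_self.2 ha
      have e3 : insert a (B.erase a) = B := Finset.insert_erase ha
      rw [e1]
      simp only [hφ, Gate.apply, ha, if_true, e2, Finset.notMem_erase, if_false, e3,
        Finset.erase_idem]
      have := key (ψ (B.erase a)) (ψ B)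
      rw [one_mul, neg_one_mul, ← sub_eq_add_neg]
      linarith
    · have e1 : flipEquiv {a} B = insert a B := by
        ext q; by_cases hq : q = a <;> simp [flipEquiv, Finset.mem_symmDiff, hq, ha]
      have e2 : B.erase a = B := Finset.erase_eq_of_notMem ha
      have e3 : (insert a B).erase a = B := Finset.erase_insert ha
      rw [e1]
      simp only [hφ, Gate.apply, ha, if_false, e2, Finset.mem_insert_self, if_true, e3,
        Finset.insert_idem]
      have := key (ψ B) (ψ (insert a B))
      rw [one_mul, neg_one_mul, ← sub_eq_add_neg]
      linarith
  have hψ' : Summable fun B => ‖ψ (flipEquiv {a} B)‖ ^ 2 :=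
    (flipEquiv {a}).summable_iff (f := fun B => ‖ψ B‖ ^ 2) |>.2 hψ
  have hsum := hψ.add hψ'
  have hφ1 : φ.L2 := by
    refine Summable.of_nonneg_of_le (fun _ => by positivity) (fun B => ?_) hsum
    rw [← hpar B]
    have : 0 ≤ ‖φ (flipEquiv {a} B)‖ ^ 2 := by positivity
    linarith
  have hφ' : Summable fun B => ‖φ (flipEquiv {a} B)‖ ^ 2 :=
    (flipEquiv {a}).summable_iff (f := fun B => ‖φ B‖ ^ 2) |>.2 hφ1
  refine ⟨hφ1, ?_⟩
  have h1 := hφ1.tsum_add hφ'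
  have h2 := hψ.tsum_add hψ'
  rw [(flipEquiv {a}).tsum_eq (fun B => ‖φ B‖ ^ 2)] at h1
  rw [(flipEquiv {a}).tsum_eq (fun B => ‖ψ B‖ ^ 2)] at h2
  simp only [hpar] at h1
  unfold normSq
  linarith

theorem Gate.normSq_apply (g : Gate) {ψ : Ket} (hψ : ψ.L2) :
    (g.apply ψ).L2 ∧ normSq (g.apply ψ) = normSq ψ := by
  cases g with
  | x a => exact normSq_comp (flipEquiv {a}) (fun B => rfl) hψ
  | h a => exact normSq_hadamard a hψ
  | t a =>
    refine normSq_comp (Equiv.refl _) (fun B => ?_) hψ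
    have : ‖Complex.exp (Real.pi / 4 * Complex.I)‖ = 1 := by
      have := Complex.norm_exp_ofReal_mul_I (Real.pi / 4)
      push_cast at this
      exact this
    simp only [Gate.apply, Equiv.refl_apply]
    split_ifs <;> simp [this]
  | cnot a b =>
    exact normSq_comp ⟨cnotMap a b, cnotMap a b, cnotMap_cnotMap a b, cnotMap_cnotMap a b⟩
      (fun B => rfl) hψ

theorem Circuit.normSq_apply (C : Circuit) {ψ : Ket} (hψ : ψ.L2) :
    (Circuit.apply C ψ).L2 ∧ normSq (Circuit.apply C ψ) = normSq ψ := by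
  induction C generalizing ψ with
  | nil => exact ⟨hψ, rfl⟩
  | cons g C ih =>
    obtain ⟨h1, h2⟩ := g.normSq_apply hψ
    obtain ⟨h3, h4⟩ := ih h1
    exact ⟨h3, h4.trans h2⟩

theorem flipKet_normSq (l : List Bool) {ψ : Ket} (hψ : ψ.L2) :
    (flipKet l ψ).L2 ∧ normSq (flipKet l ψ) = normSq ψ :=
  normSq_comp (flipEquiv _) (fun _ => rfl) hψ

theorem IsState.normSq {n : ℕ} {ψ : Ket} (h : IsState n ψ) : ψ.L2 ∧ WMark.normSq ψ = 1 := by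
  have h0 : ∀ B ∉ (Finset.range n).powerset, ‖ψ B‖ ^ 2 = 0 := by
    intro B hB
    have : ψ B = 0 := by
      by_contra h'
      exact hB (Finset.mem_powerset.2 (h.1 B h'))
    simp [this]
  exact ⟨summable_of_ne_finset_zero h0, by
    unfold WMark.normSq
    rw [tsum_eq_sum h0, h.2]⟩

/-- Vectors of branches are not renormalized, so this is conservation of probability: a coin splits
the squared norm evenly and a measurement splits it along orthogonal projections. -/
theorem Instr.normSq_apply (O : Oracle) (i : Instr) {σ : State} (hσ : σ.ket.L2) :
    (∀ σ' ∈ i.apply O σ, σ'.ket.L2) ∧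
      ((i.apply O σ).map fun σ' => normSq σ'.ket).sum = normSq σ.ket := by
  cases i with
  | push r b => simpa [Instr.apply, State.set] using hσ
  | pop r => simpa [Instr.apply, State.set] using hσ
  | call i r r' => simpa [Instr.apply, State.set] using hσ
  | gate g =>
    obtain ⟨h1, h2⟩ := (g.map fun r => (σ.reg r).length).normSq_apply hσ
    simpa [Instr.apply] using ⟨h1, h2⟩
  | coin r =>
    have h0 : ∀ B, ‖σ.ket B / (Real.sqrt 2 : ℂ)‖ ^ 2 = ‖σ.ket B‖ ^ 2 / 2 := by
      intro B
      rw [norm_div, div_pow, Complex.norm_real, Real.norm_eq_abs, sq_abs,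
        Real.sq_sqrt (by norm_num)]
    have h1 : Ket.L2 fun B => σ.ket B / (Real.sqrt 2 : ℂ) := by
      unfold Ket.L2
      simp only [h0]
      exact hσ.div_const 2
    have h2 : normSq (fun B => σ.ket B / (Real.sqrt 2 : ℂ)) = normSq σ.ket / 2 := by
      unfold normSq
      simp only [h0]
      exact tsum_div_const
    refine ⟨?_, ?_⟩
    · intro σ' h
      obtain ⟨b, _, rfl⟩ := List.mem_map.1 h
      exact h1
    · simp only [Instr.apply, List.map_cons, List.map_nil, List.sum_cons, List.sum_nil, h2]
      ring
  | measure r r' =>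
    have h0 : ∀ b, Ket.L2 fun B => if decide ((σ.reg r).length ∈ B) = b then σ.ket B else 0 := by
      intro b
      refine Summable.of_nonneg_of_le (fun _ => by positivity) (fun B => ?_) hσ
      dsimp only
      split_ifs
      · exact le_rfl
      · simp
    refine ⟨?_, ?_⟩
    · intro σ' h
      obtain ⟨b, _, rfl⟩ := List.mem_map.1 h
      exact h0 b
    · simp only [Instr.apply, List.map_cons, List.map_nil, List.sum_cons, List.sum_nil, add_zero]
      unfold normSq
      rw [← (h0 false).tsum_add (h0 true)]
      refine tsum_congr fun B => ?_
      by_cases hB : (σ.reg r).length ∈ B <;> simp [hB]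

/-! ### Expectations over the branches of a program -/

/-- The sum of `f` over all branches. -/
def Code.val (O : Oracle) (a : Code) (f : State → ℝ) (σ : State) : ℝ := ((a.den O σ).map f).sum

theorem sum_map_flatMap {α β : Type} (L : List α) (M : α → List β) (f : β → ℝ) :
    ((L.flatMap M).map f).sum = (L.map fun x => ((M x).map f).sum).sum := by
  induction L with
  | nil => simp
  | cons x L ih => simp [ih]

theorem Code.val_seq (O : Oracle) (a b : Code) (f : State → ℝ) (σ : State) :
    (seq a b).val O f σ = a.val O (b.val O f) σ := sum_map_flatMap _ _ _

theorem Code.val_ite (O : Oracle) (r : ℕ) (a b c : Code) (f : State → ℝ) (σ : State) :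
    (ite r a b c).val O f σ = match σ.reg r with
      | [] => c.val O f σ
      | true :: _ => a.val O f σ
      | false :: _ => b.val O f σ := by
  simp only [val, den]
  rcases σ.reg r with _ | ⟨_ | _, l⟩ <;> rfl

theorem Code.normSq_den (O : Oracle) (a : Code) {σ : State} (hσ : σ.ket.L2) :
    (∀ σ' ∈ a.den O σ, σ'.ket.L2) ∧ a.val O (fun σ' => normSq σ'.ket) σ = normSq σ.ket := by
  induction a generalizing σ with
  | skip => simpa [den, val] using hσ
  | instr i => exact i.normSq_apply O hσ
  | seq a b iha ihb =>
    constructor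
    · intro σ' h
      obtain ⟨σ₁, h1, h2⟩ := List.mem_flatMap.1 h
      exact (ihb ((iha hσ).1 σ₁ h1)).1 σ' h2
    · rw [val_seq, ← (iha hσ).2]
      unfold val
      congr 1
      exact List.map_congr_left fun σ₁ h1 => (ihb ((iha hσ).1 σ₁ h1)).2
  | ite r a b c iha ihb ihc =>
    rw [val_ite]
    simp only [den]
    rcases σ.reg r with _ | ⟨_ | _, l⟩
    exacts [ihc hσ, ihb hσ, iha hσ]
  | loop r a _ => simpa [den, val] using hσ

/-- `f` is at most the probability of the branch. -/
def SubProb (f : State → ℝ) : Prop := ∀ σ, σ.ket.L2 → 0 ≤ f σ ∧ f σ ≤ normSq σ.ket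

theorem Code.val_le {O : Oracle} {a : Code} {f g : State → ℝ} {σ : State} (hσ : σ.ket.L2)
    (h : ∀ σ, σ.ket.L2 → f σ ≤ g σ) : a.val O f σ ≤ a.val O g σ :=
  List.sum_le_sum fun σ' h' => h σ' ((a.normSq_den O hσ).1 σ' h')

theorem Code.val_zero (O : Oracle) (a : Code) (σ : State) : a.val O (fun _ => 0) σ = 0 := by
  simp [val]

theorem Code.val_nonneg {O : Oracle} {a : Code} {f : State → ℝ} {σ : State} (hσ : σ.ket.L2)
    (h : ∀ σ, σ.ket.L2 → 0 ≤ f σ) : 0 ≤ a.val O f σ := by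
  rw [← a.val_zero O σ]
  exact val_le hσ h

theorem SubProb.val {f : State → ℝ} (hf : SubProb f) (O : Oracle) (a : Code) :
    SubProb (a.val O f) := fun σ hσ =>
  ⟨Code.val_nonneg hσ fun σ h => (hf σ h).1, by
    rw [← (a.normSq_den O hσ).2]
    exact Code.val_le hσ fun σ h => (hf σ h).2⟩

theorem SubProb.set {f : State → ℝ} (hf : SubProb f) (r : ℕ) (l : List Bool) :
    SubProb fun σ => f (σ.set r l) := fun σ hσ => hf (σ.set r l) hσ

theorem Code.val_sub (O : Oracle) (a : Code) (f g : State → ℝ) (σ : State) :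
    a.val O (fun σ => f σ - g σ) σ = a.val O f σ - a.val O g σ := by
  unfold val
  induction a.den O σ with
  | nil => simp
  | cons x L ih => simp only [List.map_cons, List.sum_cons, ih]; ring

theorem Code.abs_val_le {O : Oracle} {a : Code} {f g : State → ℝ} {σ : State} (hσ : σ.ket.L2)
    (h : ∀ σ, σ.ket.L2 → |f σ| ≤ g σ) : |a.val O f σ| ≤ a.val O g σ := by
  refine le_trans ?_ (val_le (f := fun σ => |f σ|) hσ h)
  unfold val
  induction a.den O σ with
  | nil => simp
  | cons x L ih =>
    simp only [List.map_cons, List.sum_cons]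
    exact (abs_add_le _ _).trans (by linarith)

/-! ### Queries at a hidden point -/

open Classical in
/-- The expected number of queries in the set `E`. -/
def Code.hits (O : Oracle) (E : ℕ → List Bool → Prop) : Code → State → ℝ
  | instr (.call i r _), σ => if E i (σ.reg r) then normSq σ.ket else 0
  | seq a b, σ => a.hits O E σ + a.val O (b.hits O E) σ
  | ite r a b c, σ =>
      match σ.reg r with
      | [] => c.hits O E σ
      | true :: _ => a.hits O E σ
      | false :: _ => b.hits O E σ
  | _, _ => 0

/-- Two runs are identical until a query falls into `E`, and from there on the outcomes differ by at
most the probability of the branch. As queries are classical, the amplitudes within a branch play no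
role and the loss is linear in the probability of a hit. -/
theorem Code.abs_val_sub_le {O O' : Oracle} {E : ℕ → List Bool → Prop}
    (hE : ∀ i q, ¬ E i q → O' i q = O i q) (a : Code) {f : State → ℝ} (hf : SubProb f)
    {σ : State} (hσ : σ.ket.L2) : |a.val O' f σ - a.val O f σ| ≤ a.hits O E σ := by
  induction a generalizing σ f with
  | skip => simp [val, den, hits]
  | instr i =>
    cases i with
    | call i r r' =>
      simp only [val, den, hits, Instr.apply, List.map_cons, List.map_nil, List.sum_cons,
        List.sum_nil, add_zero]
      split_ifs with h
      · have h1 := hf (σ.set r' (O' i (σ.reg r))) hσ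
        have h2 := hf (σ.set r' (O i (σ.reg r))) hσ
        rw [abs_le]
        simp only [State.set] at h1 h2 ⊢
        constructor <;> linarith
      · rw [hE i _ h]; simp
    | _ => simp [val, den, hits, Instr.apply]
  | seq a b iha ihb =>
    rw [val_seq, val_seq, hits]
    -- The oracle is exchanged in `a` while `b` still uses `O'`, and then in `b` on the states that
    -- `a` reaches with `O`. Thus all hits are counted in the run with `O`.
    have h1 := iha (hf.val O' b) hσ
    have h2 : |a.val O (fun σ => b.val O' f σ - b.val O f σ) σ| ≤ a.val O (b.hits O E) σ :=
      abs_val_le hσ fun σ h => ihb hf h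
    rw [val_sub] at h2
    have := abs_add_le (a.val O' (b.val O' f) σ - a.val O (b.val O' f) σ)
      (a.val O (fun σ => b.val O' f σ) σ - a.val O (fun σ => b.val O f σ) σ)
    have e : (a.val O' (b.val O' f) σ - a.val O (b.val O' f) σ) +
      (a.val O (fun σ => b.val O' f σ) σ - a.val O (fun σ => b.val O f σ) σ) =
      a.val O' (b.val O' f) σ - a.val O (b.val O f) σ := by ring
    rw [e] at this
    linarith
  | ite r a b c iha ihb ihc =>
    rw [val_ite, val_ite]
    simp only [hits]
    rcases σ.reg r with _ | ⟨_ | _, l⟩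
    exacts [ihc hf hσ, ihb hf hσ, iha hf hσ]
  | loop r a _ => simp [val, den, hits]

theorem Code.val_sum {P : Type} (s : Finset P) (O : Oracle) (a : Code) (f : P → State → ℝ)
    (σ : State) : ∑ p ∈ s, a.val O (f p) σ = a.val O (fun σ => ∑ p ∈ s, f p σ) σ := by
  unfold val
  induction a.den O σ with
  | nil => simp
  | cons x L ih => simp [Finset.sum_add_distrib, ih]

theorem Code.val_const_mul (O : Oracle) (a : Code) (c : ℝ) (f : State → ℝ) (σ : State) :
    a.val O (fun σ => c * f σ) σ = c * a.val O f σ := List.sum_map_mul_left ..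

/-- A query lies in at most one of the sets, so summing over all of them counts each query at most
once, and a loop-free program makes no more queries than its size. -/
theorem Code.sum_hits_le {P : Type} [Fintype P] (O : Oracle) {E : P → ℕ → List Bool → Prop}
    (hE : ∀ i q p p', E p i q → E p' i q → p = p') (a : Code) {σ : State} (hσ : σ.ket.L2) :
    ∑ p, a.hits O (E p) σ ≤ a.size * normSq σ.ket := by
  induction a generalizing σ with
  | skip => simpa [hits, size] using normSq_nonneg _
  | instr i =>
    cases i with
    | call i r r' =>
      simp only [hits, size, Nat.cast_one, one_mul]
      by_cases h : ∃ p, E p i (σ.reg r)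
      · obtain ⟨p, hp⟩ := h
        rw [Finset.sum_eq_single p]
        · simp [hp]
        · intro p' _ hne
          rw [if_neg fun h' => hne (hE _ _ _ _ h' hp)]
        · simp
      · push Not at h
        simpa [h] using normSq_nonneg _
    | _ => simpa [hits, size] using normSq_nonneg _
  | seq a b iha ihb =>
    simp only [hits, size, Finset.sum_add_distrib]
    rw [val_sum]
    have h1 : a.val O (fun σ => ∑ p, b.hits O (E p) σ) σ ≤ b.size * normSq σ.ket := by
      rw [← (a.normSq_den O hσ).2, ← val_const_mul]
      exact val_le hσ fun σ h => ihb h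
    have h2 := iha hσ
    have := normSq_nonneg σ.ket
    push_cast
    linarith
  | ite r a b c iha ihb ihc =>
    have h0 := normSq_nonneg σ.ket
    have ha := iha hσ
    have hb := ihb hσ
    have hc := ihc hσ
    have e1 : 0 ≤ (a.size : ℝ) * normSq σ.ket := by positivity
    have e2 : 0 ≤ (b.size : ℝ) * normSq σ.ket := by positivity
    have e3 : 0 ≤ (c.size : ℝ) * normSq σ.ket := by positivity
    simp only [hits, size]
    push_cast
    rcases σ.reg r with _ | ⟨_ | _, l⟩ <;> simp only <;> linarith
  | loop r a _ => simpa [hits, size] using mul_nonneg (by positivity) (normSq_nonneg _)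

end WMark
end

noncomputable section

namespace WMark

/-! ### The game played with given keys -/

/-- What matters about one instance of the PRF: the function that the oracle evaluates, the marked
key, the challenge and the expected answer. -/
structure PairSpec (l : ℕ) where
  fn : (Fin l → Bool) → Bool
  mark : List Bool
  point : Fin l → Bool
  ans : Bool

/-- The concatenation of the rows of a matrix. -/
def flat {α : Type} {n w : ℕ} (f : Fin n × Fin w → α) : List α :=
  (List.ofFn fun i => List.ofFn fun j => f (i, j)).flatten

theorem flat_eq {α : Type} {n w : ℕ} (f : Fin n × Fin w → α) :
    flat f = List.ofFn fun q : Fin (n * w) => f (finProdFinEquiv.symm q) := by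
  rw [List.ofFn_mul, flat]
  congr 2
  funext i
  congr 1
  funext j
  congr 1
  apply finProdFinEquiv.injective
  rw [Equiv.apply_symm_apply]
  apply Fin.ext
  simp [finProdFinEquiv, add_comm, mul_comm]

theorem length_flat {α : Type} {n w : ℕ} (f : Fin n × Fin w → α) : (flat f).length = n * w := by
  rw [flat_eq, List.length_ofFn]

theorem index_lt {n w : ℕ} (i : Fin n) (j : Fin w) : i.val * w + j.val < n * w := by
  have := (finProdFinEquiv (i, j)).isLt
  simp [finProdFinEquiv] at this
  linarith [mul_comm w i.val]

theorem getD_flat {α : Type} {n w : ℕ} (f : Fin n × Fin w → α) (i : Fin n) (j : Fin w) (d : α) :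
    (flat f).getD (i.val * w + j.val) d = f (i, j) := by
  rw [flat_eq, List.getD_eq_getElem _ _ (by simpa using index_lt i j), List.getElem_ofFn]
  congr 1
  rw [Equiv.symm_apply_eq]
  apply Fin.ext
  simp [finProdFinEquiv, add_comm, mul_comm]

theorem exists_index {n w q : ℕ} (hq : q < n * w) :
    ∃ (i : Fin n) (j : Fin w), q = i.val * w + j.val := by
  refine ⟨(finProdFinEquiv.symm ⟨q, hq⟩).1, (finProdFinEquiv.symm ⟨q, hq⟩).2, ?_⟩
  have := congrArg Fin.val (finProdFinEquiv.apply_symm_apply (⟨q, hq⟩ : Fin (n * w)))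
  simp only [finProdFinEquiv_apply_val] at this
  exact this.symm.trans ((add_comm _ _).trans (by rw [mul_comm]))

theorem map_flat {α β : Type} {n w : ℕ} (g : α → β) (f : Fin n × Fin w → α) :
    (flat f).map g = flat fun p => g (f p) := by
  simp [flat, List.map_flatten, List.map_ofFn, Function.comp_def]

section game

variable {n w l : ℕ}

/-- The bits of the `j`-th block of a query. -/
def queryBlock (l j : ℕ) (q : List Bool) : Fin l → Bool := fun k => q.getD (k + l * j) false

def specOracle (R : Fin n × Fin w → PairSpec l) : Oracle := fun i q =>
  if hi : i < n then List.ofFn fun j => (R (⟨i, hi⟩, j)).fn (queryBlock l j q) else []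

def specMarks (R : Fin n × Fin w → PairSpec l) : List Bool :=
  encList (encList encStr) (List.ofFn fun i => List.ofFn fun j => (R (i, j)).mark)

/-- The probability that the answers are correct, for the state `φ` of the adversary. -/
def specFinal (C : Circuit) (R : Fin n × Fin w → PairSpec l) (φ : Ket) : ℝ :=
  listProb (C.apply (flipKet (flat fun p => List.ofFn (R p).point).flatten φ))
    (flat fun p => (R p).ans)

/-- The probability of winning the game with given keys. -/
def game (pre post : Code) (C : Circuit) (ψ : Ket) (R : Fin n × Fin w → PairSpec l) : ℝ :=
  pre.val (specOracle R) (fun σ => post.val (specOracle R) (fun σ' => specFinal C R σ'.ket)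
    (σ.set 0 (specMarks R))) ⟨fun _ => [], ψ⟩

theorem listProb_mem {φ : Ket} (hφ : φ.L2) (bits : List Bool) :
    0 ≤ listProb φ bits ∧ listProb φ bits ≤ normSq φ := by
  classical
  unfold listProb normSq
  have h0 : ∀ B, (0 : ℝ) ≤ if ∀ q < bits.length, decide (q ∈ B) = bits.getD q false
      then ‖φ B‖ ^ 2 else 0 := fun B => by split_ifs <;> positivity
  have h1 : ∀ B, (if ∀ q < bits.length, decide (q ∈ B) = bits.getD q false
      then ‖φ B‖ ^ 2 else 0) ≤ ‖φ B‖ ^ 2 := fun B => by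
    split_ifs
    · exact le_rfl
    · positivity
  constructor
  · refine tsum_nonneg fun B => ?_
    convert h0 B
  · refine Summable.tsum_le_tsum (fun B => ?_) (.of_nonneg_of_le (fun B => ?_) (fun B => ?_) hφ) hφ
    · convert h1 B
    · convert h0 B
    · convert h1 B

theorem specFinal_subProb (C : Circuit) (R : Fin n × Fin w → PairSpec l) :
    SubProb fun σ => specFinal C R σ.ket := fun σ hσ => by
  obtain ⟨h1, h2⟩ := flipKet_normSq (flat fun p => List.ofFn (R p).point).flatten hσ
  obtain ⟨h3, h4⟩ := C.normSq_apply h1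
  have := listProb_mem h3 (flat fun p => (R p).ans)
  rwa [h4, h2] at this

variable {pre post : Code} {C : Circuit} {ψ : Ket}

theorem game_mem (hψ : ψ.L2) (h1 : normSq ψ = 1) (R : Fin n × Fin w → PairSpec l) :
    0 ≤ game pre post C ψ R ∧ game pre post C ψ R ≤ 1 := by
  have := (((specFinal_subProb C R).val (specOracle R) post).set 0 (specMarks R)).val
    (specOracle R) pre ⟨fun _ => [], ψ⟩ hψ
  rwa [h1] at this

theorem specOracle_congr {R R' : Fin n × Fin w → PairSpec l} {p : Fin n × Fin w}
    {x : Fin l → Bool} (h : ∀ p', p' ≠ p → (R' p').fn = (R p').fn)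
    (hp : ∀ y, y ≠ x → (R' p).fn y = (R p).fn y) (i : ℕ) (q : List Bool)
    (hq : ¬ (i = p.1 ∧ queryBlock l p.2 q = x)) : specOracle R' i q = specOracle R i q := by
  unfold specOracle
  split_ifs with hi
  · congr 1
    funext j
    by_cases hj : ((⟨i, hi⟩ : Fin n), j) = p
    · rw [hj]
      refine hp _ fun hy => hq ⟨?_, ?_⟩
      · rw [← hj]
      · rw [← hy, ← hj]
    · rw [h _ hj]
  · rfl

/-- A single value of the function in the oracle is hidden from the adversary. -/
theorem sum_abs_game_sub_le (hψ : ψ.L2) (h1 : normSq ψ = 1) (p : Fin n × Fin w)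
    (R R' : (Fin l → Bool) → Fin n × Fin w → PairSpec l)
    (hmark : ∀ x x' p', (R x p').mark = (R x' p').mark)
    (hfn : ∀ x x' p', (R x p').fn = (R x' p').fn)
    (hmark' : ∀ x p', (R' x p').mark = (R x p').mark)
    (hpoint : ∀ x p', (R' x p').point = (R x p').point)
    (hans : ∀ x p', (R' x p').ans = (R x p').ans)
    (h : ∀ x p', p' ≠ p → (R' x p').fn = (R x p').fn)
    (hp : ∀ x y, y ≠ x → (R' x p).fn y = (R x p).fn y) :
    ∑ x, |game pre post C ψ (R' x) - game pre post C ψ (R x)| ≤ pre.size + post.size := by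
  set x₀ : Fin l → Bool := fun _ => false
  set O := specOracle (R x₀) with hO
  set M := specMarks (R x₀) with hM
  have hOx : ∀ x, specOracle (R x) = O := fun x => by
    rw [hO]; unfold specOracle; simp only [hfn x x₀]
  have hMx : ∀ x, specMarks (R x) = M := fun x => by
    rw [hM]; unfold specMarks; simp only [hmark x x₀]
  have hMx' : ∀ x, specMarks (R' x) = M := fun x => by
    rw [← hMx x]; unfold specMarks; simp only [hmark' x]
  have hfin : ∀ x, specFinal C (R' x) = specFinal C (R x) := fun x => by
    funext φ; unfold specFinal; simp only [hpoint x, hans x]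
  -- Oracle and marked keys of `R x` do not depend on `x`. So the hits are counted in one and the
  -- same run for all `x`, where the events are disjoint. Challenge and expected answer may depend
  -- on `x`, as they appear only when no more queries can be made.
  set E : (Fin l → Bool) → ℕ → List Bool → Prop := fun x i q =>
    i = p.1 ∧ queryBlock l p.2 q = x with hE
  have hE1 : ∀ x i q, ¬ E x i q → specOracle (R' x) i q = O i q := fun x i q hq => by
    rw [← hOx x]
    exact specOracle_congr (h x) (hp x) i q hq
  have hE2 : ∀ i q x x', E x i q → E x' i q → x = x' := fun i q x x' hx hx' =>
    hx.2.symm.trans hx'.2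
  have key : ∀ x, |game pre post C ψ (R' x) - game pre post C ψ (R x)| ≤
      pre.hits O (E x) ⟨fun _ => [], ψ⟩ +
        pre.val O (fun σ => post.hits O (E x) (σ.set 0 M)) ⟨fun _ => [], ψ⟩ := by
    intro x
    have hs := specFinal_subProb C (R x)
    have e1 := pre.abs_val_sub_le (hE1 x) ((hs.val (specOracle (R' x)) post).set 0 M)
      (σ := ⟨fun _ => [], ψ⟩) hψ
    have e2 : |pre.val O (fun σ => post.val (specOracle (R' x)) (fun σ => specFinal C (R x) σ.ket)
        (σ.set 0 M) - post.val O (fun σ => specFinal C (R x) σ.ket) (σ.set 0 M)) ⟨fun _ => [], ψ⟩| ≤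
        pre.val O (fun σ => post.hits O (E x) (σ.set 0 M)) ⟨fun _ => [], ψ⟩ :=
      Code.abs_val_le hψ fun σ hσ => post.abs_val_sub_le (hE1 x) hs hσ
    rw [Code.val_sub] at e2
    unfold game
    rw [hOx, hMx, hMx', hfin]
    refine (abs_sub_le _ _ _).trans (add_le_add e1 e2)
  refine (Finset.sum_le_sum fun x _ => key x).trans ?_
  rw [Finset.sum_add_distrib, Code.val_sum]
  refine add_le_add ?_ ?_
  · have := pre.sum_hits_le O (E := E) hE2 (σ := ⟨fun _ => [], ψ⟩) hψ
    rwa [h1, mul_one] at this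
  · have e1 : pre.val O (fun σ => ∑ x, post.hits O (E x) (σ.set 0 M)) ⟨fun _ => [], ψ⟩ ≤
        pre.val O (fun σ => post.size * normSq σ.ket) ⟨fun _ => [], ψ⟩ :=
      Code.val_le hψ fun σ hσ => post.sum_hits_le O hE2 (σ := σ.set 0 M) hσ
    rw [Code.val_const_mul, (pre.normSq_den O (σ := ⟨fun _ => [], ψ⟩) hψ).2, h1, mul_one] at e1
    exact e1

end game

end WMark
end

noncomputable section

namespace WMark

/-! ### The hybrid argument -/

section hybrid

variable {ι Z : Type} [Fintype ι] [DecidableEq ι]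

theorem prod_update_mul (ρ : Z → ℝ) (z : ι → Z) (p : ι) (t : Z) :
    (∏ q, ρ (Function.update z p t q)) * ρ (z p) = (∏ q, ρ (z q)) * ρ t := by
  rw [← Finset.mul_prod_erase _ _ (Finset.mem_univ p),
    ← Finset.mul_prod_erase _ (fun q => ρ (z q)) (Finset.mem_univ p), Function.update_self,
    Finset.prod_congr rfl fun q hq => by rw [Function.update_of_ne (Finset.ne_of_mem_erase hq)]]
  ring

variable [Fintype Z]

/-- One of several independent samples can be drawn last. -/
theorem sum_prod_resample (ρ : Z → ℝ) (hρ : ∑ t, ρ t = 1) (p : ι) (Φ : (ι → Z) → ℝ) :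
    ∑ z : ι → Z, (∏ q, ρ (z q)) * Φ z =
      ∑ z : ι → Z, (∏ q, ρ (z q)) * ∑ t, ρ t * Φ (Function.update z p t) := by
  -- The sample at `p` is exchanged with the fresh one; by `prod_update_mul` the joint weight is
  -- invariant under this involution.
  have hinv : Function.Involutive
      fun x : (ι → Z) × Z => ((Function.update x.1 p x.2, x.1 p) : (ι → Z) × Z) := fun x => by
    simp
  have h := Equiv.sum_comp hinv.toPerm fun x : (ι → Z) × Z => (∏ q, ρ (x.1 q)) * ρ x.2 * Φ x.1
  simp only [Function.Involutive.coe_toPerm, prod_update_mul, Fintype.sum_prod_type] at h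
  simp only [Finset.mul_sum, ← mul_assoc, h]
  simp only [← Finset.sum_mul, ← Finset.mul_sum, hρ, mul_one]

/-- If the specification of any one of several independent objects can be changed from `pre` to `ext`
at cost `η`, then all of them can be changed. -/
theorem hybrid_le {β : Type} (ρ : Z → ℝ) (hρ0 : ∀ t, 0 ≤ ρ t) (hρ : ∑ t, ρ t = 1) (pre ext : Z → β)
    (G : (ι → β) → ℝ) (η : ℝ)
    (hstep : ∀ (z : ι → Z) (D : ι → Bool) (p : ι),
      ∑ t, ρ t * G (Function.update (fun q => if D q then ext (z q) else pre (z q)) p (pre t)) ≤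
      ∑ t, ρ t * G (Function.update (fun q => if D q then ext (z q) else pre (z q)) p (ext t)) + η) :
    ∑ z : ι → Z, (∏ q, ρ (z q)) * G (fun q => pre (z q)) ≤
      ∑ z : ι → Z, (∏ q, ρ (z q)) * G (fun q => ext (z q)) + Fintype.card ι * η := by
  set H : (ι → Bool) → ℝ := fun D =>
    ∑ z : ι → Z, (∏ q, ρ (z q)) * G (fun q => if D q then ext (z q) else pre (z q)) with hH
  have hw : ∑ z : ι → Z, ∏ q, ρ (z q) = 1 := by
    rw [← Fintype.prod_sum, Finset.prod_eq_one fun _ _ => hρ]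
  -- Switching the single position `p`: its sample is drawn last, and `hstep` is applied with all
  -- other samples fixed.
  have hone : ∀ (D : ι → Bool) (p : ι), D p = false → H D ≤ H (Function.update D p true) + η := by
    intro D p hp
    have hr : ∀ D' : ι → Bool, H D' = ∑ z : ι → Z, (∏ q, ρ (z q)) * ∑ t, ρ t *
        G (Function.update (fun q => if D' q then ext (z q) else pre (z q)) p
          (if D' p then ext t else pre t)) := by
      intro D'
      rw [hH]
      beta_reduce
      rw [sum_prod_resample ρ hρ p]
      refine Finset.sum_congr rfl fun z _ => ?_
      congr 1
      refine Finset.sum_congr rfl fun t _ => ?_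
      congr 2
      funext q
      by_cases hq : q = p
      · subst hq; simp
      · simp [Function.update_of_ne hq]
    rw [hr, hr]
    have hD : ∀ z : ι → Z, ∀ b, Function.update (fun q => if Function.update D p true q
        then ext (z q) else pre (z q)) p b =
        Function.update (fun q => if D q then ext (z q) else pre (z q)) p b := by
      intro z b
      funext q
      by_cases hq : q = p
      · subst hq; simp
      · simp [Function.update_of_ne hq]
    simp only [hD, Function.update_self, hp, if_true, Bool.false_eq_true, if_false]
    rw [← mul_one η, ← hw, mul_comm η, Finset.sum_mul, ← Finset.sum_add_distrib]
    refine Finset.sum_le_sum fun z _ => ?_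
    rw [← mul_add]
    exact mul_le_mul_of_nonneg_left (hstep z D p) (Finset.prod_nonneg fun _ _ => hρ0 _)
  have hall : ∀ s : Finset ι, H (fun _ => false) ≤ H (fun q => decide (q ∈ s)) + s.card * η := by
    intro s
    induction s using Finset.induction_on with
    | empty => simp
    | insert p s hp ih =>
      refine ih.trans ?_
      have h1 := hone (fun q => decide (q ∈ s)) p (by simpa using hp)
      have h2 : Function.update (fun q => decide (q ∈ s)) p true =
          fun q => decide (q ∈ insert p s) := by
        funext q
        by_cases hq : q = p
        · subst hq; simp
        · simp [hq]
      rw [h2] at h1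
      rw [Finset.card_insert_of_notMem hp]
      push_cast
      linarith
  simpa [hH] using hall Finset.univ

end hybrid

/-! ### A single instance -/

section step

variable {l : ℕ} {K : Type}

/-- The data of an instance: the differing point, the challenge, the bit that tells which key is
given as marked key, and the keys. -/
abbrev Sample (l : ℕ) (K : Type) := (Fin l → Bool) × (Fin l → Bool) × Bool × K

/-- The specification of an instance in the prediction experiment. -/
def preSpec (v : List Bool → List Bool → Bool) (key : K → Bool → List Bool) (z : Sample l K) :
    PairSpec l where
  fn x := v (key z.2.2.2 false) (List.ofFn x)
  mark := key z.2.2.2 z.2.2.1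
  point := z.2.1
  ans := v (key z.2.2.2 false) (List.ofFn z.2.1)

/-- The specification of an instance in the extraction experiment. -/
def extSpec (v : List Bool → List Bool → Bool) (key : K → Bool → List Bool) (z : Sample l K) :
    PairSpec l where
  fn x := v (key z.2.2.2 false) (List.ofFn x)
  mark := key z.2.2.2 z.2.2.1
  point := z.1
  ans := v (key z.2.2.2 z.2.2.1) (List.ofFn z.1)

/-- The specification of an instance with the same key in all places, the value of the oracle being
flipped at a point. -/
def flipSpec (v : List Bool → List Bool → Bool) (f : Option (Fin l → Bool)) (h : Fin l → Bool)
    (k : List Bool) : PairSpec l where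
  fn x := xor (v k (List.ofFn x)) (decide (f = some x))
  mark := k
  point := h
  ans := v k (List.ofFn h)

variable {v : List Bool → List Bool → Bool} {key : K → Bool → List Bool}

/-- The oracle always evaluates the key with index `false`. If the marked key is the other one, this
is the marked key's function with the value flipped at the differing point. So the key that is given
away determines the whole instance, up to this point. -/
theorem extSpec_eq {s h : Fin l → Bool} {b : Bool} {k : K}
    (hk : ∀ x : Fin l → Bool, v (key k true) (List.ofFn x) =
      xor (v (key k false) (List.ofFn x)) (decide (x = s))) :
    extSpec v key (s, h, b, k) = flipSpec v (if b then some s else none) s (key k b) := by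
  cases b
  · simp [extSpec, flipSpec]
  · simp only [extSpec, flipSpec, if_true, PairSpec.mk.injEq, and_true]
    funext x
    simp [hk, eq_comm (a := s)]

/-- As for `extSpec_eq`. Away from the differing point both keys agree, so the expected answer,
defined by the key with index `false`, is also a value of the marked key. -/
theorem preSpec_eq {s h : Fin l → Bool} {b : Bool} {k : K}
    (hk : ∀ x : Fin l → Bool, v (key k true) (List.ofFn x) =
      xor (v (key k false) (List.ofFn x)) (decide (x = s))) (hs : h ≠ s) :
    preSpec v key (s, h, b, k) = flipSpec v (if b then some s else none) h (key k b) := by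
  cases b
  · simp [preSpec, flipSpec]
  · simp only [preSpec, flipSpec, if_true, PairSpec.mk.injEq, hk h, hs, decide_false,
      Bool.xor_false, and_true]
    funext x
    simp [hk, eq_comm (a := s)]

variable {μ : (Fin l → Bool) → K → ℝ} {g : PairSpec l → ℝ} {δ Q : ℝ}

/-- The weight of a sample. -/
def sampleWeight (μ : (Fin l → Bool) → K → ℝ) (z : Sample l K) : ℝ :=
  (2 ^ l : ℝ)⁻¹ * ((2 ^ l : ℝ)⁻¹ * (2⁻¹ * μ z.1 z.2.2.2))

theorem sampleWeight_nonneg (hμ : ∀ s k, 0 ≤ μ s k) (z : Sample l K) : 0 ≤ sampleWeight μ z :=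
  mul_nonneg (by positivity) (mul_nonneg (by positivity) (mul_nonneg (by positivity) (hμ _ _)))

variable [Fintype K]

theorem sum_sampleWeight_mul (f : Sample l K → ℝ) :
    ∑ z, sampleWeight μ z * f z = 2⁻¹ * ∑ b, (2 ^ l : ℝ)⁻¹ * ∑ s, (2 ^ l : ℝ)⁻¹ * ∑ h,
      ∑ k, μ s k * f (s, h, b, k) := by
  simp only [Fintype.sum_prod_type, sampleWeight, Finset.mul_sum]
  simp only [Finset.sum_comm (s := (Finset.univ : Finset Bool))
    (t := (Finset.univ : Finset (Fin l → Bool)))]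
  refine Finset.sum_congr rfl fun s _ => Finset.sum_congr rfl fun h _ =>
    Finset.sum_congr rfl fun b _ => Finset.sum_congr rfl fun k _ => by ring

theorem sum_const_div (c : ℝ) : (2 ^ l : ℝ)⁻¹ * ∑ _s : Fin l → Bool, c = c := by
  simp

theorem sum_sampleWeight (hμ1 : ∀ s, ∑ k, μ s k = 1) : ∑ z, sampleWeight μ z = 1 := by
  have := sum_sampleWeight_mul (μ := μ) fun _ => 1
  simp only [mul_one, hμ1, sum_const_div] at this
  rw [this]
  simp

/-- For a single instance the prediction experiment can be replaced by the extraction experiment. -/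
theorem sum_preSpec_le (hμ : ∀ s k, 0 ≤ μ s k) (hμ1 : ∀ s, ∑ k, μ s k = 1)
    (hg : ∀ r, 0 ≤ g r ∧ g r ≤ 1)
    (hk : ∀ s k, μ s k ≠ 0 → ∀ x : Fin l → Bool, v (key k true) (List.ofFn x) =
      xor (v (key k false) (List.ofFn x)) (decide (x = s)))
    (hhide : ∀ (s s' h : Fin l → Bool) f (b : Bool),
      |∑ k, μ s k * g (flipSpec v f h (key k b)) - ∑ k, μ s' k * g (flipSpec v f h (key k b))| ≤ δ)
    (hstat : ∀ (h : (Fin l → Bool) → Fin l → Bool) (k : List Bool),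
      ∑ s, |g (flipSpec v (some s) (h s) k) - g (flipSpec v none (h s) k)| ≤ Q) :
    ∑ z, sampleWeight μ z * g (preSpec v key z) ≤
      ∑ z, sampleWeight μ z * g (extSpec v key z) + (2 * δ + (2 * Q + 1) * (2 ^ l : ℝ)⁻¹) := by
  set N : ℝ := (2 ^ l : ℝ)⁻¹ with hN
  have hN0 : 0 ≤ N := by positivity
  have hQ0 : 0 ≤ Q := (Finset.sum_nonneg fun _ _ => abs_nonneg _).trans (hstat (fun s => s) [])
  set s₀ : Fin l → Bool := fun _ => false
  -- The common middle of both experiments: a key generated for the arbitrary point `s₀`, an oracle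
  -- without flip, and challenge `h`. Averaged over `h`, it is reached from the prediction side and
  -- from the extraction side.
  set m : Bool → (Fin l → Bool) → ℝ := fun b h => ∑ k, μ s₀ k * g (flipSpec v none h (key k b))
    with hm
  -- Removing the flip, once the key is independent of `s`. The challenge may depend on `s`: a
  -- constant is used for prediction, `s` itself for extraction.
  have hstat' : ∀ b (h : (Fin l → Bool) → Fin l → Bool),
      |N * ∑ s, ∑ k, μ s₀ k * g (flipSpec v (if b then some s else none) (h s) (key k b)) -
        N * ∑ s, m b (h s)| ≤ N * Q := by
    intro b h
    rw [← mul_sub, abs_mul, abs_of_nonneg hN0, ← Finset.sum_sub_distrib]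
    refine mul_le_mul_of_nonneg_left ?_ hN0
    cases b
    · simpa [hm] using hQ0
    · simp only [if_true, hm, ← Finset.sum_sub_distrib, ← mul_sub]
      refine (Finset.abs_sum_le_sum_abs _ _).trans ?_
      refine (Finset.sum_le_sum fun s _ => Finset.abs_sum_le_sum_abs _ _).trans ?_
      rw [Finset.sum_comm]
      simp only [abs_mul, abs_of_nonneg (hμ _ _), ← Finset.mul_sum]
      calc _ ≤ ∑ k, μ s₀ k * Q :=
            Finset.sum_le_sum fun k _ => mul_le_mul_of_nonneg_left (hstat h _) (hμ _ _)
        _ = Q := by rw [← Finset.sum_mul, hμ1, one_mul]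
  -- Prediction to the middle: `δ` for making the key independent of `s`, `N * Q` for the flip, and
  -- `N` for the event `h = s`, in which the expected answer may differ from the value of the marked
  -- key.
  have hpre : ∀ b, N * ∑ s, N * ∑ h, ∑ k, μ s k * g (preSpec v key (s, h, b, k)) ≤
      N * ∑ h, m b h + δ + N * Q + N := by
    intro b
    have h1 : ∀ s h, ∑ k, μ s k * g (preSpec v key (s, h, b, k)) ≤
        ∑ k, μ s₀ k * g (flipSpec v (if b then some s else none) h (key k b)) + δ +
          if h = s then 1 else 0 := by
      intro s h
      have e1 := (abs_le.1 (hhide s s₀ h (if b then some s else none) b)).2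
      have e2 : ∑ k, μ s k * g (preSpec v key (s, h, b, k)) ≤
          ∑ k, μ s k * g (flipSpec v (if b then some s else none) h (key k b)) +
            if h = s then 1 else 0 := by
        by_cases hs : h = s
        · rw [if_pos hs]
          refine (Finset.sum_le_sum fun k _ => mul_le_mul_of_nonneg_left (hg _).2 (hμ s k)).trans ?_
          simp only [mul_one, hμ1]
          have : 0 ≤ ∑ k, μ s k * g (flipSpec v (if b then some s else none) h (key k b)) :=
            Finset.sum_nonneg fun k _ => mul_nonneg (hμ s k) (hg _).1
          linarith
        · rw [if_neg hs, add_zero]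
          refine Finset.sum_le_sum fun k _ => ?_
          by_cases h0 : μ s k = 0
          · simp [h0]
          · rw [preSpec_eq (hk s k h0) hs]
      linarith
    have h2 : N * ∑ s, N * ∑ h, ∑ k, μ s k * g (preSpec v key (s, h, b, k)) ≤
        N * ∑ s, N * ∑ h, (∑ k, μ s₀ k * g (flipSpec v (if b then some s else none) h (key k b)) +
          δ + if h = s then 1 else 0) := by
      gcongr with s _ h _
      exact h1 s h
    have h3 : N * ∑ s, N * ∑ h, (∑ k, μ s₀ k * g (flipSpec v (if b then some s else none) h
        (key k b)) + δ + if h = s then 1 else 0) =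
        N * ∑ h, (N * ∑ s, ∑ k, μ s₀ k * g (flipSpec v (if b then some s else none) h (key k b))) +
          δ + N := by
      simp only [Finset.sum_add_distrib, mul_add, Finset.sum_ite_eq', Finset.mem_univ, if_true]
      rw [hN, sum_const_div, sum_const_div, sum_const_div]
      simp only [Finset.mul_sum]
      rw [Finset.sum_comm, mul_one]
    have h4 : ∀ h, N * ∑ s, ∑ k, μ s₀ k * g (flipSpec v (if b then some s else none) h (key k b)) ≤
        m b h + N * Q := by
      intro h
      have := (abs_le.1 (hstat' b fun _ => h)).2
      rw [hN, sum_const_div, ← hN] at this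
      linarith
    have h5 : N * ∑ h, (N * ∑ s, ∑ k, μ s₀ k * g (flipSpec v (if b then some s else none) h
        (key k b))) ≤ N * ∑ h, m b h + N * Q := by
      refine (mul_le_mul_of_nonneg_left (Finset.sum_le_sum fun h _ => h4 h) hN0).trans_eq ?_
      rw [Finset.sum_add_distrib, mul_add]
      congr 1
      rw [hN, sum_const_div]
    linarith
  -- Middle to extraction. There is no collision term, because here the answer is checked against
  -- the marked key in any case.
  have hext : ∀ b, N * ∑ h, m b h - δ - N * Q ≤
      N * ∑ s, N * ∑ h, ∑ k, μ s k * g (extSpec v key (s, h, b, k)) := by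
    intro b
    have h1 : ∀ s h, ∑ k, μ s k * g (extSpec v key (s, h, b, k)) =
        ∑ k, μ s k * g (flipSpec v (if b then some s else none) s (key k b)) := by
      intro s h
      refine Finset.sum_congr rfl fun k _ => ?_
      by_cases h0 : μ s k = 0
      · simp [h0]
      · rw [extSpec_eq (hk s k h0)]
    simp only [h1]
    simp only [hN, sum_const_div]
    rw [← hN]
    -- The challenge is the point of the flip. After the flip has been removed it is just a uniform
    -- point, as in the prediction experiment.
    have h2 := (abs_le.1 (hstat' b fun s => s)).1
    have h3 : N * ∑ s, (∑ k, μ s₀ k * g (flipSpec v (if b then some s else none) s (key k b)) - δ) ≤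
        N * ∑ s, ∑ k, μ s k * g (flipSpec v (if b then some s else none) s (key k b)) := by
      refine mul_le_mul_of_nonneg_left (Finset.sum_le_sum fun s _ => ?_) hN0
      have := (abs_le.1 (hhide s s₀ s (if b then some s else none) b)).1
      linarith
    rw [Finset.sum_sub_distrib, mul_sub, hN, sum_const_div, ← hN] at h3
    linarith
  rw [sum_sampleWeight_mul, sum_sampleWeight_mul, Fintype.sum_bool, Fintype.sum_bool]
  have a1 := hpre true
  have a2 := hpre false
  have a3 := hext true
  have a4 := hext false
  linarith

end step

end WMark
end

noncomputable section

namespace WMark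

open scoped ENNReal

/-! ### Finite representations of distributions -/

open Classical in
/-- The distribution `p` is the image under `φ` of weights `r` on a finite type. -/
def Rep {Y α : Type} [Fintype Y] (p : PMF α) (r : Y → ℝ≥0∞) (φ : Y → α) : Prop :=
  ∀ a, p a = ∑ y, if φ y = a then r y else 0

section Rep

variable {Y Y' α β : Type} [Fintype Y] [Fintype Y'] {p : PMF α} {r : Y → ℝ≥0∞} {φ : Y → α}

theorem Rep.ne_top (h : Rep p r φ) (y : Y) : r y ≠ ⊤ := by
  classical
  refine ne_top_of_le_ne_top (p.apply_ne_top (φ y)) ?_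
  rw [h]
  refine le_trans ?_ (Finset.single_le_sum (fun _ _ => zero_le) (Finset.mem_univ y))
  simp

/-- The map `φ` need not be injective: the sum over each fibre gives the probability of its image,
and outside the image the distribution vanishes. -/
theorem Rep.expect (h : Rep p r φ) (f : α → ℝ) : expect p f = ∑ y, (r y).toReal * f (φ y) := by
  classical
  unfold WMark.expect
  have h1 : ∀ a, (p a).toReal * f a = ∑ y, if φ y = a then (r y).toReal * f (φ y) else 0 := by
    intro a
    rw [h, ENNReal.toReal_sum fun y _ => by split_ifs <;> simp [h.ne_top y], Finset.sum_mul]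
    refine Finset.sum_congr rfl fun y _ => ?_
    split_ifs with hy
    · rw [hy]
    · simp
  rw [tsum_eq_sum (s := Finset.univ.image φ)]
  · simp only [h1]
    rw [Finset.sum_comm]
    refine Finset.sum_congr rfl fun y _ => ?_
    rw [Finset.sum_ite_eq, if_pos (Finset.mem_image_of_mem _ (Finset.mem_univ _))]
  · intro a ha
    rw [h1]
    refine Finset.sum_eq_zero fun y _ => if_neg fun hy => ha ?_
    rw [← hy]
    exact Finset.mem_image_of_mem _ (Finset.mem_univ _)

theorem Rep.bind (h : Rep p r φ) {g : α → PMF β} {r' : Y → Y' → ℝ≥0∞} {φ' : Y → Y' → β}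
    (h' : ∀ y, Rep (g (φ y)) (r' y) (φ' y)) :
    Rep (p.bind g) (fun z : Y × Y' => r z.1 * r' z.1 z.2) fun z => φ' z.1 z.2 := by
  classical
  intro b
  rw [PMF.bind_apply]
  have h1 : ∀ a, p a * g a b = ∑ y, if φ y = a then r y * g (φ y) b else 0 := by
    intro a
    rw [h, Finset.sum_mul]
    refine Finset.sum_congr rfl fun y _ => ?_
    split_ifs with hy
    · rw [hy]
    · simp
  simp only [h1]
  rw [Summable.tsum_finsetSum fun _ _ => ENNReal.summable, Fintype.sum_prod_type]
  refine Finset.sum_congr rfl fun y _ => ?_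
  rw [tsum_eq_single (φ y) fun a ha => if_neg fun hy => ha hy.symm, if_pos rfl, h' y,
    Finset.mul_sum]
  simp

theorem Rep.pure (a : α) : Rep (PMF.pure a) (fun _ : Unit => 1) fun _ => a := by
  classical
  intro b
  simp [PMF.pure_apply, eq_comm]

theorem Rep.equiv (h : Rep p r φ) (e : Y' ≃ Y) : Rep p (fun y => r (e y)) fun y => φ (e y) := by
  classical
  intro a
  rw [h, ← Equiv.sum_comp e]

theorem Rep.map (h : Rep p r φ) (g : α → β) :
    Rep (p.bind fun a => PMF.pure (g a)) r fun y => g (φ y) := by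
  have := (h.bind (g := fun a => PMF.pure (g a)) fun y => Rep.pure (g (φ y))).equiv (Equiv.prodUnique Y Unit).symm
  simpa using this

theorem Rep.uniform [Nonempty Y] :
    Rep (PMF.uniformOfFintype Y) (fun _ => (Fintype.card Y : ℝ≥0∞)⁻¹) id := by
  classical
  intro a
  simp

theorem Rep.indep : ∀ {n : ℕ} {p : Fin n → PMF α} {r : Fin n → Y → ℝ≥0∞} {φ : Fin n → Y → α},
    (∀ i, Rep (p i) (r i) (φ i)) →
    Rep (WMark.indep n p) (fun y : Fin n → Y => ∏ i, r i (y i)) fun y i => φ i (y i)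
  | 0, p, r, φ, _ => by
    classical
    intro a
    simp [WMark.indep, PMF.pure_apply,
      Subsingleton.elim (fun i : Fin 0 => _) Fin.elim0]
  | n + 1, p, r, φ, h => by
    have ih := Rep.indep fun i : Fin n => h i.succ
    have h1 := (h 0).bind (g := fun a => (WMark.indep n fun i => p i.succ).bind fun f =>
      PMF.pure (Fin.cons a f : Fin (n + 1) → α))
      fun y => ih.map fun f => (Fin.cons (φ 0 y) f : Fin (n + 1) → α)
    have h2 := h1.equiv (Fin.consEquiv fun _ : Fin (n + 1) => Y).symm
    unfold WMark.indep
    convert h2 using 1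
    · funext y
      rw [Fin.prod_univ_succ]
      rfl
    · funext y i
      refine Fin.cases ?_ (fun i => ?_) i
      · rfl
      · rfl

end Rep

/-! ### Keys of bounded length -/

/-- Strings of length at most `L`. -/
abbrev Str (L : ℕ) := {x : List Bool // x.length ≤ L}

instance (L : ℕ) : Fintype (Str L) := @Fintype.ofFinite _ (List.finite_length_le Bool L)

/-- Pairs of keys of length at most `L`. -/
abbrev KeyPair (L : ℕ) := Str L × Str L

def KeyPair.key {L : ℕ} (k : KeyPair L) (b : Bool) : List Bool := if b then k.2.1 else k.1.1

variable {ℓ : ℕ → ℕ} (F : TEPRF ℓ)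

def TEPRF.Bounded (L : ℕ → ℕ) : Prop := ∀ κ s, ∀ key ∈ (F.KG κ s).support,
  key.1.length ≤ L κ ∧ key.2.length ≤ L κ

/-- A key of positive probability is left in a register by some branch of key generation, and
registers grow by at most one bit per step. The bound makes the set of keys finite and lets keys be
hard-wired into polynomial-size programs. -/
theorem TEPRF.exists_bounded (hℓ : PolyBounded ℓ) : ∃ L, PolyBounded L ∧ F.Bounded L := by
  obtain ⟨a, T, -, h⟩ := F.kg_ppt
  refine ⟨fun κ => κ + ℓ κ + T.eval (κ + ℓ κ),
    (PolyBounded.id.add hℓ).add (.eval T (PolyBounded.id.add hℓ)), ?_⟩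
  intro κ s key hkey
  obtain ⟨-, h2⟩ := h κ s
  have h3 : (F.KG κ s key).toReal ≠ 0 :=
    ENNReal.toReal_ne_zero.2 ⟨(PMF.mem_support_iff _ _).1 hkey, PMF.apply_ne_top _ _⟩
  rw [h2] at h3
  have h4 : ∃ σ ∈ exec noOracle (T.eval (κ + ℓ κ)) a
      (inputState (List.replicate κ true) (List.ofFn s) zeroKet),
      σ.reg 0 = key.1 ∧ σ.reg 1 = key.2 := by
    by_contra hc
    push Not at hc
    refine h3 (weight_eq_zero fun σ hσ hE => hc σ hσ hE.1 hE.2)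
  obtain ⟨σ, hσ, h5, h6⟩ := h4
  have h7 := length_exec_le hσ 0
  have h8 := length_exec_le hσ 1
  rw [h5] at h7
  rw [h6] at h8
  simp only [inputState, if_true, one_ne_zero, if_false, List.length_replicate,
    List.length_ofFn] at h7 h8
  exact ⟨h7.trans (by dsimp only; omega), h8.trans (by dsimp only; omega)⟩

/-- The probability that key generation yields a pair of keys. -/
def TEPRF.keyWeight (L : ℕ) (κ : ℕ) (s : Fin (ℓ κ) → Bool) (k : KeyPair L) : ℝ :=
  (F.KG κ s (k.1.1, k.2.1)).toReal

variable {F} {L : ℕ → ℕ}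

theorem TEPRF.Bounded.rep (hL : F.Bounded L) (κ : ℕ) (s : Fin (ℓ κ) → Bool) :
    Rep (F.KG κ s) (fun k : KeyPair (L κ) => F.KG κ s (k.1.1, k.2.1))
      fun k => (k.1.1, k.2.1) := by
  classical
  intro key
  by_cases hkey : key ∈ (F.KG κ s).support
  · obtain ⟨h1, h2⟩ := hL κ s key hkey
    rw [Finset.sum_eq_single (⟨⟨key.1, h1⟩, ⟨key.2, h2⟩⟩ : KeyPair (L κ))]
    · simp
    · rintro ⟨⟨a, ha⟩, ⟨b, hb⟩⟩ - hne
      refine if_neg fun h => hne ?_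
      subst h
      rfl
    · simp
  · rw [PMF.mem_support_iff, not_not] at hkey
    rw [hkey]
    refine (Finset.sum_eq_zero fun k _ => ?_).symm
    split_ifs with h
    · exact (congrArg (F.KG κ s) h).trans hkey
    · rfl

theorem TEPRF.Bounded.expect (hL : F.Bounded L) (κ : ℕ) (s : Fin (ℓ κ) → Bool)
    (f : List Bool × List Bool → ℝ) :
    WMark.expect (F.KG κ s) f = ∑ k : KeyPair (L κ), F.keyWeight (L κ) κ s k * f (k.1.1, k.2.1) :=
  (hL.rep κ s).expect f

theorem TEPRF.keyWeight_nonneg (κ : ℕ) (s : Fin (ℓ κ) → Bool) (k : KeyPair (L κ)) :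
    0 ≤ F.keyWeight (L κ) κ s k := ENNReal.toReal_nonneg

theorem TEPRF.Bounded.sum_keyWeight (hL : F.Bounded L) (κ : ℕ) (s : Fin (ℓ κ) → Bool) :
    ∑ k, F.keyWeight (L κ) κ s k = 1 := by
  have h := hL.expect κ s fun _ => 1
  simp only [mul_one] at h
  rw [← h]
  unfold WMark.expect
  simp only [mul_one]
  rw [← ENNReal.tsum_toReal_eq fun a => PMF.apply_ne_top _ _, PMF.tsum_coe, ENNReal.toReal_one]

/-- The relation between the values under the two keys. -/
theorem TEPRF.eval_true (hdiff : F.DifferentValuesOnTarget) {κ : ℕ} {s : Fin (ℓ κ) → Bool}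
    {k : KeyPair (L κ)} (hk : F.keyWeight (L κ) κ s k ≠ 0) (x : Fin (ℓ κ) → Bool) :
    F.Eval (k.key true) (List.ofFn x) =
      xor (F.Eval (k.key false) (List.ofFn x)) (decide (x = s)) := by
  have h1 : (k.1.1, k.2.1) ∈ (F.KG κ s).support := (PMF.mem_support_iff _ _).2 fun h => by
    simp [keyWeight, h] at hk
  by_cases hx : x = s
  · have := hdiff κ s _ h1
    subst hx
    simp only [KeyPair.key, if_true, Bool.false_eq_true, if_false, decide_true, Bool.xor_true]
    cases h2 : F.Eval k.1.1 (List.ofFn x) <;> cases h3 : F.Eval k.2.1 (List.ofFn x) <;>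
      simp_all
  · simp [KeyPair.key, hx, F.equality κ s _ h1 x hx]

end WMark
end

noncomputable section

namespace WMark

open scoped ENNReal

/-! ### The experiments as games -/

variable {ℓ w : ℕ → ℕ} {F : TEPRF ℓ} {L : ℕ → ℕ}

/-- The keys of an instance of the construction. -/
def instanceKeys (κ : ℕ) (y : (Fin (w κ) → Fin (ℓ κ) → Bool) × (Fin (w κ) → Bool) ×
    (Fin (w κ) → KeyPair (L κ))) : (F.toWUPF w).Msk κ × (F.toWUPF w).Xk κ :=
  ((y.2.1, fun j => (y.2.2 j).key), (y.2.1, y.1, fun j => (y.2.2 j).key))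

theorem TEPRF.Bounded.rep_instance (hL : F.Bounded L) (κ : ℕ) :
    Rep ((F.toWUPF w).KG κ) (fun y : (Fin (w κ) → Fin (ℓ κ) → Bool) × (Fin (w κ) → Bool) ×
        (Fin (w κ) → KeyPair (L κ)) =>
      (Fintype.card (Fin (w κ) → Fin (ℓ κ) → Bool) : ℝ≥0∞)⁻¹ *
        ((Fintype.card (Fin (w κ) → Bool) : ℝ≥0∞)⁻¹ *
          ∏ j, F.KG κ (y.1 j) ((y.2.2 j).1.1, (y.2.2 j).2.1))) (instanceKeys κ) := by
  have h1 := fun s : Fin (w κ) → Fin (ℓ κ) → Bool => Rep.indep fun j => hL.rep κ (s j)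
  have h2 := fun (s : Fin (w κ) → Fin (ℓ κ) → Bool) (c : Fin (w κ) → Bool) =>
    (h1 s).map (fun k => (((c, fun j b => if b then (k j).2 else (k j).1),
      (c, s, fun j b => if b then (k j).2 else (k j).1)) :
        (F.toWUPF w).Msk κ × (F.toWUPF w).Xk κ))
  have h3 := fun s : Fin (w κ) → Fin (ℓ κ) → Bool =>
    (Rep.uniform (Y := Fin (w κ) → Bool)).bind (g := fun c =>
      (indep (w κ) fun j => F.KG κ (s j)).bind fun k =>
        PMF.pure (((c, fun j b => if b then (k j).2 else (k j).1),
          (c, s, fun j b => if b then (k j).2 else (k j).1)) :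
          (F.toWUPF w).Msk κ × (F.toWUPF w).Xk κ)) fun c => h2 s c
  exact (Rep.uniform (Y := Fin (w κ) → Fin (ℓ κ) → Bool)).bind (g := fun s =>
    (PMF.uniformOfFintype (Fin (w κ) → Bool)).bind fun c =>
      (indep (w κ) fun j => F.KG κ (s j)).bind fun k =>
        PMF.pure (((c, fun j b => if b then (k j).2 else (k j).1),
          (c, s, fun j b => if b then (k j).2 else (k j).1)) :
          (F.toWUPF w).Msk κ × (F.toWUPF w).Xk κ)) fun s => h3 s

/-- The data of all instances, with pairs of indices. -/
def matrixEquiv (n w : ℕ) (S B K : Type) : (Fin n × Fin w → S) × (Fin n × Fin w → B) ×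
    (Fin n × Fin w → K) ≃ (Fin n → (Fin w → S) × (Fin w → B) × (Fin w → K)) where
  toFun t i := (fun j => t.1 (i, j), fun j => t.2.1 (i, j), fun j => t.2.2 (i, j))
  invFun y := (fun p => (y p.1).1 p.2, fun p => (y p.1).2.1 p.2, fun p => (y p.1).2.2 p.2)
  left_inv _ := rfl
  right_inv _ := rfl

variable (F) in
/-- The weight of given differing points and keys. -/
def pairsWeight (L : ℕ) (κ : ℕ) {ι : Type} [Fintype ι] (s : ι → Fin (ℓ κ) → Bool)
    (k : ι → KeyPair L) : ℝ := ∏ p, ((2 ^ ℓ κ : ℝ)⁻¹ * (2⁻¹ * F.keyWeight L κ (s p) (k p)))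

theorem TEPRF.Bounded.expect_instances (hL : F.Bounded L) (κ n : ℕ)
    (f : (Fin n → (F.toWUPF w).Msk κ × (F.toWUPF w).Xk κ) → ℝ) :
    WMark.expect (WMark.indep n fun _ => (F.toWUPF w).KG κ) f =
      ∑ s : Fin n × Fin (w κ) → Fin (ℓ κ) → Bool, ∑ c : Fin n × Fin (w κ) → Bool,
        ∑ k : Fin n × Fin (w κ) → KeyPair (L κ), pairsWeight F (L κ) κ s k *
          f fun i => instanceKeys κ (fun j => s (i, j), fun j => c (i, j), fun j => k (i, j)) := by
  have h := ((Rep.indep fun _ : Fin n => hL.rep_instance (w := w) κ).equiv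
    (matrixEquiv n (w κ) _ _ _)).expect f
  rw [h, Fintype.sum_prod_type]
  refine Finset.sum_congr rfl fun s _ => ?_
  rw [Fintype.sum_prod_type]
  refine Finset.sum_congr rfl fun c _ => Finset.sum_congr rfl fun k _ => ?_
  congr 1
  rw [pairsWeight, ENNReal.toReal_prod, Fintype.prod_prod_type]
  refine Finset.prod_congr rfl fun i _ => ?_
  simp only [matrixEquiv, Equiv.coe_fn_mk, ENNReal.toReal_mul, ENNReal.toReal_prod,
    ENNReal.toReal_inv, ENNReal.toReal_natCast, Finset.prod_mul_distrib, keyWeight]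
  simp [← pow_mul]

/-- The answers of the evaluation oracles. -/
theorem oracle_instanceKeys {κ n : ℕ} (s : Fin n × Fin (w κ) → Fin (ℓ κ) → Bool)
    (c : Fin n × Fin (w κ) → Bool) (k : Fin n × Fin (w κ) → KeyPair (L κ))
    (R : Fin n × Fin (w κ) → PairSpec (ℓ κ))
    (hR : ∀ p x, (R p).fn x = F.Eval ((k p).key false) (List.ofFn x)) :
    (F.toWUPF w).oracle (fun i => instanceKeys (F := F) κ
      (fun j => s (i, j), fun j => c (i, j), fun j => k (i, j))) = specOracle R := by
  funext i q
  unfold WUPF.oracle specOracle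
  split_ifs with hi
  · refine congrArg List.ofFn (funext fun j => ?_)
    rw [hR]
    change F.Eval _ (block _ j) = _
    congr 1
  · rfl

theorem sum_map_finsetSum {α β : Type} (l : List α) (s : Finset β) (f : β → α → ℝ) :
    (l.map fun a => ∑ b ∈ s, f b a).sum = ∑ b ∈ s, (l.map (f b)).sum := by
  induction l with
  | nil => simp
  | cons a l ih => simp [ih, Finset.sum_add_distrib]

/-- The experiment with all distributions written as finite sums. -/
theorem TEPRF.Bounded.experiment_eq (hL : F.Bounded L) (κ n : ℕ) (A : ParAdversary)
    (final : (Fin n → (F.toWUPF w).Msk κ × (F.toWUPF w).Xk κ) →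
      (Fin n → Fin ((F.toWUPF w).markLen κ) → Bool) → Ket → ℝ)
    (R : (Fin n × Fin (w κ) → Fin (ℓ κ) → Bool) → (Fin n × Fin (w κ) → Fin (ℓ κ) → Bool) →
      (Fin n × Fin (w κ) → Bool) → (Fin n × Fin (w κ) → KeyPair (L κ)) →
      Fin n × Fin (w κ) → PairSpec (ℓ κ))
    (hfn : ∀ s h b k p x, (R s h b k p).fn x = F.Eval ((k p).key false) (List.ofFn x))
    (hmark : ∀ s h b k p, (R s h b k p).mark = (k p).key (b p))
    (hfinal : ∀ s (c : Fin n × Fin (w κ) → Bool) k, (∀ p, F.keyWeight (L κ) κ (s p) (k p) ≠ 0) → ∀ x ψ,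
      final (fun i => instanceKeys κ (fun j => s (i, j), fun j => c (i, j), fun j => k (i, j))) x ψ =
        (∏ _p : Fin n × Fin (w κ), (2 ^ ℓ κ : ℝ)⁻¹) *
          ∑ h, specFinal (A.predictor κ) (R s h (fun p => xor (x p.1 p.2) (c p)) k) ψ) :
    (F.toWUPF w).experiment n A κ final = ∑ s, ∑ h, ∑ b, ∑ k,
      (∏ p, sampleWeight (F.keyWeight (L κ) κ) (s p, h p, b p, k p)) *
        game (A.preMark κ) (A.postMark κ) (A.predictor κ) (A.advice κ) (R s h b k) := by
  unfold WUPF.experiment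
  rw [hL.expect_instances]
  refine Finset.sum_congr rfl fun s _ => ?_
  rw [Finset.sum_comm (s := (Finset.univ : Finset (Fin n × Fin (w κ) → Bool)))]
  have hcomm : ∀ f : (Fin n × Fin (w κ) → Fin (ℓ κ) → Bool) → (Fin n × Fin (w κ) → Bool) →
      (Fin n × Fin (w κ) → KeyPair (L κ)) → ℝ,
      ∑ h, ∑ b, ∑ k, f h b k = ∑ k, ∑ b, ∑ h, f h b k := fun f => by
    simp only [Finset.sum_comm (s := (Finset.univ : Finset (Fin n × Fin (w κ) → KeyPair (L κ))))]
    rw [Finset.sum_comm]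
  rw [hcomm]
  refine Finset.sum_congr rfl fun k _ => ?_
  -- Keys outside the support have weight zero on both sides. Discarding them makes the relation
  -- between the two keys of a pair available for `hfinal`.
  by_cases hk : ∀ p, F.keyWeight (L κ) κ (s p) (k p) ≠ 0
  swap
  · push Not at hk
    obtain ⟨p, hp⟩ := hk
    have h1 : pairsWeight F (L κ) κ s k = 0 :=
      Finset.prod_eq_zero (Finset.mem_univ p) (by simp [hp])
    have h2 : ∀ (h : Fin n × Fin (w κ) → Fin (ℓ κ) → Bool) (b : Fin n × Fin (w κ) → Bool),
        ∏ p, sampleWeight (F.keyWeight (L κ) κ) (s p, h p, b p, k p) = 0 := fun h b =>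
      Finset.prod_eq_zero (Finset.mem_univ p) (by simp [sampleWeight, hp])
    simp [h1, h2]
  set O := specOracle (R s s (fun _ => false) k) with hO
  have hO' : ∀ h b, specOracle (R s h b k) = O := fun h b => by
    rw [hO]; unfold specOracle; simp only [hfn]
  set M : (Fin n × Fin (w κ) → Bool) → List Bool := fun b =>
    encList (encList encStr) (List.ofFn fun i => List.ofFn fun j => (k (i, j)).key (b (i, j))) with hM
  have hM' : ∀ h b, specMarks (R s h b k) = M b := fun h b => by
    unfold specMarks; simp only [hmark, hM]
  set x : State → Fin n × Fin (w κ) → Bool := fun σ p =>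
    (F.toWUPF w).readMarks κ n (σ.reg 0) p.1 p.2 with hx
  set N : ℝ := ∏ _p : Fin n × Fin (w κ), (2 ^ ℓ κ : ℝ)⁻¹ with hN
  have hweight : ∀ (h : Fin n × Fin (w κ) → Fin (ℓ κ) → Bool) (b : Fin n × Fin (w κ) → Bool),
      ∏ p, sampleWeight (F.keyWeight (L κ) κ) (s p, h p, b p, k p) =
        pairsWeight F (L κ) κ s k * N := fun h b => by
    rw [pairsWeight, hN, ← Finset.prod_mul_distrib]
    refine Finset.prod_congr rfl fun p _ => ?_
    simp only [sampleWeight]; ring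
  set V : (Fin n × Fin (w κ) → Bool) → State → ℝ := fun b σ =>
    (A.postMark κ).val O (fun σ' => ∑ h, specFinal (A.predictor κ) (R s h b k) σ'.ket)
      (σ.set 0 (M b)) with hV
  have hgame : ∀ b, ∑ h, game (A.preMark κ) (A.postMark κ) (A.predictor κ) (A.advice κ) (R s h b k) =
      (A.preMark κ).val O (V b) ⟨fun _ => [], A.advice κ⟩ := fun b => by
    simp only [game, hO', hM', ← Code.val_sum, hV]
  simp only [hweight, ← Finset.mul_sum, hgame]
  rw [mul_assoc]
  congr 1
  rw [Code.val_sum, ← Code.val_const_mul]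
  simp only [oracle_instanceKeys s _ k (R s s (fun _ => false) k) (hfn s s (fun _ => false) k),
    ← hO]
  rw [← sum_map_finsetSum]
  rw [Code.LoopFree.run_eq (A.preMark_poly.1 κ)]
  unfold Code.val
  refine congrArg List.sum (List.map_congr_left fun σ _ => ?_)
  -- For a fixed branch before marking, which does not depend on `c` because the oracles only use
  -- the first keys, the map sending `c` to its XOR with the chosen marks is a bijection. Summing
  -- over `c` is therefore the same as summing over the indices of the marked keys.
  have hinv : Function.Involutive fun (c : Fin n × Fin (w κ) → Bool) p => xor (x σ p) (c p) :=
    fun c => by funext p; simp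
  rw [← Equiv.sum_comp hinv.toPerm fun b => V b σ, Finset.mul_sum]
  refine Finset.sum_congr rfl fun c _ => ?_
  rw [Code.LoopFree.run_eq (A.postMark_poly.1 κ), hV]
  beta_reduce
  rw [← Code.val_const_mul]
  unfold Code.val
  have hm : encList (F.toWUPF w).encKey (List.ofFn fun i => (F.toWUPF w).mark
      (instanceKeys (F := F) κ (fun j => s (i, j), fun j => c (i, j), fun j => k (i, j))).1
      ((F.toWUPF w).readMarks κ n (σ.reg 0) i)) = M fun p => xor (x σ p) (c p) :=
    (encList_map (encList encStr) (fun key : Fin (w κ) → List Bool => List.ofFn key)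
      (List.ofFn fun i j => (k (i, j)).key (xor (x σ (i, j)) (c (i, j))))).symm.trans
      (by rw [List.map_ofFn]; rfl)
  rw [hm]
  refine congrArg List.sum (List.map_congr_left fun σ' _ => ?_)
  exact hfinal s c k hk _ _

end WMark
end

noncomputable section

namespace WMark

/-! ### The prediction and the extraction experiment -/

variable {ℓ w : ℕ → ℕ} {F : TEPRF ℓ} {L : ℕ → ℕ}

/-- Challenges with pairs of indices. -/
def challengeEquiv (n w l : ℕ) : (Fin n → Fin (w * l) → Bool) ≃ (Fin n × Fin w → Fin l → Bool) where
  toFun s p a := s p.1 (finProdFinEquiv (p.2, a))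
  invFun h i q := h (i, (finProdFinEquiv.symm q).1) (finProdFinEquiv.symm q).2
  left_inv s := by
    funext i q
    exact congrArg (s i) (finProdFinEquiv.apply_symm_apply q)
  right_inv h := by funext p a; simp

/-- Both sides put bit `a` of block `j` of instance `i` on qubit `(i * w + j) * l + a`; only the
grouping of the indices differs. -/
theorem loadInput_eq_flipKet {n w l : ℕ} (s : Fin n → Fin (w * l) → Bool) (ψ : Ket) :
    loadInput s ψ = flipKet (flat fun p => List.ofFn (challengeEquiv n w l s p)).flatten ψ := by
  have h1 : (flat fun p => List.ofFn (challengeEquiv n w l s p)).flatten =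
      flat fun q : Fin n × Fin (w * l) => s q.1 q.2 := by
    unfold flat
    rw [List.flatten_flatten, List.map_ofFn]
    congr 2
    funext i
    have := flat_eq fun q : Fin w × Fin l => challengeEquiv n w l s (i, q.1) q.2
    unfold flat at this
    simp only [Function.comp_apply]
    rw [this]
    congr 1
    funext q
    exact congrArg (s i) (finProdFinEquiv.apply_symm_apply q)
  rw [h1]
  funext B
  unfold loadInput flipKet
  congr 2
  ext q
  simp only [Finset.mem_image, Finset.mem_filter, Finset.mem_univ, true_and, Prod.exists,
    Finset.mem_range, length_flat]
  constructor
  · rintro ⟨i, j, h, rfl⟩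
    refine ⟨index_lt i j, ?_⟩
    rw [getD_flat]
    exact h
  · rintro ⟨hq, h⟩
    obtain ⟨i, j, rfl⟩ := exists_index hq
    rw [getD_flat] at h
    exact ⟨i, j, h, rfl⟩

theorem outputProb_eq_listProb {n v : ℕ} (ψ : Ket) (t : Fin n → Fin v → Bool) :
    outputProb ψ t = listProb ψ (flat fun p => t p.1 p.2) := by
  unfold outputProb listProb
  refine tsum_congr fun B => ?_
  have : (∀ i j, decide (i.val * v + j.val ∈ B) = t i j) ↔
      ∀ q < (flat fun p => t p.1 p.2).length, decide (q ∈ B) =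
        (flat fun p => t p.1 p.2).getD q false := by
    rw [length_flat]
    constructor
    · intro h q hq
      obtain ⟨i, j, rfl⟩ := exists_index hq
      rw [getD_flat]
      exact h i j
    · intro h i j
      rw [h _ (index_lt i j), getD_flat]
  simp only [this]

variable (F) in
/-- The weights of the samples for the key generation. -/
def TEPRF.weights (L : ℕ) (κ : ℕ) : Sample (ℓ κ) (KeyPair L) → ℝ :=
  sampleWeight (F.keyWeight L κ)

/-- Samples for all instances. -/
def sampleEquiv (ι S B K : Type) :
    (ι → S × S × B × K) ≃ (ι → S) × (ι → S) × (ι → B) × (ι → K) where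
  toFun z := (fun p => (z p).1, fun p => (z p).2.1, fun p => (z p).2.2.1, fun p => (z p).2.2.2)
  invFun t := fun p => (t.1 p, t.2.1 p, t.2.2.1 p, t.2.2.2 p)
  left_inv _ := rfl
  right_inv _ := rfl

theorem sum_samples {ι S B K : Type} [Fintype ι] [DecidableEq ι] [Fintype S] [Fintype B] [Fintype K]
    (f : (ι → S × S × B × K) → ℝ) :
    ∑ z, f z = ∑ s : ι → S, ∑ h : ι → S, ∑ b : ι → B, ∑ k : ι → K,
      f fun p => (s p, h p, b p, k p) := by
  rw [← Equiv.sum_comp (sampleEquiv ι S B K).symm]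
  simp only [Fintype.sum_prod_type]
  rfl

/-- The probability of winning the prediction experiment. -/
theorem TEPRF.Bounded.predictionProb_eq (hL : F.Bounded L) (κ n : ℕ) (A : ParAdversary) :
    (F.toWUPF w).predictionProb n A κ =
      ∑ z : Fin n × Fin (w κ) → Sample (ℓ κ) (KeyPair (L κ)), (∏ p, F.weights (L κ) κ (z p)) *
        game (A.preMark κ) (A.postMark κ) (A.predictor κ) (A.advice κ)
          fun p => preSpec F.Eval KeyPair.key (z p) := by
  rw [sum_samples]
  refine hL.experiment_eq κ n A _
    (fun s h b k p => preSpec F.Eval KeyPair.key (s p, h p, b p, k p))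
    (fun _ _ _ _ _ _ => rfl) (fun _ _ _ _ _ => rfl) fun s c k _ x ψ => ?_
  have h := (Rep.uniform (Y := Fin n → Fin (w κ * ℓ κ) → Bool)).expect fun s' =>
      outputProb ((A.predictor κ).apply (loadInput s' ψ)) fun i => (F.toWUPF w).evalMsk
        (instanceKeys κ (fun j => s (i, j), fun j => c (i, j), fun j => k (i, j))).1 (s' i)
  refine h.trans ?_
  rw [← Finset.mul_sum]
  congr 1
  · simp [← pow_mul, mul_comm, mul_left_comm]
  · rw [← Equiv.sum_comp (challengeEquiv n (w κ) (ℓ κ))]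
    refine Finset.sum_congr rfl fun s' _ => ?_
    rw [id, loadInput_eq_flipKet, outputProb_eq_listProb]
    rfl

/-- The bound for the running time of the extractor is a polynomial. -/
theorem exists_extractorTime (T : Polynomial ℕ) :
    ∃ T' : Polynomial ℕ, ∀ n, T'.eval n = extractorTime T n :=
  ⟨(.X * (.X * (20 * .X + T + 104) + 12) + 8) + .X * (20 * .X + 44) + 22 * .X + 50 + 2 * .X ^ 3,
    fun n => by simp [extractorTime]⟩

/-- The extraction keys as input of the extractor. -/
def keyItems {n w l : ℕ} (xk : Fin n → (Fin w → Bool) × (Fin w → Fin l → Bool) ×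
    (Fin w → Bool → List Bool)) : List (List Item) :=
  List.ofFn fun i => List.ofFn fun j =>
    ((xk i).1 j, List.ofFn ((xk i).2.1 j), (xk i).2.2 j false, (xk i).2.2 j true)

theorem extInput_eq {κ n : ℕ} (xk : Fin n → (F.toWUPF w).Xk κ) (C : Circuit) (ψ : Ket) :
    encList (F.toWUPF w).encXk (List.ofFn xk) = encList (encList encItem) (keyItems xk) ∧
    (F.toWUPF w).extInput xk C ψ = ⟨rf (encList (encList encItem) (keyItems xk)) (encCircuit C)
      [] [] [] [] [] [] [] [] [] (fun _ => []), ψ⟩ := by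
  have h : encList (F.toWUPF w).encXk (List.ofFn xk) = encList (encList encItem) (keyItems xk) := by
    have h1 := encList_map (encList encItem) (fun k : (F.toWUPF w).Xk κ =>
      List.ofFn fun j : Fin (w κ) => ((k.1 j, List.ofFn (k.2.1 j), k.2.2 j false, k.2.2 j true) : Item))
      (List.ofFn xk)
    rw [List.map_ofFn] at h1
    refine Eq.trans ?_ h1.symm
    congr 1
    funext k
    have h2 := encList_map encItem id (List.ofFn fun j : Fin (w κ) =>
      ((k.1 j, List.ofFn (k.2.1 j), k.2.2 j false, k.2.2 j true) : Item))
    have h3 := encList_map id encItem (List.ofFn fun j : Fin (w κ) =>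
      ((k.1 j, List.ofFn (k.2.1 j), k.2.2 j false, k.2.2 j true) : Item))
    rw [List.map_ofFn] at h3
    exact h3
  refine ⟨h, ?_⟩
  unfold WUPF.extInput
  rw [h]
  unfold inputState
  congr 1
  funext r
  match r with
  | 0 | 1 | 2 | 3 | 4 | 5 | 6 | 7 | 8 | 9 | 10 | _ + 11 => simp [rf]

variable {S : Code} {m : ℕ} {T T' : Polynomial ℕ}

theorem runs_extInput (hS : Computes S m T F.Eval) (hT : ∀ n, T'.eval n = extractorTime T n)
    {κ n : ℕ} (xk : Fin n → (F.toWUPF w).Xk κ) (C : Circuit) (ψ : Ket) :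
    Runs noOracle [extractor S] ((F.toWUPF w).extInput xk C ψ) ((F.toWUPF w).extTime T' xk C)
      (measured (fun a => rf a [] [] [] [] [] [] [] [] [] [] fun _ => [])
        ((keyItems xk).flatten.map (Item.bit F.Eval)).reverse []
        (C.apply (flipKet ((keyItems xk).flatten.flatMap fun p => p.2.1) ψ))) := by
  obtain ⟨h1, h2⟩ := extInput_eq xk C ψ
  rw [h2]
  refine (runs_extractor hS (fun _ _ => rfl) (keyItems xk) C _ le_rfl).mono ?_
  unfold WUPF.extTime
  rw [h1, hT]
  exact le_rfl

/-- The probability of winning the extraction experiment. -/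
theorem TEPRF.Bounded.extractionProb_eq (hL : F.Bounded L) (hdiff : F.DifferentValuesOnTarget)
    (hS : Computes S m T F.Eval) (hT : ∀ n, T'.eval n = extractorTime T n)
    (κ n : ℕ) (A : ParAdversary) :
    (F.toWUPF w).extractionProb (extractor S) T' n A κ =
      ∑ z : Fin n × Fin (w κ) → Sample (ℓ κ) (KeyPair (L κ)), (∏ p, F.weights (L κ) κ (z p)) *
        game (A.preMark κ) (A.postMark κ) (A.predictor κ) (A.advice κ)
          fun p => extSpec F.Eval KeyPair.key (z p) := by
  rw [sum_samples]
  refine hL.experiment_eq κ n A _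
    (fun s h b k p => extSpec F.Eval KeyPair.key (s p, h p, b p, k p))
    (fun _ _ _ _ _ _ => rfl) (fun _ _ _ _ _ => rfl) fun s c k hk (x : Fin n → Fin (w κ) → Bool) ψ => ?_
  -- The extraction experiment has no random challenge. `extSpec` ignores `h`, so the sum over it
  -- cancels against the normalization.
  have hconst : ∀ h : Fin n × Fin (w κ) → Fin (ℓ κ) → Bool,
      specFinal (A.predictor κ) (fun p => extSpec F.Eval KeyPair.key
        (s p, h p, xor (x p.1 p.2) (c p), k p)) ψ =
      specFinal (A.predictor κ) (fun p => extSpec F.Eval KeyPair.key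
        (s p, s p, xor (x p.1 p.2) (c p), k p)) ψ := fun h => rfl
  simp only [hconst]
  rw [Finset.sum_const, Finset.card_univ, nsmul_eq_mul, ← mul_assoc,
    show (∏ _p : Fin n × Fin (w κ), (2 ^ ℓ κ : ℝ)⁻¹) *
      (Fintype.card (Fin n × Fin (w κ) → Fin (ℓ κ) → Bool) : ℝ) = 1 by simp, one_mul]
  set xk : Fin n → (F.toWUPF w).Xk κ := fun i =>
    (instanceKeys (F := F) κ (fun j => s (i, j), fun j => c (i, j), fun j => k (i, j))).2 with hxk
  have hrun := runs_extInput hS hT xk (A.predictor κ) ψ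
  have hitems : (keyItems xk).flatten = flat fun p : Fin n × Fin (w κ) =>
      ((c p, List.ofFn (s p), (k p).key false, (k p).key true) : Item) := rfl
  change weight (exec noOracle ((F.toWUPF w).extTime T' xk (A.predictor κ)) (extractor S)
    ((F.toWUPF w).extInput xk (A.predictor κ) ψ)) (fun σ => σ.reg 0 = flat fun p => x p.1 p.2) = _
  rw [hrun.exec le_rfl, hitems, map_flat]
  have hw := weight_measured (rest := fun a => rf a [] [] [] [] [] [] [] [] [] [] fun _ => [])
    (fun a => rf_0) (flat fun p : Fin n × Fin (w κ) => Item.bit F.Eval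
      (c p, List.ofFn (s p), (k p).key false, (k p).key true)).reverse [] (flat fun p => x p.1 p.2)
    ((A.predictor κ).apply (flipKet ((flat fun p : Fin n × Fin (w κ) =>
      ((c p, List.ofFn (s p), (k p).key false, (k p).key true) : Item)).flatMap
        fun p => p.2.1) ψ)) (by rw [List.length_reverse, length_flat, length_flat])
  rw [List.append_nil] at hw
  rw [hw]
  unfold specFinal listProb
  rw [List.flatMap_def, map_flat]
  refine tsum_congr fun B => ?_
  congr 1
  rw [List.length_reverse, length_flat, List.reverse_reverse, length_flat, eq_iff_iff]
  refine forall₂_congr fun q hq => ?_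
  obtain ⟨i, j, rfl⟩ := exists_index hq
  rw [getD_flat, getD_flat, getD_flat]
  -- The heart of the extractor: the mark plus the correction bit is the value of the marked key at
  -- the differing point, since that value changes exactly when the index of the key does. Hence a
  -- correct mark is the same event as a correct answer.
  have he : xor (x i j) (Item.bit F.Eval (c (i, j), List.ofFn (s (i, j)), (k (i, j)).key false,
      (k (i, j)).key true)) = F.Eval ((k (i, j)).key (xor (x i j) (c (i, j))))
        (List.ofFn (s (i, j))) := by
    have h1 := TEPRF.eval_true hdiff (hk (i, j)) (s (i, j))
    simp only [decide_true, Bool.xor_true] at h1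
    unfold Item.bit
    cases hxx : x i j <;> cases hc : c (i, j) <;> simp [h1]
  rw [he]
  rfl

end WMark
end

noncomputable section

namespace WMark

/-! ### The wiring for given hybrid data -/

/-- Hard-wired data of an instance, where `none` stands for the unknown key: the key in the oracle
and the point at which its value is flipped, the marked key, the challenge, and the key against which
the answer is checked. -/
abbrev HardPair (l L : ℕ) := Option (Str L) × Option (Fin l → Bool) × Option (Str L) ×
  (Fin l → Bool) × Option (Str L)

def optKey {L : ℕ} (x : Option (Str L)) (k : List Bool) : List Bool := (x.map Subtype.val).getD k

/-- The specification given by the hard-wired data and the unknown key. -/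
def HardPair.spec {l L : ℕ} (v : List Bool → List Bool → Bool) (z : HardPair l L) (k : List Bool) :
    PairSpec l where
  fn x := xor (v (optKey z.1 k) (List.ofFn x)) (decide (z.2.1 = some x))
  mark := optKey z.2.2.1 k
  point := z.2.2.2.1
  ans := v (optKey z.2.2.2.2 k) (List.ofFn z.2.2.2.1)

def HardPair.entry {l L : ℕ} (z : HardPair l L) : Entry := (z.1.map Subtype.val, z.2.1.map List.ofFn)

section wiring

variable {n w l L : ℕ} (z : Fin n × Fin w → HardPair l L)

def hardWiring : Wiring where
  rows := List.ofFn fun i => List.ofFn fun j => (z (i, j)).entry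
  marks := List.ofFn fun i => List.ofFn fun j => (z (i, j)).2.2.1.map Subtype.val
  checks := List.ofFn fun i => List.ofFn fun j =>
    (List.ofFn (z (i, j)).2.2.2.1, (z (i, j)).2.2.2.2.map Subtype.val)

theorem padTake_eq (l : ℕ) (q : List Bool) : padTake l q = List.ofFn fun k : Fin l =>
    q.getD k false := by
  induction l generalizing q with
  | zero => rfl
  | succ l ih =>
    rw [padTake, ih, List.ofFn_succ]
    cases q <;> simp

theorem rowVal_ofFn (v : List Bool → List Bool → Bool) (k : List Bool) {w : ℕ} (e : Fin w → Entry)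
    (q : List Bool) : rowVal v k l (List.ofFn e) q =
      List.ofFn fun j : Fin w => (e j).val v k (List.ofFn (queryBlock l j q)) := by
  induction w generalizing q with
  | zero => rfl
  | succ w ih =>
    rw [List.ofFn_succ, rowVal, ih, List.ofFn_succ, padTake_eq]
    congr 1
    congr 1
    funext j
    congr 2
    funext a
    simp only [queryBlock, List.getD_eq_getElem?_getD, List.getElem?_drop, Fin.val_succ]
    congr 2
    ring

theorem HardPair.val_entry (v : List Bool → List Bool → Bool) (k : List Bool) (z : HardPair l L)
    (x : Fin l → Bool) : z.entry.val v k (List.ofFn x) = (z.spec v k).fn x := by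
  unfold Entry.val HardPair.entry HardPair.spec optKey
  congr 1
  rcases z with ⟨_, _ | y, _⟩
  · simp
  · simp [List.ofFn_inj]

theorem tableOracle_hardWiring (v : List Bool → List Bool → Bool) (k : List Bool) :
    tableOracle v k l (hardWiring z).rows = specOracle fun p => (z p).spec v k := by
  funext i q
  unfold tableOracle specOracle hardWiring
  split_ifs with hi
  · rw [List.getD_eq_getElem _ _ (by simpa using hi), List.getElem_ofFn, rowVal_ofFn]
    simp only [HardPair.val_entry]
  · rw [List.getD_eq_default _ _ (by simpa using hi), rowVal]

theorem markStr_hardWiring (v : List Bool → List Bool → Bool) (k : List Bool) :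
    (hardWiring z).markStr k = specMarks fun p => (z p).spec v k := by
  unfold Wiring.markStr specMarks hardWiring
  rw [← encList_map (encList encStr), List.map_ofFn]
  congr 2
  funext i
  rw [Function.comp_apply, List.map_ofFn]
  rfl

theorem items_hardWiring (k : List Bool) : ((hardWiring z).items k).flatten =
    flat fun p => ((false, List.ofFn (z p).2.2.2.1, optKey (z p).2.2.2.2 k, []) : Item) := by
  unfold Wiring.items hardWiring flat
  rw [List.map_ofFn]
  congr 2
  funext i
  rw [Function.comp_apply, List.map_ofFn]
  rfl

/-- Identifies the success probability of the reduction's program with the abstract game in which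
the unknown key fills the open places. -/
theorem value_hardWiring (v : List Bool → List Bool → Bool) (pre post : Code) (C : Circuit)
    (k : List Bool) (ψ : Ket) : (hardWiring z).value v l pre post C k ψ =
      game pre post C ψ fun p => (z p).spec v k := by
  unfold Wiring.value game Code.val
  rw [tableOracle_hardWiring, markStr_hardWiring z v]
  simp only [items_hardWiring, specFinal]
  simp only [List.flatMap_def, map_flat]
  simp [HardPair.spec, Item.bit]

/-! ### Length bounds for the hard-wired data -/

theorem length_flatMap_le {α β : Type} {f : α → List β} {B : ℕ} {s : List α}
    (h : ∀ a ∈ s, (f a).length ≤ B) : (s.flatMap f).length ≤ s.length * B := by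
  induction s with
  | nil => simp
  | cons a s ih =>
    have h1 := ih fun b hb => h b (List.mem_cons_of_mem _ hb)
    have h2 := h a List.mem_cons_self
    rw [List.flatMap_cons, List.length_append, List.length_cons, add_mul]
    omega

theorem length_encList_le {α : Type} {f : α → List Bool} {B : ℕ} {s : List α}
    (h : ∀ a ∈ s, (f a).length ≤ B) : (encList f s).length ≤ s.length * (B + 1) + 1 := by
  have := length_flatMap_le (f := fun a => true :: f a) (B := B + 1) (s := s) fun a ha => by
    simpa using h a ha
  rw [encList, List.length_append]
  simpa using this

theorem length_pieceList_le {α : Type} {f : α → List Piece} {B : ℕ} {s : List α}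
    (h : ∀ a ∈ s, (f a).length ≤ B) : (pieceList f s).length ≤ s.length * (B + 1) + 1 := by
  have := length_flatMap_le (f := fun a => some [true] :: f a) (B := B + 1) (s := s) fun a ha => by
    simpa using h a ha
  rw [pieceList, List.length_append]
  simpa using this

theorem length_optKey_le (x : Option (Str L)) {k : List Bool} (hk : k.length ≤ L) :
    (optKey x k).length ≤ L := by
  cases x with
  | none => exact hk
  | some x => exact x.2

/-- A bound for the size of the hard-wired data. -/
def hardSize (n w l L : ℕ) : ℕ :=
  20 * (n * (w * (2 * l + 2 * L + 5 + 1) + 2) + 1) + 24 * (n * (w * (3 + 1) + 2) + 1) + 1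

theorem bounded_hardWiring {k : List Bool} (hk : k.length ≤ L) {X : ℕ} (hX : hardSize n w l L ≤ X)
    (hw : w ≤ X) (hl : L + l ≤ X) : (hardWiring z).Bounded l X k := by
  refine ⟨?_, ?_, ?_⟩
  · intro row hrow
    obtain ⟨i, rfl⟩ := List.mem_ofFn.1 hrow
    refine ⟨by simpa using hw, fun x hx => ?_⟩
    obtain ⟨j, rfl⟩ := List.mem_ofFn.1 hx
    refine ⟨fun p hp => ?_, ?_⟩
    · obtain ⟨y, -, rfl⟩ := Option.mem_map.1 hp
      simp
    · have := length_optKey_le (z (i, j)).1 hk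
      unfold optKey at this
      simp only [HardPair.entry]
      omega
  · refine le_trans ?_ hX
    unfold emitTime hardSize
    -- The string of marked keys does not involve the evaluation function, so any function may be
    -- inserted.
    rw [Wiring.piecesVal_markPieces, markStr_hardWiring z fun _ _ => false]
    have h1 : (specMarks fun p => (z p).spec (fun _ _ => false) k).length ≤
        n * (w * (2 * l + 2 * L + 5 + 1) + 1 + 1) + 1 := by
      refine (length_encList_le (B := w * (2 * l + 2 * L + 5 + 1) + 1) fun row hrow => ?_).trans
        (by simp)
      obtain ⟨i, rfl⟩ := List.mem_ofFn.1 hrow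
      refine (length_encList_le (B := 2 * l + 2 * L + 5) fun x hx => ?_).trans (by simp)
      obtain ⟨j, rfl⟩ := List.mem_ofFn.1 hx
      rw [length_encStr]
      have := length_optKey_le (z (i, j)).2.2.1 hk
      simp only [HardPair.spec]
      omega
    have h2 : (hardWiring z).markPieces.length ≤ n * (w * (3 + 1) + 1 + 1) + 1 := by
      refine (length_pieceList_le (B := w * (3 + 1) + 1) fun row hrow => ?_).trans
        (by simp [hardWiring])
      obtain ⟨i, rfl⟩ := List.mem_ofFn.1 hrow
      exact (length_pieceList_le (B := 3) fun x _ => by simp [keyPiece]).trans (by simp)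
    gcongr
  · refine le_trans ?_ hX
    unfold emitTime hardSize
    rw [Wiring.piecesVal_itemPieces]
    have h1 : (encList (encList encItem) ((hardWiring z).items k)).length ≤
        n * (w * (2 * l + 2 * L + 5 + 1) + 1 + 1) + 1 := by
      unfold Wiring.items
      rw [encList_map]
      refine (length_encList_le (B := w * (2 * l + 2 * L + 5 + 1) + 1) fun row hrow => ?_).trans
        (by simp [hardWiring])
      obtain ⟨i, rfl⟩ := List.mem_ofFn.1 hrow
      rw [encList_map]
      refine (length_encList_le (B := 2 * l + 2 * L + 5) fun x hx => ?_).trans (by simp)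
      obtain ⟨j, rfl⟩ := List.mem_ofFn.1 hx
      have := length_optKey_le (z (i, j)).2.2.2.2 hk
      unfold optKey at this
      simp only [encItem, List.length_cons, List.length_append, length_encStr, List.length_ofFn,
        List.length_nil]
      omega
    have h2 : (hardWiring z).itemPieces.length ≤ n * (w * (3 + 1) + 1 + 1) + 1 := by
      refine (length_pieceList_le (B := w * (3 + 1) + 1) fun row hrow => ?_).trans
        (by simp [hardWiring])
      obtain ⟨i, rfl⟩ := List.mem_ofFn.1 hrow
      exact (length_pieceList_le (B := 3) fun x _ => by simp [checkPieces]).trans (by simp)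
    gcongr

end wiring

/-! ### Hiding for the hybrid games -/

variable {ℓ w : ℕ → ℕ} {F : TEPRF ℓ} {L n : ℕ → ℕ}

theorem KeyPair.length_key_le {L : ℕ} (k : KeyPair L) (b : Bool) : (k.key b).length ≤ L := by
  cases b
  · exact k.1.2
  · exact k.2.2

/-- A bound on the advantage against hiding that holds for all hard-wired data. -/
theorem exists_hiding_bound (hL : F.Bounded L) (hLp : PolyBounded L) (hℓ : PolyBounded ℓ)
    (hw : PolyBounded w) (hn : PolyBounded n) (hhide : F.DifferingPointHiding) (A : ParAdversary) :
    ∃ δ : ℕ → ℝ, Negligible δ ∧ ∀ (κ : ℕ) (z : Fin (n κ) × Fin (w κ) → HardPair (ℓ κ) (L κ))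
      (s s' : Fin (ℓ κ) → Bool) (b : Bool),
      |∑ k, F.keyWeight (L κ) κ s k * game (A.preMark κ) (A.postMark κ) (A.predictor κ) (A.advice κ)
          (fun p => (z p).spec F.Eval (k.key b)) -
        ∑ k, F.keyWeight (L κ) κ s' k * game (A.preMark κ) (A.postMark κ) (A.predictor κ)
          (A.advice κ) (fun p => (z p).spec F.Eval (k.key b))| ≤ δ κ := by
  obtain ⟨S, m, T, hS⟩ := F.exists_computes
  set X : ℕ → ℕ := fun κ => hardSize (n κ) (w κ) (ℓ κ) (L κ) + w κ + L κ + ℓ κ +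
    (A.preMark κ).size + (A.postMark κ).size + (encCircuit (A.predictor κ)).length with hX
  have hXp : PolyBounded X := by
    have h2l := (((PolyBounded.const 2).mul hℓ).add ((PolyBounded.const 2).mul hLp)).add (.const 5)
    have h1 := (hn.mul ((hw.mul (h2l.add (.const 1))).add (.const 2))).add (.const 1)
    have h2 := (hn.mul ((hw.mul (.const (3 + 1))).add (.const 2))).add (.const 1)
    have h3 : PolyBounded fun κ => hardSize (n κ) (w κ) (ℓ κ) (L κ) :=
      (((PolyBounded.const 20).mul h1).add ((PolyBounded.const 24).mul h2)).add (.const 1)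
    exact (((((h3.add hw).add hLp).add hℓ).add A.preMark_poly.2).add A.postMark_poly.2).add
      A.predictor_poly
  let f : (κ : ℕ) → ((Fin (n κ) × Fin (w κ) → HardPair (ℓ κ) (L κ)) × (Bool → Fin (ℓ κ) → Bool) ×
      Bool) → ℝ := fun κ t =>
    |∑ k, F.keyWeight (L κ) κ (t.2.1 false) k * game (A.preMark κ) (A.postMark κ) (A.predictor κ)
        (A.advice κ) (fun p => (t.1 p).spec F.Eval (k.key t.2.2)) -
      ∑ k, F.keyWeight (L κ) κ (t.2.1 true) k * game (A.preMark κ) (A.postMark κ) (A.predictor κ)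
        (A.advice κ) (fun p => (t.1 p).spec F.Eval (k.key t.2.2))|
  -- For each security parameter there are finitely many choices of hard-wired data, since keys have
  -- bounded length. The worst of them, pair of points and bit included, becomes non-uniform advice,
  -- so one adversary dominates all hybrids.
  have hmax : ∀ κ, ∃ t, ∀ t', f κ t' ≤ f κ t := fun κ =>
    haveI : Nonempty ((Fin (n κ) × Fin (w κ) → HardPair (ℓ κ) (L κ)) × (Bool → Fin (ℓ κ) → Bool) ×
      Bool) := ⟨(fun _ => (none, none, none, fun _ => false, none), fun _ _ => false, false)⟩
    Finite.exists_max (f κ)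
  choose t ht using hmax
  have hbd : ∀ κ k, k.length ≤ L κ → (hardWiring (t κ).1).Bounded (ℓ κ) (X κ) k := fun κ k hk =>
    bounded_hardWiring _ hk (by rw [hX]; dsimp only; omega) (by rw [hX]; dsimp only; omega)
      (by rw [hX]; dsimp only; omega)
  set B := wiredAdversary S m T A hℓ hXp (fun κ => (t κ).2.1) (fun κ => (t κ).2.2)
    (fun κ => hardWiring (t κ).1) (fun κ => hbd κ [] (by simp))
    (fun κ => by rw [hX]; dsimp only; omega) (fun κ => by rw [hX]; dsimp only; omega)
    (fun κ => by rw [hX]; dsimp only; omega) with hB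
  have hprob : ∀ coin κ, F.hidingProb B coin κ = ∑ k, F.keyWeight (L κ) κ ((t κ).2.1 coin) k *
      game (A.preMark κ) (A.postMark κ) (A.predictor κ) (A.advice κ)
        (fun p => ((t κ).1 p).spec F.Eval (k.key (t κ).2.2)) := by
    intro coin κ
    rw [hB, hidingProb_wiredAdversary F hS A hℓ hXp _ _ _ _ _ _ _ coin κ
      (by rw [hX]; dsimp only; omega), hL.expect]
    · refine Finset.sum_congr rfl fun k _ => ?_
      rw [value_hardWiring]
      rfl
    · intro key hkey
      have h1 := hL κ _ key hkey
      have h2 : (if (t κ).2.2 then key.2 else key.1).length ≤ L κ := by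
        split_ifs
        · exact h1.2
        · exact h1.1
      exact ⟨h2.trans (by rw [hX]; dsimp only; omega), hbd κ _ h2⟩
  refine ⟨fun κ => f κ (t κ), ?_, fun κ z s s' b => ?_⟩
  · have := hhide B
    simp only [hprob] at this
    exact this
  · have := ht κ (z, fun c => if c then s' else s, b)
    simpa only [f, Bool.false_eq_true, if_false, if_true] using this

end WMark
end

noncomputable section

namespace WMark

/-! ### Negligible functions -/

theorem Negligible.polyBounded_mul {ε : ℕ → ℝ} (hε : Negligible ε) {f : ℕ → ℕ}
    (hf : PolyBounded f) : Negligible fun κ => f κ * ε κ := by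
  obtain ⟨p, hp⟩ := hf
  refine (Asymptotics.SuperpolynomialDecay.polynomial_mul hε
    (p.map (Nat.castRingHom ℝ))).trans_abs_le fun κ => ?_
  rw [abs_mul, abs_mul, Polynomial.eval_natCast_map, Nat.abs_cast, eq_natCast, Nat.abs_cast]
  gcongr
  exact hp κ

/-- Eventually (d + 1) log κ is at most ℓ log 2, and then κ^d / 2^ℓ is at most 1/κ. The additional
factor κ is what forces convergence to zero. -/
theorem SuperLog.negligible {ℓ : ℕ → ℕ} (h : SuperLog ℓ) :
    Negligible fun κ => (2 ^ ℓ κ : ℝ)⁻¹ := by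
  intro d
  have hc : 0 < Real.log 2 / (d + 1) := div_pos (Real.log_pos one_lt_two) (by positivity)
  refine squeeze_zero' (g := fun κ : ℕ => (κ : ℝ)⁻¹) (.of_forall fun κ => by positivity) ?_
    tendsto_inv_atTop_nhds_zero_nat
  filter_upwards [h.bound hc, Filter.eventually_gt_atTop 0] with κ h1 h2
  have hκ : (0 : ℝ) < κ := Nat.cast_pos.2 h2
  rw [Real.norm_of_nonneg (Real.log_natCast_nonneg κ), Real.norm_of_nonneg (Nat.cast_nonneg _),
    div_mul_eq_mul_div, le_div_iff₀ (by positivity)] at h1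
  have h3 : (κ : ℝ) ^ (d + 1) ≤ 2 ^ ℓ κ := by
    rw [← Real.log_le_log_iff (by positivity) (by positivity), Real.log_pow, Real.log_pow]
    push_cast
    linarith
  rw [← div_eq_mul_inv, div_le_iff₀ (by positivity), ← div_eq_inv_mul, le_div_iff₀ hκ, ← pow_succ]
  exact h3

/-! ### The security of the construction -/

variable {ℓ w : ℕ → ℕ} {F : TEPRF ℓ} {L n : ℕ → ℕ}

/-- The hybrid data of an instance that does not depend on an unknown key. -/
def samplePair {l L : ℕ} (ext : Bool) (z : Sample l (KeyPair L)) : HardPair l L :=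
  (some z.2.2.2.1, none, some ⟨z.2.2.2.key z.2.2.1, z.2.2.2.length_key_le _⟩,
    if ext then z.1 else z.2.1,
    if ext then some ⟨z.2.2.2.key z.2.2.1, z.2.2.2.length_key_le _⟩ else some z.2.2.2.1)

theorem spec_samplePair {l L : ℕ} (v : List Bool → List Bool → Bool) (ext : Bool)
    (z : Sample l (KeyPair L)) (k : List Bool) : (samplePair ext z).spec v k =
      if ext then extSpec v KeyPair.key z else preSpec v KeyPair.key z := by
  cases ext <;> simp [samplePair, HardPair.spec, optKey, extSpec, preSpec, KeyPair.key]

/-- Changing the experiment for one instance changes the winning probability by little. -/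
theorem TEPRF.Bounded.step (hL : F.Bounded L) (hdiff : F.DifferentValuesOnTarget) {κ n w : ℕ}
    {pre post : Code} {C : Circuit} {ψ : Ket} (hψ : ψ.L2) (h1 : normSq ψ = 1) {δ : ℝ}
    (hδ : ∀ (z : Fin n × Fin w → HardPair (ℓ κ) (L κ)) (s s' : Fin (ℓ κ) → Bool) (b : Bool),
      |∑ k, F.keyWeight (L κ) κ s k * game pre post C ψ (fun p => (z p).spec F.Eval (k.key b)) -
        ∑ k, F.keyWeight (L κ) κ s' k * game pre post C ψ (fun p => (z p).spec F.Eval (k.key b))| ≤ δ)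
    (z : Fin n × Fin w → Sample (ℓ κ) (KeyPair (L κ))) (D : Fin n × Fin w → Bool)
    (p : Fin n × Fin w) :
    ∑ t, F.weights (L κ) κ t * game pre post C ψ (Function.update (fun q =>
        if D q then extSpec F.Eval KeyPair.key (z q) else preSpec F.Eval KeyPair.key (z q)) p
          (preSpec F.Eval KeyPair.key t)) ≤
      ∑ t, F.weights (L κ) κ t * game pre post C ψ (Function.update (fun q =>
        if D q then extSpec F.Eval KeyPair.key (z q) else preSpec F.Eval KeyPair.key (z q)) p
          (extSpec F.Eval KeyPair.key t)) +
        (2 * δ + (2 * ((pre.size + post.size : ℕ) : ℝ) + 1) * (2 ^ ℓ κ : ℝ)⁻¹) := by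
  set R : Fin n × Fin w → PairSpec (ℓ κ) := fun q =>
    if D q then extSpec F.Eval KeyPair.key (z q) else preSpec F.Eval KeyPair.key (z q) with hR
  refine sum_preSpec_le (g := fun r => game pre post C ψ (Function.update R p r))
    (fun s k => TEPRF.keyWeight_nonneg κ s k) (hL.sum_keyWeight κ) (fun r => game_mem hψ h1 _)
    (fun s k hk x => TEPRF.eval_true hdiff hk x) ?_ ?_
  · intro s s' h f b
    -- At position `p` every key is the unknown one and the oracle may be flipped at `f`; all other
    -- positions are completely hard-wired, whether already switched or not.
    have := hδ (fun q => if q = p then (none, f, none, h, none) else samplePair (D q) (z q)) s s' b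
    have he : ∀ k : List Bool, (fun q => HardPair.spec F.Eval
        (if q = p then (none, f, none, h, none) else samplePair (D q) (z q)) k) =
        Function.update R p (flipSpec F.Eval f h k) := by
      intro k
      funext q
      by_cases hq : q = p
      · subst hq
        simp [HardPair.spec, optKey, flipSpec]
      · rw [if_neg hq, Function.update_of_ne hq, spec_samplePair]
    simp only [he] at this
    exact this
  · intro h k
    refine (sum_abs_game_sub_le hψ h1 p (fun s => Function.update R p (flipSpec F.Eval none (h s) k))
      (fun s => Function.update R p (flipSpec F.Eval (some s) (h s) k)) ?_ ?_ ?_ ?_ ?_ ?_ ?_).trans_eq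
      (by push_cast; rfl)
    · intro x x' q
      by_cases hq : q = p
      · subst hq; simp [flipSpec]
      · simp [Function.update_of_ne hq]
    · intro x x' q
      by_cases hq : q = p
      · subst hq; simp [flipSpec]
      · simp [Function.update_of_ne hq]
    · intro x q
      by_cases hq : q = p
      · subst hq; simp [flipSpec]
      · simp [Function.update_of_ne hq]
    · intro x q
      by_cases hq : q = p
      · subst hq; simp [flipSpec]
      · simp [Function.update_of_ne hq]
    · intro x q
      by_cases hq : q = p
      · subst hq; simp [flipSpec]
      · simp [Function.update_of_ne hq]
    · intro x q hq
      simp [Function.update_of_ne hq]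
    · intro x y hy
      simp [flipSpec, hy.symm]

end WMark

end

/-- The watermarkable unpredictable function built from a two-key equivocal PRF is parallel mark
extractable. -/
theorem mainTheorem7 (ℓ w : ℕ → ℕ)
    (hℓ_poly : WMark.PolyBounded ℓ) (hw_poly : WMark.PolyBounded w)
    (hℓ : WMark.SuperLog ℓ) (hw : WMark.SuperLog w)
    (F : WMark.TEPRF ℓ)
    (hdiff : F.DifferentValuesOnTarget) (hhide : F.DifferingPointHiding) :
    (F.toWUPF w).ParallelMarkExtractable := by
  obtain ⟨S, m, T, hS⟩ := F.exists_computes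
  obtain ⟨T', hT⟩ := WMark.exists_extractorTime T
  obtain ⟨L, hLp, hL⟩ := F.exists_bounded hℓ_poly
  refine ⟨WMark.extractor S, T', fun κ n xk C ψ => (WMark.runs_extInput hS hT xk C ψ).haltsIn le_rfl,
    fun n hn A => ?_⟩
  obtain ⟨δ, hδ, hbound⟩ := WMark.exists_hiding_bound hL hLp hℓ_poly hw_poly hn hhide A
  -- The number of pairs that are switched, times the loss for a single pair.
  refine ⟨fun κ => ((n κ * w κ : ℕ) : ℝ) * (2 * δ κ +
    ((2 * ((A.preMark κ).size + (A.postMark κ).size) + 1 : ℕ) : ℝ) * (2 ^ ℓ κ : ℝ)⁻¹), ?_, ?_⟩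
  · refine WMark.Negligible.polyBounded_mul ?_ (hn.mul hw_poly)
    exact Asymptotics.SuperpolynomialDecay.add
      (Asymptotics.SuperpolynomialDecay.const_mul hδ 2)
      (hℓ.negligible.polyBounded_mul (((WMark.PolyBounded.const 2).mul
        (A.preMark_poly.2.add A.postMark_poly.2)).add (.const 1)))
  · intro κ
    obtain ⟨h1, h2⟩ := (A.advice_state κ).normSq
    have h3 := WMark.hybrid_le (F.weights (L κ) κ)
      (WMark.sampleWeight_nonneg fun s k => WMark.TEPRF.keyWeight_nonneg κ s k)
      (WMark.sum_sampleWeight (hL.sum_keyWeight κ)) _ _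
      (WMark.game (A.preMark κ) (A.postMark κ) (A.predictor κ) (A.advice κ)) _
      (hL.step hdiff (n := n κ) (w := w κ) h1 h2 (hbound κ))
    rw [← hL.predictionProb_eq, ← hL.extractionProb_eq hdiff hS hT] at h3
    simp only [Fintype.card_prod, Fintype.card_fin] at h3
    push_cast at h3 ⊢
    linarith
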